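/- Let $\mathcal O_n=\mathrm{End}((\mathbb C^2)^{\otimes n})$ be the operators of $n$ spins $1/2$, with $U\in\mathrm{SU}(2)$ acting by $X\mapsto U^{\otimes n}X(U^{-1})^{\otimes n}$ and $S_n$ acting by permuting the spins. For $G\subseteq\{1,\dots,n\}$ let $\mathcal L(G)\subseteq\mathcal O_n$ be the span of the product operators with a traceless matrix at each spin of $G$ and the identity at every other spin; for $|G|=g$ these are the $g$-linear operators of the subsystem $G$. Write $\varphi_j$ for the irreducible representation of $\mathrm{SU}(2)$ on $\mathbb C^{2j+1}$ ($j\in\{0,1,2,\dots\}$), $\mu_\lambda$ for the irreducible representation of $S_g$ belonging to the partition $\lambda$ of $g$ (with $\mu_{[g]}$ trivial), and $m(\lambda,j)$ for the multiplicity of $\varphi_j\otimes\mu_\lambda$ in the representation $\mathcal L(\{1,\dots,g\})\subseteq\mathcal O_g$ of $\mathrm{SU}(2)\times S_g$. For a standard Young tableau $\tau$ filled with the elements of $G$, define the Young operator $P_\tau\in\mathbb C[S_G]$, up to a nonzero scalar, as follows. Order the tableaux of a shape lexicographically by their entries read row by row. If $\tau$ is the first tableau of its shape, $P_\tau$ is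 the Young symmetrizer (row sum times signed column sum) of $\tau$. If $\tau$ arises from an earlier tableau $\rho$ by exchanging two labels $a<b$ that are consecutive in $G$, then $P_\tau=(d\,(a\,b)+e)P_\rho$, where $d$ is the signed axial distance from $a$ to $b$ in $\rho$ (steps down or left count positively). An operator in $\mathcal L(G)$ has symmetry type $\tau$ if it lies in $P_\tau\mathcal L(G)$. A tensor operator of rank $j$ is a family $(T_m)_{-j\le m\le j}$ with $[J_z,T_m]=mT_m$ and $[J_\pm,T_m]=\sqrt{j(j+1)-m(m\pm1)}\,T_{m\pm1}$, where $J_x,J_y,J_z$ are the total spin operators. 1. For every $g\ge 0$ the $g$-linear operators $\mathcal L(\{1,\dots,g\})$ are equivalent, as a representation of $\mathrm{SU}(2)\times S_g$, to $(\mathbb C^3)^{\otimes g}$ with $\mathrm{SU}(2)$ acting by $\varphi_1^{\otimes g}$ and $S_g$ permuting the factors. 2. For every partition $\lambda$ of some $g\le5$ and every $j$, $m(\lambda,j)\le1$. The pairs with $m(\lambda,j)=1$ are exactly: $[\,]$: $0$; $[1]$: $1$; $[2]$: $0,2$; $[1,1]$: $1$; $[3]$: $1,3$; $[2,1]$: $1,2$;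 $[1,1,1]$: $0$; $[4]$: $0,2,4$; $[3,1]$: $1,2,3$; $[2,2]$: $0,2$; $[2,1,1]$: $1$; $[5]$: $1,3,5$; $[4,1]$: $1,2,3,4$; $[3,2]$: $1,2,3$; $[3,1,1]$: $0,2$; $[2,2,1]$: $1$. 3. Let $n\le5$. For every $G\subseteq\{1,\dots,n\}$, every standard Young tableau $\tau$ of shape $\lambda$ filled with $G$, and every $j$, the space of rank-$j$ tensor operators in $\mathcal L(G)$ of symmetry type $\tau$ has dimension $m(\lambda,j)\le 1$. Consequently the LISA basis needs no labels besides $G$ and $\tau$: there is a choice, for each triple $(G,\tau,j)$ with $m(\lambda,j)>0$, of one rank-$j$ tensor operator $T_j^{G}(\tau)$ in $\mathcal L(G)$ of symmetry type $\tau$, satisfying the Condon–Shortley convention $T_{jm}=(-1)^mT_{j,-m}^\dagger$, such that all components $T_{jm}^G(\tau)$ together form an orthonormal basis of $\mathcal O_n$ for $\langle A,B\rangle=\mathrm{tr}(A^\dagger B)$; and this choice is unique up to one sign for each $(G,\tau,j)$. 4. For six spins, however, $m([4,2],2)=2$. -/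

import Mathlib

open scoped TensorProduct Matrix

noncomputable section

namespace SpinTensor

/-! ### Operators of a system of `n` spins 1/2 -/

/-- The group `SU(2)`. -/
abbrev SU2 : Type := Matrix.specialUnitaryGroup (Fin 2) ℂ

/-- Operators on `(ℂ²)^{⊗n}`; a basis vector of `(ℂ²)^{⊗n}` is a function `Fin n → Fin 2`. -/
abbrev Op (n : ℕ) : Type := Matrix (Fin n → Fin 2) (Fin n → Fin 2) ℂ

/-- The product operator `A₁ ⊗ ⋯ ⊗ Aₙ`. -/
def prodOp {n : ℕ} (A : Fin n → Matrix (Fin 2) (Fin 2) ℂ) : Op n :=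
  Matrix.of fun s t => ∏ k, A k (s k) (t k)

theorem prodOp_mul {n : ℕ} (A B : Fin n → Matrix (Fin 2) (Fin 2) ℂ) :
    prodOp A * prodOp B = prodOp fun k => A k * B k := by
  ext s t
  simp only [prodOp, Matrix.mul_apply, Matrix.of_apply, ← Finset.prod_mul_distrib]
  rw [Finset.prod_univ_sum]
  simp

theorem prodOp_one {n : ℕ} : prodOp (fun _ : Fin n => 1) = 1 := by
  ext s t
  simp only [prodOp, Matrix.of_apply, Matrix.one_apply, Finset.prod_ite_zero,
    Finset.prod_const_one, Finset.mem_univ, true_implies, funext_iff]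

/-- The operators that are linear in every spin of `G` and involve no other spin: the span of the
product operators with a traceless matrix (a complex combination of `Iₓ`, `I_y`, `I_z`) at each
site of `G` and the identity at every other site. For `|G| = g` they are `g`-linear. -/
def linOps {n : ℕ} (G : Finset (Fin n)) : Submodule ℂ (Op n) :=
  Submodule.span ℂ {X | ∃ A : Fin n → Matrix (Fin 2) (Fin 2) ℂ,
    (∀ k ∈ G, (A k).trace = 0) ∧ (∀ k ∉ G, A k = 1) ∧ X = prodOp A}

/-- Simultaneous rotation of all spins: `X ↦ U^{⊗n} X (U⁻¹)^{⊗n}`. -/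
def rotRep (n : ℕ) : Representation ℂ SU2 (Op n) where
  toFun U := LinearMap.mulLeft ℂ (prodOp fun _ => U.1) ∘ₗ
    LinearMap.mulRight ℂ (prodOp fun _ => (U⁻¹).1)
  map_one' := by
    ext1 X
    simp [prodOp_one]
  map_mul' U V := by
    ext1 X
    simp [← prodOp_mul, mul_assoc]

/-- Permutation of the spins: `σ (A₁ ⊗ ⋯ ⊗ Aₙ) = A_{σ⁻¹ 1} ⊗ ⋯ ⊗ A_{σ⁻¹ n}`
(see `permRep_prodOp`). -/
def permRep (n : ℕ) : Representation ℂ (Equiv.Perm (Fin n)) (Op n) where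
  toFun σ :=
    { toFun := fun X => Matrix.of fun s t => X (s ∘ σ) (t ∘ σ)
      map_add' := fun _ _ => rfl
      map_smul' := fun _ _ => rfl }
  map_one' := rfl
  map_mul' _ _ := rfl

theorem permRep_prodOp {n : ℕ} (σ : Equiv.Perm (Fin n)) (A : Fin n → Matrix (Fin 2) (Fin 2) ℂ) :
    permRep n σ (prodOp A) = prodOp fun k => A (σ⁻¹ k) := by
  ext s t
  change ∏ k, A k (s (σ k)) (t (σ k)) = ∏ k, A (σ⁻¹ k) (s k) (t k)
  rw [← Equiv.prod_comp σ (fun k => A (σ⁻¹ k) (s k) (t k))]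
  simp

theorem permRep_mul {n : ℕ} (σ : Equiv.Perm (Fin n)) (X Y : Op n) :
    permRep n σ (X * Y) = permRep n σ X * permRep n σ Y := by
  ext s t
  change ∑ u, X (s ∘ σ) u * Y u (t ∘ σ) = ∑ u, X (s ∘ σ) (u ∘ σ) * Y (u ∘ σ) (t ∘ σ)
  exact (Equiv.sum_comp (Equiv.arrowCongr σ.symm (Equiv.refl (Fin 2)))
    (fun u => X (s ∘ σ) u * Y u (t ∘ σ))).symm

theorem rot_perm_commute {n : ℕ} (U : SU2) (σ : Equiv.Perm (Fin n)) :
    rotRep n U * permRep n σ = permRep n σ * rotRep n U := by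
  ext1 X
  simp [rotRep, permRep_mul, permRep_prodOp]

/-- The action of `SU(2) × Sₙ` on the operators of `n` spins. -/
def opRep (n : ℕ) : Representation ℂ (SU2 × Equiv.Perm (Fin n)) (Op n) where
  toFun x := rotRep n x.1 * permRep n x.2
  map_one' := by simp
  map_mul' x y := by
    simp only [Prod.fst_mul, Prod.snd_mul, map_mul]
    rw [mul_assoc, ← mul_assoc (rotRep n y.1), rot_perm_commute y.1 x.2]
    simp only [mul_assoc]

theorem linOps_invariant (n : ℕ) (x : SU2 × Equiv.Perm (Fin n)) :
    linOps (Finset.univ : Finset (Fin n)) ≤ (linOps Finset.univ).comap (opRep n x) := by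
  refine Submodule.span_le.2 ?_
  rintro X ⟨A, hA, -, rfl⟩
  refine Submodule.subset_span ⟨fun k => x.1.1 * (A (x.2⁻¹ k) * (x.1⁻¹).1), ?_, by simp, ?_⟩
  · intro k _
    rw [Matrix.trace_mul_comm, mul_assoc, ← Submonoid.coe_mul, inv_mul_cancel]
    simpa using hA (x.2⁻¹ k) (Finset.mem_univ _)
  · simp [opRep, rotRep, permRep_prodOp, prodOp_mul]

/-- The `g`-linear operators of a `g`-spin system as a representation of `SU(2) × S_g`. -/
def linRep (g : ℕ) :
    Representation ℂ (SU2 × Equiv.Perm (Fin g)) (linOps (Finset.univ : Finset (Fin g))) :=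
  (opRep g).subrepresentation _ (linOps_invariant g)

/-! ### Irreducible representations of `SU(2)` and tensor powers of `φ₁` -/

/-- The substitution `X_i ↦ ∑_k U_{k i} X_k` in two variables. -/
def substAlg (U : Matrix (Fin 2) (Fin 2) ℂ) :
    MvPolynomial (Fin 2) ℂ →ₐ[ℂ] MvPolynomial (Fin 2) ℂ :=
  MvPolynomial.aeval fun i => ∑ k, MvPolynomial.C (U k i) * MvPolynomial.X k

theorem substAlg_mul (U V : Matrix (Fin 2) (Fin 2) ℂ) :
    substAlg (U * V) = (substAlg U).comp (substAlg V) := by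
  ext1 i
  simp only [substAlg, AlgHom.comp_apply, MvPolynomial.aeval_X, Matrix.mul_apply,
    Fin.sum_univ_two, map_add, map_mul, MvPolynomial.algHom_C, MvPolynomial.algebraMap_eq]
  ring

theorem substAlg_one : substAlg 1 = AlgHom.id ℂ _ := by
  ext1 i
  fin_cases i <;> simp [substAlg]

theorem substAlg_homogeneous (U : Matrix (Fin 2) (Fin 2) ℂ) (d : ℕ) :
    MvPolynomial.homogeneousSubmodule (Fin 2) ℂ d ≤
      (MvPolynomial.homogeneousSubmodule (Fin 2) ℂ d).comap (substAlg U).toLinearMap := by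
  intro p hp
  have h : (MvPolynomial.aeval (fun i : Fin 2 =>
      ∑ k, MvPolynomial.C (U k i) * MvPolynomial.X k) p).IsHomogeneous (1 * d) := by
    refine MvPolynomial.IsHomogeneous.aeval hp _ fun i => ?_
    refine MvPolynomial.IsHomogeneous.sum _ _ _ fun k _ => ?_
    simpa using (MvPolynomial.isHomogeneous_C (Fin 2) (U k i)).mul
      (MvPolynomial.isHomogeneous_X ℂ k)
  rw [one_mul] at h
  exact h

/-- `ℂ^{2j+1}`, realised as the binary forms of degree `2j`. -/
abbrev SpinSpace (j : ℕ) : Type :=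
  MvPolynomial.homogeneousSubmodule (Fin 2) ℂ (2 * j)

/-- The irreducible representation `φ_j` of `SU(2)` of (integer) rank `j`. -/
def spinRep (j : ℕ) : Representation ℂ SU2 (SpinSpace j) where
  toFun U := (substAlg U.1).toLinearMap.restrict (substAlg_homogeneous U.1 (2 * j))
  map_one' := by
    ext1 p
    apply Subtype.ext
    simp [LinearMap.restrict_apply, substAlg_one]
  map_mul' U V := by
    ext1 p
    apply Subtype.ext
    simp [LinearMap.restrict_apply, substAlg_mul]

/-- `⨂^g ℂ³` with `SU(2)` acting by `φ₁^{⊗g}` and `S_g` permuting the factors. -/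
def tensorPowerRep (g : ℕ) :
    Representation ℂ (SU2 × Equiv.Perm (Fin g)) (⨂[ℂ] _ : Fin g, SpinSpace 1) where
  toFun x := (PiTensorProduct.reindex ℂ (fun _ : Fin g => SpinSpace 1) x.2).toLinearMap ∘ₗ
    PiTensorProduct.map fun _ => spinRep 1 x.1
  map_one' := by
    ext v
    simp
    rfl
  map_mul' x y := by
    ext v
    simp [PiTensorProduct.map_tprod]
    rfl

/-! ### Young tableaux, Young symmetrizers, irreducible representations of `S_g` -/

variable {μ : YoungDiagram} {α : Type} [Fintype α] [LinearOrder α]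

/-- The row of the box of `t` that contains `x`. -/
def rowOf (t : μ.cells ≃ α) (x : α) : ℕ := (t.symm x).1.1

/-- The column of the box of `t` that contains `x`. -/
def colOf (t : μ.cells ≃ α) (x : α) : ℕ := (t.symm x).1.2

/-- Standard Young tableaux of shape `μ` whose boxes are filled bijectively with `α`. -/
structure StdTableau (μ : YoungDiagram) (α : Type) [LinearOrder α] where
  entry : μ.cells ≃ α
  row_strict : ∀ c c' : μ.cells, c.1.1 = c'.1.1 → c.1.2 < c'.1.2 → entry c < entry c'
  col_strict : ∀ c c' : μ.cells, c.1.2 = c'.1.2 → c.1.1 < c'.1.1 → entry c < entry c'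

/-- The order of the tableaux of a fixed shape: `p` precedes `q` if the filling pattern of `p`,
read row by row, is lexicographically smaller than that of `q`. -/
def StdTableau.Before (p q : StdTableau μ α) : Prop :=
  ∃ c : μ.cells, p.entry c < q.entry c ∧
    ∀ c' : μ.cells, toLex c'.1 < toLex c.1 → p.entry c' = q.entry c'

/-- The sum `H_t` of all row-wise permutations of `t`. -/
def rowSum (t : μ.cells ≃ α) : MonoidAlgebra ℂ (Equiv.Perm α) :=
  ∑ σ : Equiv.Perm α with ∀ x, rowOf t (σ x) = rowOf t x, MonoidAlgebra.of ℂ _ σ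

/-- The signed sum `V_t` of all column-wise permutations of `t`. -/
def colSum (t : μ.cells ≃ α) : MonoidAlgebra ℂ (Equiv.Perm α) :=
  ∑ σ : Equiv.Perm α with ∀ x, colOf t (σ x) = colOf t x,
    ((Equiv.Perm.sign σ : ℤ) : ℂ) • MonoidAlgebra.of ℂ _ σ

/-- The Young symmetrizer `e_t = f H_t V_t`, where `f` is the number of standard Young tableaux
of the shape of `t` divided by `g!`. -/
def youngSymmetrizer (t : μ.cells ≃ α) : MonoidAlgebra ℂ (Equiv.Perm α) :=
  ((Nat.card (StdTableau μ α) : ℂ) / ((Fintype.card α).factorial : ℂ)) • (rowSum t * colSum t)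

/-- The boxes of `μ` numbered row by row. -/
def rowReading (μ : YoungDiagram) : μ.cells ≃ Fin μ.card :=
  ((toLex (α := ℕ × ℕ)).subtypeEquiv (by simp)).trans
    ((μ.cells.map (toLex (α := ℕ × ℕ)).toEmbedding).orderIsoOfFin
      (k := μ.card) (by rw [Finset.card_map])).symm.toEquiv

/-- The left ideal `ℂ[S_g] e` generated by the Young symmetrizer of the row-by-row numbering. -/
def spechtModule (μ : YoungDiagram) :
    Submodule ℂ (MonoidAlgebra ℂ (Equiv.Perm (Fin μ.card))) :=
  LinearMap.range (LinearMap.mulRight ℂ (youngSymmetrizer (rowReading μ)))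

/-- The irreducible representation of `S_g` indexed by the partition `μ` of `g`: left
multiplication on `ℂ[S_g] e`. -/
def spechtRep (μ : YoungDiagram) :
    Representation ℂ (Equiv.Perm (Fin μ.card)) (spechtModule μ) where
  toFun σ := (LinearMap.mulLeft ℂ (MonoidAlgebra.of ℂ _ σ)).restrict (by
    rintro _ ⟨y, rfl⟩
    exact ⟨MonoidAlgebra.of ℂ _ σ * y, by simp [mul_assoc]⟩)
  map_one' := by
    ext1 p
    apply Subtype.ext
    simp only [map_one, LinearMap.restrict_apply, LinearMap.mulLeft_apply, one_mul]
    rfl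
  map_mul' σ τ := by
    ext1 p
    apply Subtype.ext
    simp only [map_mul, LinearMap.restrict_apply, LinearMap.mulLeft_apply, mul_assoc,
      Module.End.mul_apply]

/-- How often the pair `(λ, j)` occurs in the `g`-linear operators of `g = |λ|` spins: the
multiplicity of the irreducible representation `φ_j ⊗ μ_λ` of `SU(2) × S_g` in them, i.e. the
dimension of the space of equivariant maps. -/
def rankMultiplicity (lam : YoungDiagram) (j : ℕ) : ℕ :=
  Module.finrank ℂ (Representation.IntertwiningMap
    (Representation.tprod
      ((spinRep j).comp (MonoidHom.fst SU2 (Equiv.Perm (Fin lam.card))))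
      ((spechtRep lam).comp (MonoidHom.snd SU2 (Equiv.Perm (Fin lam.card)))))
    (linRep lam.card))

/-- The ranks occurring for a partition of `g ≤ 5`. -/
def rankTable : List ℕ → Finset ℕ
  | [] => {0}
  | [1] => {1}
  | [2] => {0, 2}
  | [1, 1] => {1}
  | [3] => {1, 3}
  | [2, 1] => {1, 2}
  | [1, 1, 1] => {0}
  | [4] => {0, 2, 4}
  | [3, 1] => {1, 2, 3}
  | [2, 2] => {0, 2}
  | [2, 1, 1] => {1}
  | [5] => {1, 3, 5}
  | [4, 1] => {1, 2, 3, 4}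
  | [3, 2] => {1, 2, 3}
  | [3, 1, 1] => {0, 2}
  | [2, 2, 1] => {1}
  | _ => ∅

/-! ### Tensor operators and the LISA basis -/

/-- `Iₓ = σₓ / 2`. -/
def spinX : Matrix (Fin 2) (Fin 2) ℂ := !![0, 1 / 2; 1 / 2, 0]

/-- `I_y = σ_y / 2`. -/
def spinY : Matrix (Fin 2) (Fin 2) ℂ := !![0, -Complex.I / 2; Complex.I / 2, 0]

/-- `I_z = σ_z / 2`. -/
def spinZ : Matrix (Fin 2) (Fin 2) ℂ := !![1 / 2, 0; 0, -1 / 2]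

/-- The sum over all spins of the one-spin operator `M`. -/
def totalOp (n : ℕ) (M : Matrix (Fin 2) (Fin 2) ℂ) : Op n :=
  ∑ k, prodOp (Function.update (fun _ => 1) k M)

/-- The raising operator `J₊ = Jₓ + i J_y`. -/
def raiseOp (n : ℕ) : Op n := totalOp n spinX + Complex.I • totalOp n spinY

/-- The lowering operator `J₋ = Jₓ - i J_y`. -/
def lowerOp (n : ℕ) : Op n := totalOp n spinX - Complex.I • totalOp n spinY

/-- The tensor operators of rank `j` with all components in `W`: families `T m`, `-j ≤ m ≤ j`
(extended by `0` to other `m`), that satisfy Racah's commutation relations. -/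
def tensorOperators {n : ℕ} (W : Submodule ℂ (Op n)) (j : ℕ) : Submodule ℂ (ℤ → Op n) where
  carrier := {T | (∀ m, T m ∈ W) ∧ (∀ m, (j : ℤ) < |m| → T m = 0) ∧
    ∀ m : ℤ, |m| ≤ (j : ℤ) →
      totalOp n spinZ * T m - T m * totalOp n spinZ = (m : ℂ) • T m ∧
      raiseOp n * T m - T m * raiseOp n =
        (Real.sqrt ((j : ℝ) * (j + 1) - m * (m + 1)) : ℂ) • T (m + 1) ∧
      lowerOp n * T m - T m * lowerOp n =
        (Real.sqrt ((j : ℝ) * (j + 1) - m * (m - 1)) : ℂ) • T (m - 1)}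
  zero_mem' := by simp
  add_mem' := by
    rintro S T ⟨hS1, hS2, hS3⟩ ⟨hT1, hT2, hT3⟩
    refine ⟨fun m => W.add_mem (hS1 m) (hT1 m), fun m hm => ?_, fun m hm => ?_⟩
    · simp [hS2 m hm, hT2 m hm]
    · obtain ⟨a, b, c⟩ := hS3 m hm
      obtain ⟨a', b', c'⟩ := hT3 m hm
      have h : ∀ A X Y : Op n, A * (X + Y) - (X + Y) * A = (A * X - X * A) + (A * Y - Y * A) :=
        fun A X Y => by rw [mul_add, add_mul]; abel
      simp only [Pi.add_apply, h, smul_add, a, b, c, a', b', c', and_self]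
  smul_mem' := by
    rintro z T ⟨hT1, hT2, hT3⟩
    refine ⟨fun m => W.smul_mem z (hT1 m), fun m hm => ?_, fun m hm => ?_⟩
    · simp [hT2 m hm]
    · obtain ⟨a, b, c⟩ := hT3 m hm
      simp only [Pi.smul_apply, mul_smul_comm, smul_mul_assoc, ← smul_sub, a, b, c]
      exact ⟨smul_comm _ _ _, smul_comm _ _ _, smul_comm _ _ _⟩

/-- The orthogonalised Young operators belonging to a standard tableau, up to a nonzero scalar:
the Young symmetrizer for the first tableau of each shape, and `(d (a b) + e) P` for the tableau
`p` obtained from an earlier one `q` with operator `P` by exchanging the consecutive labels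
`a < b`; here `d` is the signed axial distance from the box of `a` to the box of `b` in `q`, where
steps down or to the left count positively. -/
inductive IsYoungOperator :
    StdTableau μ α → MonoidAlgebra ℂ (Equiv.Perm α) → Prop
  | first (q : StdTableau μ α) (hq : ∀ p : StdTableau μ α, ¬ p.Before q) :
      IsYoungOperator q (youngSymmetrizer q.entry)
  | step (q p : StdTableau μ α) (P : MonoidAlgebra ℂ (Equiv.Perm α)) (a b : α)
      (hP : IsYoungOperator q P) (hqp : q.Before p) (hab : a ⋖ b)
      (hp : p.entry = q.entry.trans (Equiv.swap a b)) :
      IsYoungOperator p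
        (((((rowOf q.entry b : ℤ) - rowOf q.entry a + (colOf q.entry a - colOf q.entry b) : ℤ) : ℂ) •
          MonoidAlgebra.of ℂ _ (Equiv.swap a b) + 1) * P)

/-- The permutations of a set `G` of spins acting on the operators of `n` spins. -/
def subPermRep {n : ℕ} (G : Finset (Fin n)) :
    Representation ℂ (Equiv.Perm G) (Op n) :=
  (permRep n).comp (Equiv.Perm.ofSubtype (p := fun k => k ∈ G))

/-- A label `(G, τ)`: a set of spins and a standard Young tableau filled with its elements. -/
structure Label (n : ℕ) where
  subsystem : Finset (Fin n)
  shape : YoungDiagram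
  tableau : StdTableau shape subsystem

/-- The operators linear in exactly the spins of `G` that have symmetry type `τ` under the
permutations of `G`: the image of the Young operator of `τ`. (All Young operators of `τ` have the
same image.) -/
def Label.space {n : ℕ} (l : Label n) : Submodule ℂ (Op n) :=
  ⨆ (P : MonoidAlgebra ℂ (Equiv.Perm l.subsystem)) (_ : IsYoungOperator l.tableau P),
    (linOps l.subsystem).map ((subPermRep l.subsystem).asAlgebraHom P)

/-- A label `(G, τ)` together with a rank that occurs for the shape of `τ`. -/
structure TensorLabel (n : ℕ) extends Label n where
  rank : ℕ
  occurs : 0 < rankMultiplicity shape rank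

/-- A LISA tensor operator basis of the operators of `n` spins that is labelled by subsystem,
standard Young tableau and rank alone: for each such label one tensor operator of that rank and
symmetry, with the Condon-Shortley phase convention, such that all components together are an
orthonormal basis for the inner product `tr(A† B)`. -/
structure IsLISABasis {n : ℕ} (T : TensorLabel n → ℤ → Op n) : Prop where
  mem : ∀ l, T l ∈ tensorOperators l.space l.rank
  phase : ∀ l m, T l m = ((-1 : ℂ) ^ m) • (T l (-m))ᴴ
  normalized : ∀ l (m : ℤ), |m| ≤ (l.rank : ℤ) → ((T l m)ᴴ * T l m).trace = 1
  orthogonal : ∀ l l' m m', (l, m) ≠ (l', m') → ((T l m)ᴴ * T l' m').trace = 0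
  complete : Submodule.span ℂ (Set.range fun x : TensorLabel n × ℤ => T x.1 x.2) = ⊤

end SpinTensor

end

set_option linter.unusedSectionVars false
open scoped TensorProduct Matrix

noncomputable section

namespace SpinTensor

/-! ### Product operators -/

/-! Almost everything comes down to weight multiplicities. The operators `linOps G` have an
orthogonal basis of words in three traceless letters of weights -1, 0 and 1 (`span_wordOp`,
`ip_wordOp`), and the permutations of `G` permute these words. For the trace form the commutators
with J₊ and J₋ are adjoint to each other (`ip_adTotal`), so the highest weight theory of sl₂ follows
from positivity alone. In a space `W` stable under both, the dimension of the space of rank-j tensor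
operators is dim W_j - dim W_{j+1} (`finrank_tensorOperators`).

An intertwiner on φ_j ⊗ ℂ[S_g]e is determined by its values on φ_j ⊗ e, where e is the Young
symmetrizer. Hence m(λ, j) is the dimension of the space of SU(2)-equivariant maps from φ_j to e
applied to the g-linear operators (`range_evalGenerator`). Differentiating along one-parameter
groups identifies these maps with tensor operators (`equivariant_iff`, `finrank_equivariantMaps`),
and m(λ, j) becomes a difference of two weight multiplicities. Up to a factor e is HV, the row sum
times the signed column sum, and (HV)² = κHV by von Neumann's lemma (`exists_symmetrizer_sq`). So κ
times the dimension of a weight space of the image is a trace, that is, a signed count of words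
fixed by permutations (`scalar_mul_finrank`). The generating function of these traces, evaluated at
1000, carries all the dimensions as digits, since they are at most 3^6 = 729. Its value is computed
for every partition of g ≤ 5 and for [4,2] (`checkShape_partitions`, `checkShape_four_two`).

For the bases, the Jucys-Murphy elements act on a Young operator of τ by the contents of τ
(`IsYoungOperator.jucysMurphy_mul`). They are self-adjoint, and the contents determine a standard
tableau together with its shape (`StdTableau.eq_of_content`), so different symmetry types are
orthogonal. Their dimensions add up to at least 3^g (`sum_tableauCount`, `tableauCount_le`), hence
they fill the g-linear operators (`iSup_symmetrySpace`). It follows that a symmetry type is a full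
joint eigenspace of the Jucys-Murphy elements; in particular it does not depend on the Young
operator chosen and is closed under the adjoint. Each label then carries a single line of tensor
operators. The map T ↦ (-1)^m (T_{-m})† is an antilinear involution of this line; its fixed vectors
of norm one are unique up to sign (`exists_isLISABasis`).

The comparison with (ℂ³)^{⊗g} rests on the classical identification of traceless 2×2 matrices with
binary quadratic forms (`substAlg_quadForm`), carried to tensor powers factor by factor. -/

/-- One-spin operators. -/
abbrev Qubit : Type := Matrix (Fin 2) (Fin 2) ℂ

/-- The trace form `tr(A† B)`. -/
def ip {n : ℕ} (A B : Op n) : ℂ := (Aᴴ * B).trace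

theorem ip_add_right {n : ℕ} (A B C : Op n) : ip A (B + C) = ip A B + ip A C := by
  simp [ip, mul_add]

theorem ip_smul_right {n : ℕ} (A B : Op n) (c : ℂ) : ip A (c • B) = c * ip A B := by
  simp [ip]

theorem ip_add_left {n : ℕ} (A B C : Op n) : ip (A + B) C = ip A C + ip B C := by
  simp [ip, add_mul]

theorem ip_smul_left {n : ℕ} (A B : Op n) (c : ℂ) : ip (c • A) B = star c * ip A B := by
  simp [ip]

@[simp] theorem ip_zero_right {n : ℕ} (A : Op n) : ip A 0 = 0 := by simp [ip]

@[simp] theorem ip_zero_left {n : ℕ} (A : Op n) : ip 0 A = 0 := by simp [ip]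

theorem ip_sum_right {n : ℕ} {ι : Type*} (s : Finset ι) (A : Op n) (B : ι → Op n) :
    ip A (∑ i ∈ s, B i) = ∑ i ∈ s, ip A (B i) := by
  simp [ip, Finset.mul_sum, Matrix.trace_sum]

theorem ip_sum_left {n : ℕ} {ι : Type*} (s : Finset ι) (A : Op n) (B : ι → Op n) :
    ip (∑ i ∈ s, B i) A = ∑ i ∈ s, ip (B i) A := by
  simp [ip, Finset.sum_mul, Matrix.trace_sum, Matrix.conjTranspose_sum]

theorem star_ip {n : ℕ} (A B : Op n) : star (ip A B) = ip B A := by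
  rw [ip, ← Matrix.trace_conjTranspose]
  simp [ip]

open scoped ComplexOrder in
theorem ip_self_eq_zero {n : ℕ} {A : Op n} : ip A A = 0 ↔ A = 0 :=
  Matrix.trace_conjTranspose_mul_self_eq_zero_iff

theorem ip_self_eq_re {n : ℕ} (A : Op n) : ip A A = ((ip A A).re : ℂ) := by
  have h := star_ip A A
  exact (Complex.conj_eq_iff_re.1 h).symm

open scoped ComplexOrder in
theorem ip_self_re_nonneg {n : ℕ} (A : Op n) : 0 ≤ (ip A A).re := by
  have h := (Matrix.posSemidef_conjTranspose_mul_self A).trace_nonneg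
  exact (Complex.nonneg_iff.1 h).1

theorem prodOp_apply {n : ℕ} (A : Fin n → Qubit) (s t : Fin n → Fin 2) :
    prodOp A s t = ∏ k, A k (s k) (t k) := rfl

theorem conjTranspose_prodOp {n : ℕ} (A : Fin n → Qubit) :
    (prodOp A)ᴴ = prodOp fun k => (A k)ᴴ := by
  ext s t
  simp [prodOp, Matrix.conjTranspose_apply]

theorem trace_prodOp {n : ℕ} (A : Fin n → Qubit) : (prodOp A).trace = ∏ k, (A k).trace := by
  simp only [Matrix.trace, Matrix.diag_apply, prodOp_apply]
  rw [Finset.prod_univ_sum]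
  simp

theorem ip_prodOp {n : ℕ} (A B : Fin n → Qubit) :
    ip (prodOp A) (prodOp B) = ∏ k, ((A k)ᴴ * B k).trace := by
  rw [ip, conjTranspose_prodOp, prodOp_mul, trace_prodOp]

theorem prodOp_update_add {n : ℕ} (A : Fin n → Qubit) (k : Fin n) (x y : Qubit) :
    prodOp (Function.update A k (x + y)) =
      prodOp (Function.update A k x) + prodOp (Function.update A k y) := by
  ext s t
  simp only [prodOp_apply, Matrix.add_apply,
    ← Finset.mul_prod_erase _ _ (Finset.mem_univ k), Function.update_self, add_mul]
  congr 1 <;> congr 1 <;> refine Finset.prod_congr rfl fun l hl => ?_ <;>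
    simp [Function.update_of_ne (Finset.ne_of_mem_erase hl)]

theorem prodOp_update_smul {n : ℕ} (A : Fin n → Qubit) (k : Fin n) (c : ℂ) (x : Qubit) :
    prodOp (Function.update A k (c • x)) = c • prodOp (Function.update A k x) := by
  ext s t
  simp only [prodOp_apply, Matrix.smul_apply, smul_eq_mul,
    ← Finset.mul_prod_erase _ _ (Finset.mem_univ k), Function.update_self, mul_assoc]
  congr 2
  refine Finset.prod_congr rfl fun l hl => ?_
  simp [Function.update_of_ne (Finset.ne_of_mem_erase hl)]

theorem prodOp_update_zero {n : ℕ} (A : Fin n → Qubit) (k : Fin n) :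
    prodOp (Function.update A k 0) = 0 := by
  simpa using prodOp_update_smul A k 0 0

/-! ### Words in three letters, placed on a chosen set of sites -/

section Embed

variable {α : Type} {n : ℕ} (e : α ↪ Fin n)

/-- `A` on the sites `e a` and the identity elsewhere. -/
def siteMats (A : α → Qubit) : Fin n → Qubit := Function.extend e A fun _ => 1

@[simp] theorem siteMats_apply (A : α → Qubit) (a : α) : siteMats e A (e a) = A a :=
  e.injective.extend_apply _ _ _

theorem siteMats_refl (A : Fin n → Qubit) : siteMats (Function.Embedding.refl (Fin n)) A = A :=
  funext fun k => siteMats_apply (Function.Embedding.refl (Fin n)) A k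

theorem siteMats_of_notMem (A : α → Qubit) {k : Fin n} (hk : ∀ a, e a ≠ k) :
    siteMats e A k = 1 :=
  Function.extend_apply' _ _ _ fun ⟨a, ha⟩ => hk a ha

theorem siteMats_update [DecidableEq α] (A : α → Qubit) (a : α) (x : Qubit) :
    siteMats e (Function.update A a x) = Function.update (siteMats e A) (e a) x := by
  funext k
  by_cases hk : ∃ b, e b = k
  · obtain ⟨b, rfl⟩ := hk
    by_cases hb : b = a
    · subst hb; simp
    · rw [siteMats_apply, Function.update_of_ne hb,
        Function.update_of_ne (e.injective.ne hb), siteMats_apply]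
  · push Not at hk
    rw [siteMats_of_notMem e _ hk, Function.update_of_ne (hk a).symm, siteMats_of_notMem e _ hk]

/-- The operator with `A a` at the site `e a` and the identity at every other site. -/
def embedOp : MultilinearMap ℂ (fun _ : α => Qubit) (Op n) where
  toFun A := prodOp (siteMats e A)
  map_update_add' A a x y := by simp only [siteMats_update, prodOp_update_add]
  map_update_smul' A a c x := by simp only [siteMats_update, prodOp_update_smul]

theorem embedOp_apply (A : α → Qubit) : embedOp e A = prodOp (siteMats e A) := rfl

/-- A basis of the traceless matrices; `letter i` has weight `i - 1`. -/
def letter : Fin 3 → Qubit := ![!![0, 0; 1, 0], !![1, 0; 0, -1], !![0, 1; 0, 0]]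

theorem trace_letter (i : Fin 3) : (letter i).trace = 0 := by
  fin_cases i <;> simp [letter, Matrix.trace_fin_two]

theorem letter_orthogonal {i j : Fin 3} (h : i ≠ j) : ((letter i)ᴴ * letter j).trace = 0 := by
  fin_cases i <;> fin_cases j <;>
    simp_all [letter, Matrix.trace_fin_two, Matrix.mul_apply, Fin.sum_univ_two]

theorem letter_normalized (i : Fin 3) : ((letter i)ᴴ * letter i).trace ≠ 0 := by
  fin_cases i <;> simp [letter, Matrix.trace_fin_two, Matrix.mul_apply, Fin.sum_univ_two]

theorem eq_sum_letter {A : Qubit} (h : A.trace = 0) :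
    A = ∑ i, (![A 1 0, A 0 0, A 0 1] : Fin 3 → ℂ) i • letter i := by
  have h' : A 1 1 = - A 0 0 := by
    rw [Matrix.trace_fin_two] at h
    linear_combination h
  ext i j
  fin_cases i <;> fin_cases j <;> simp [Fin.sum_univ_three, letter, Matrix.add_apply, h']

/-- The operator spelt by the word `f`. -/
def wordOp (f : α → Fin 3) : Op n := embedOp e fun a => letter (f a)

variable [Fintype α]

/-- Each traceless factor is a combination of the three letters, and the product operator is
multilinear in its factors. -/
theorem span_wordOp : Submodule.span ℂ (Set.range (wordOp e)) = linOps (Finset.univ.map e) := by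
  classical
  refine le_antisymm (Submodule.span_le.2 ?_) (Submodule.span_le.2 ?_)
  · rintro _ ⟨f, rfl⟩
    refine Submodule.subset_span ⟨siteMats e fun a => letter (f a), ?_, ?_, rfl⟩
    · intro k hk
      obtain ⟨a, -, rfl⟩ := Finset.mem_map.1 hk
      simp [trace_letter]
    · intro k hk
      exact siteMats_of_notMem e _ fun a ha => hk (by simp [← ha])
  · rintro _ ⟨A, hA, hA', rfl⟩
    have h : siteMats e (fun a => A (e a)) = A := by
      funext k
      by_cases hk : ∃ b, e b = k
      · obtain ⟨b, rfl⟩ := hk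
        simp
      · push Not at hk
        rw [siteMats_of_notMem e _ hk, hA' k (by simpa using hk)]
    have h2 : prodOp A = embedOp e fun a => A (e a) := by rw [embedOp_apply, h]
    have h3 : (fun a => A (e a)) = fun a => ∑ i, (![A (e a) 1 0, A (e a) 0 0, A (e a) 0 1] :
        Fin 3 → ℂ) i • letter i := by
      funext a
      exact eq_sum_letter (hA (e a) (by simp))
    rw [h2, h3, MultilinearMap.map_sum]
    refine Submodule.sum_mem _ fun f _ => ?_
    rw [MultilinearMap.map_smul_univ]
    exact Submodule.smul_mem _ _ (Submodule.subset_span ⟨f, rfl⟩)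

/-- The trace form of product operators factorises over the sites. Distinct letters are orthogonal,
while a letter or the identity paired with itself gives a nonzero factor. -/
theorem ip_wordOp (f f' : α → Fin 3) :
    ip (wordOp e f) (wordOp e f') = 0 ↔ f ≠ f' := by
  classical
  rw [wordOp, wordOp, embedOp_apply, embedOp_apply, ip_prodOp, Finset.prod_eq_zero_iff]
  constructor
  · rintro ⟨k, -, hk⟩ rfl
    by_cases h : ∃ b, e b = k
    · obtain ⟨b, rfl⟩ := h
      simp only [siteMats_apply] at hk
      exact letter_normalized _ hk
    · push Not at h
      simp [siteMats_of_notMem e _ h] at hk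
  · intro h
    obtain ⟨a, ha⟩ := Function.ne_iff.1 h
    exact ⟨e a, Finset.mem_univ _, by simpa using letter_orthogonal ha⟩

theorem linearIndependent_wordOp : LinearIndependent ℂ (wordOp e) := by
  classical
  rw [Fintype.linearIndependent_iff]
  intro c hc f
  have h : ip (wordOp e f) (∑ i, c i • wordOp e i) = 0 := by rw [hc, ip_zero_right]
  rw [ip_sum_right, Finset.sum_eq_single f] at h
  · rw [ip_smul_right, mul_eq_zero] at h
    exact h.resolve_right fun h => (ip_wordOp e f f).1 h rfl
  · intro f' _ hf
    rw [ip_smul_right, (ip_wordOp e f f').2 hf.symm, mul_zero]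
  · simp

end Embed

/-! ### Different subsystems -/

theorem ip_eq_zero_of_span {n : ℕ} {s t : Set (Op n)}
    (h : ∀ A ∈ s, ∀ B ∈ t, ip A B = 0) {A B : Op n} (hA : A ∈ Submodule.span ℂ s)
    (hB : B ∈ Submodule.span ℂ t) : ip A B = 0 := by
  induction hA, hB using Submodule.span_induction₂ with
  | mem_mem x y hx hy => exact h x hx y hy
  | zero_left => simp
  | zero_right => simp
  | add_left x y z _ _ _ h1 h2 => rw [ip_add_left, h1, h2, add_zero]
  | add_right x y z _ _ _ h1 h2 => rw [ip_add_right, h1, h2, add_zero]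
  | smul_left c x y _ _ h1 => rw [ip_smul_left, h1, mul_zero]
  | smul_right c x y _ _ h1 => rw [ip_smul_right, h1, mul_zero]

/-- At a site belonging to only one of the two sets, a traceless factor meets the identity, so this
factor of the trace vanishes. -/
theorem ip_linOps {n : ℕ} {G G' : Finset (Fin n)} (hG : G ≠ G') {A B : Op n}
    (hA : A ∈ linOps G) (hB : B ∈ linOps G') : ip A B = 0 := by
  refine ip_eq_zero_of_span ?_ hA hB
  rintro _ ⟨A, hA, hA', rfl⟩ _ ⟨B, hB, hB', rfl⟩
  rw [ip_prodOp, Finset.prod_eq_zero_iff]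
  obtain ⟨k, hk⟩ : ∃ k, ¬ (k ∈ G ↔ k ∈ G') := by
    by_contra! h
    exact hG (Finset.ext h)
  refine ⟨k, Finset.mem_univ _, ?_⟩
  by_cases h : k ∈ G
  · have h' : k ∉ G' := fun h' => hk ⟨fun _ => h', fun _ => h⟩
    rw [hB' k h', mul_one, Matrix.trace_conjTranspose, hA k h, star_zero]
  · have h' : k ∈ G' := by_contra fun h' => hk ⟨fun h1 => absurd h1 h, fun h1 => absurd h1 h'⟩
    rw [hA' k h, Matrix.conjTranspose_one, one_mul, hB k h']

/-- Split every factor into a traceless part and a scalar and expand the product; the sites where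
the traceless part was taken form the set `G`. Products of matrix units span all operators. -/
theorem iSup_linOps (n : ℕ) : ⨆ G : Finset (Fin n), linOps G = ⊤ := by
  classical
  rw [eq_top_iff]
  have key : ∀ A : Fin n → Qubit, prodOp A ∈ ⨆ G : Finset (Fin n), linOps G := by
    intro A
    have h : A = (fun k => A k - (2⁻¹ * (A k).trace) • (1 : Qubit)) +
        fun k => (2⁻¹ * (A k).trace) • (1 : Qubit) := by
      funext k
      simp
    have hm : prodOp A = embedOp (Function.Embedding.refl (Fin n)) A := by
      rw [embedOp_apply, siteMats_refl]
    rw [hm, h, MultilinearMap.map_add_univ]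
    refine Submodule.sum_mem _ fun s _ => ?_
    have hs : s.piecewise (fun k => A k - (2⁻¹ * (A k).trace) • (1 : Qubit))
        (fun k => (2⁻¹ * (A k).trace) • (1 : Qubit)) =
        fun k => (if k ∈ s then 1 else 2⁻¹ * (A k).trace) •
          (if k ∈ s then A k - (2⁻¹ * (A k).trace) • (1 : Qubit) else 1) := by
      funext k
      by_cases hk : k ∈ s <;> simp [hk]
    rw [hs, MultilinearMap.map_smul_univ]
    refine Submodule.smul_mem _ _ (Submodule.mem_iSup_of_mem s (Submodule.subset_span
      ⟨_, ?_, ?_, embedOp_apply _ _⟩))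
    · intro k hk
      rw [siteMats_refl]
      simp [hk, Matrix.trace_sub]
      ring
    · intro k hk
      rw [siteMats_refl]
      simp [hk]
  intro X _
  rw [Matrix.matrix_eq_sum_single X]
  refine Submodule.sum_mem _ fun s _ => Submodule.sum_mem _ fun t _ => ?_
  have h : Matrix.single s t (X s t) =
      X s t • prodOp fun k => Matrix.single (s k) (t k) (1 : ℂ) := by
    ext a b
    rw [Matrix.smul_apply, prodOp_apply]
    simp only [Matrix.single_apply, Finset.prod_ite_zero, Finset.prod_const_one,
      Finset.mem_univ, true_implies, forall_and]
    simp [funext_iff]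
  rw [h]
  exact Submodule.smul_mem _ _ (key _)

/-! ### The adjoint action of the total spin -/

/-- The commutator with the total operator of `M`. -/
def adTotal (n : ℕ) (M : Qubit) : Op n →ₗ[ℂ] Op n :=
  LinearMap.mulLeft ℂ (totalOp n M) - LinearMap.mulRight ℂ (totalOp n M)

theorem adTotal_apply {n : ℕ} (M : Qubit) (X : Op n) :
    adTotal n M X = totalOp n M * X - X * totalOp n M := by
  simp [adTotal]

theorem totalOp_add (n : ℕ) (M N : Qubit) : totalOp n (M + N) = totalOp n M + totalOp n N := by
  simp [totalOp, prodOp_update_add, Finset.sum_add_distrib]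

theorem totalOp_smul (n : ℕ) (c : ℂ) (M : Qubit) : totalOp n (c • M) = c • totalOp n M := by
  simp [totalOp, prodOp_update_smul, Finset.smul_sum]

theorem adTotal_add (n : ℕ) (M N : Qubit) : adTotal n (M + N) = adTotal n M + adTotal n N := by
  ext1 X
  simp only [adTotal_apply, totalOp_add, add_mul, mul_add, LinearMap.add_apply]
  abel

theorem adTotal_smul (n : ℕ) (c : ℂ) (M : Qubit) : adTotal n (c • M) = c • adTotal n M := by
  ext1 X
  simp only [adTotal_apply, totalOp_smul, LinearMap.smul_apply, smul_sub, smul_mul_assoc,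
    mul_smul_comm]

theorem totalOp_mul_prodOp {n : ℕ} (M : Qubit) (A : Fin n → Qubit) :
    totalOp n M * prodOp A = ∑ k, prodOp (Function.update A k (M * A k)) := by
  rw [totalOp, Finset.sum_mul]
  refine Finset.sum_congr rfl fun k _ => ?_
  rw [prodOp_mul]
  congr 1
  funext l
  by_cases h : l = k
  · subst h; simp
  · simp [Function.update_of_ne h]

theorem prodOp_mul_totalOp {n : ℕ} (M : Qubit) (A : Fin n → Qubit) :
    prodOp A * totalOp n M = ∑ k, prodOp (Function.update A k (A k * M)) := by
  rw [totalOp, Finset.mul_sum]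
  refine Finset.sum_congr rfl fun k _ => ?_
  rw [prodOp_mul]
  congr 1
  funext l
  by_cases h : l = k
  · subst h; simp
  · simp [Function.update_of_ne h]

theorem adTotal_prodOp {n : ℕ} (M : Qubit) (A : Fin n → Qubit) :
    adTotal n M (prodOp A) = ∑ k, prodOp (Function.update A k (M * A k - A k * M)) := by
  rw [adTotal_apply, totalOp_mul_prodOp, prodOp_mul_totalOp, ← Finset.sum_sub_distrib]
  refine Finset.sum_congr rfl fun k _ => ?_
  rw [sub_eq_iff_eq_add, ← prodOp_update_add, sub_add_cancel]

/-- One-spin operators at different sites commute, so only the diagonal terms of the double sum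
survive. -/
theorem totalOp_commutator (n : ℕ) (M N : Qubit) :
    totalOp n M * totalOp n N - totalOp n N * totalOp n M = totalOp n (M * N - N * M) := by
  classical
  rw [← adTotal_apply, totalOp, map_sum, totalOp]
  refine Finset.sum_congr rfl fun k _ => ?_
  rw [adTotal_prodOp, Finset.sum_eq_single k]
  · simp
  · intro l _ hl
    rw [Function.update_of_ne hl, mul_one, one_mul, sub_self, prodOp_update_zero]
  · simp

theorem conjTranspose_totalOp (n : ℕ) (M : Qubit) : (totalOp n M)ᴴ = totalOp n Mᴴ := by
  rw [totalOp, Matrix.conjTranspose_sum, totalOp]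
  refine Finset.sum_congr rfl fun k _ => ?_
  rw [conjTranspose_prodOp]
  congr 1
  funext l
  by_cases h : l = k
  · subst h; simp
  · simp [Function.update_of_ne h]

theorem conjTranspose_adTotal {n : ℕ} (M : Qubit) (X : Op n) :
    (adTotal n M X)ᴴ = - adTotal n Mᴴ Xᴴ := by
  simp [adTotal_apply, conjTranspose_totalOp]

/-- Cyclicity of the trace. For J_z this gives orthogonality of different weights; for J₊ and J₋ it
gives the positivity arguments that replace the structure theory of sl₂. -/
theorem ip_adTotal {n : ℕ} (M : Qubit) (X Y : Op n) :
    ip (adTotal n M X) Y = ip X (adTotal n Mᴴ Y) := by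
  rw [ip, conjTranspose_adTotal, ip, adTotal_apply, adTotal_apply, neg_sub, sub_mul, mul_sub,
    Matrix.trace_sub, Matrix.trace_sub, ← mul_assoc, ← mul_assoc, Matrix.trace_mul_cycle Xᴴ,
    mul_assoc]
  congr 1
  rw [Matrix.trace_mul_cycle, mul_assoc, mul_assoc, Matrix.trace_mul_comm Xᴴ, mul_assoc]

theorem permRep_totalOp {n : ℕ} (σ : Equiv.Perm (Fin n)) (M : Qubit) :
    permRep n σ (totalOp n M) = totalOp n M := by
  rw [totalOp, map_sum]
  conv_rhs => rw [← Equiv.sum_comp σ]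
  refine Finset.sum_congr rfl fun k _ => ?_
  rw [permRep_prodOp]
  congr 1
  funext l
  by_cases h : l = σ k
  · subst h; simp
  · have h' : σ⁻¹ l ≠ k := fun h' => h (by rw [← h']; simp)
    rw [Function.update_of_ne h, Function.update_of_ne h']

theorem permRep_adTotal {n : ℕ} (σ : Equiv.Perm (Fin n)) (M : Qubit) (X : Op n) :
    permRep n σ (adTotal n M X) = adTotal n M (permRep n σ X) := by
  simp only [adTotal_apply, map_sub, permRep_mul, permRep_totalOp]

theorem ip_permRep {n : ℕ} (σ : Equiv.Perm (Fin n)) (X Y : Op n) :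
    ip (permRep n σ X) (permRep n σ Y) = ip X Y := by
  have h1 : (permRep n σ X)ᴴ = permRep n σ Xᴴ := rfl
  rw [ip, h1, ← permRep_mul, ip]
  exact Equiv.sum_comp (Equiv.arrowCongr σ.symm (Equiv.refl (Fin 2))) fun u => (Xᴴ * Y) u u

theorem linOps_adTotal {n : ℕ} {G : Finset (Fin n)} (M : Qubit) {X : Op n} (hX : X ∈ linOps G) :
    adTotal n M X ∈ linOps G := by
  classical
  refine Submodule.span_induction (p := fun X _ => adTotal n M X ∈ linOps G) ?_ (by simp)
    (fun X Y _ _ hX hY => by rw [map_add]; exact Submodule.add_mem _ hX hY)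
    (fun c X _ hX => by rw [map_smul]; exact Submodule.smul_mem _ _ hX) hX
  rintro _ ⟨A, hA, hA', rfl⟩
  rw [adTotal_prodOp]
  refine Submodule.sum_mem _ fun k _ => ?_
  by_cases hk : k ∈ G
  · refine Submodule.subset_span ⟨_, fun l hl => ?_, fun l hl => ?_, rfl⟩
    · by_cases h : l = k
      · subst h
        rw [Function.update_self, Matrix.trace_sub, Matrix.trace_mul_comm, sub_self]
      · rw [Function.update_of_ne h, hA l hl]
    · rw [Function.update_of_ne (fun h : l = k => hl (h ▸ hk)), hA' l hl]
  · rw [hA' k hk, mul_one, one_mul, sub_self, prodOp_update_zero]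
    exact Submodule.zero_mem _

theorem conjTranspose_mem_linOps {n : ℕ} {G : Finset (Fin n)} {X : Op n} (hX : X ∈ linOps G) :
    Xᴴ ∈ linOps G := by
  refine Submodule.span_induction (p := fun X _ => Xᴴ ∈ linOps G) ?_ (by simp)
    (fun X Y _ _ hX hY => by rw [Matrix.conjTranspose_add]; exact Submodule.add_mem _ hX hY)
    (fun c X _ hX => by rw [Matrix.conjTranspose_smul]; exact Submodule.smul_mem _ _ hX) hX
  rintro _ ⟨A, hA, hA', rfl⟩
  rw [conjTranspose_prodOp]
  exact Submodule.subset_span ⟨_, fun k hk => by rw [Matrix.trace_conjTranspose, hA k hk, star_zero],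
    fun k hk => by rw [hA' k hk, Matrix.conjTranspose_one], rfl⟩

/-! ### Raising, lowering and weight operators -/

/-- `I₊`. -/
def spinRaise : Qubit := !![0, 1; 0, 0]

/-- `I₋`. -/
def spinLower : Qubit := !![0, 0; 1, 0]

theorem raiseOp_eq (n : ℕ) : raiseOp n = totalOp n spinRaise := by
  rw [raiseOp, ← totalOp_smul, ← totalOp_add]
  congr 1
  ext i j
  fin_cases i <;> fin_cases j <;>
    norm_num [spinX, spinY, spinRaise, ← mul_div_assoc]

theorem lowerOp_eq (n : ℕ) : lowerOp n = totalOp n spinLower := by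
  rw [lowerOp, sub_eq_add_neg, ← neg_smul, ← totalOp_smul, ← totalOp_add]
  congr 1
  ext i j
  fin_cases i <;> fin_cases j <;>
    norm_num [spinX, spinY, spinLower, ← mul_div_assoc]

theorem conjTranspose_spinRaise : spinRaiseᴴ = spinLower := by
  ext i j
  fin_cases i <;> fin_cases j <;> simp [spinRaise, spinLower]

theorem conjTranspose_spinLower : spinLowerᴴ = spinRaise := by
  rw [← conjTranspose_spinRaise, Matrix.conjTranspose_conjTranspose]

theorem conjTranspose_spinZ : spinZᴴ = spinZ := by
  ext i j
  fin_cases i <;> fin_cases j <;> simp [spinZ]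

theorem spinRaise_spinLower :
    spinRaise * spinLower - spinLower * spinRaise = (2 : ℂ) • spinZ := by
  ext i j
  fin_cases i <;> fin_cases j <;> norm_num [spinRaise, spinLower, spinZ]

theorem spinZ_spinRaise : spinZ * spinRaise - spinRaise * spinZ = spinRaise := by
  ext i j
  fin_cases i <;> fin_cases j <;> norm_num [spinRaise, spinZ]

theorem spinZ_spinLower : spinZ * spinLower - spinLower * spinZ = (-1 : ℂ) • spinLower := by
  ext i j
  fin_cases i <;> fin_cases j <;> norm_num [spinLower, spinZ]

theorem adTotal_commutator {n : ℕ} (M N : Qubit) (X : Op n) :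
    adTotal n M (adTotal n N X) - adTotal n N (adTotal n M X) = adTotal n (M * N - N * M) X := by
  simp only [adTotal_apply, ← totalOp_commutator]
  noncomm_ring

theorem raise_lower {n : ℕ} (X : Op n) :
    adTotal n spinRaise (adTotal n spinLower X) =
      adTotal n spinLower (adTotal n spinRaise X) + (2 : ℂ) • adTotal n spinZ X := by
  rw [← sub_eq_iff_eq_add', adTotal_commutator, spinRaise_spinLower, adTotal_smul,
    LinearMap.smul_apply]

theorem weight_raise {n : ℕ} {X : Op n} {w : ℂ} (h : adTotal n spinZ X = w • X) :
    adTotal n spinZ (adTotal n spinRaise X) = (w + 1) • adTotal n spinRaise X := by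
  have := adTotal_commutator (n := n) spinZ spinRaise X
  rw [spinZ_spinRaise, h, map_smul, sub_eq_iff_eq_add] at this
  rw [this, add_smul, one_smul, add_comm]

theorem weight_lower {n : ℕ} {X : Op n} {w : ℂ} (h : adTotal n spinZ X = w • X) :
    adTotal n spinZ (adTotal n spinLower X) = (w - 1) • adTotal n spinLower X := by
  have := adTotal_commutator (n := n) spinZ spinLower X
  rw [spinZ_spinLower, h, map_smul, sub_eq_iff_eq_add, adTotal_smul, LinearMap.smul_apply] at this
  rw [this, sub_smul, one_smul, neg_smul, one_smul]
  abel

/-! ### Weights and permutations of words -/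

section Words

variable {α : Type} {n : ℕ} (e : α ↪ Fin n) [Fintype α]

/-- The weight of a word. -/
def wordWeight (f : α → Fin 3) : ℤ := ∑ a, (((f a : ℕ) : ℤ) - 1)

theorem letter_weight (i : Fin 3) :
    spinZ * letter i - letter i * spinZ = (((((i : ℕ) : ℤ) - 1 : ℤ)) : ℂ) • letter i := by
  fin_cases i <;> ext a b <;> fin_cases a <;> fin_cases b <;> norm_num [spinZ, letter]

theorem adTotal_embedOp [DecidableEq α] (M : Qubit) (A : α → Qubit) :
    adTotal n M (embedOp e A) = ∑ a, embedOp e (Function.update A a (M * A a - A a * M)) := by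
  classical
  rw [embedOp_apply, adTotal_prodOp]
  rw [← Finset.sum_subset (Finset.subset_univ (Finset.univ.map e))]
  · rw [Finset.sum_map]
    refine Finset.sum_congr rfl fun a _ => ?_
    rw [embedOp_apply, siteMats_update, siteMats_apply]
  · intro k _ hk
    rw [siteMats_of_notMem e A (by simpa using hk), mul_one, one_mul, sub_self,
      prodOp_update_zero]

theorem wordOp_weight (f : α → Fin 3) :
    adTotal n spinZ (wordOp e f) = ((wordWeight f : ℤ) : ℂ) • wordOp e f := by
  classical
  rw [wordOp, adTotal_embedOp, wordWeight, Int.cast_sum, Finset.sum_smul]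
  refine Finset.sum_congr rfl fun a _ => ?_
  rw [letter_weight, MultilinearMap.map_update_smul, Function.update_eq_self]

theorem permRep_wordOp (σ : Equiv.Perm α) (σ' : Equiv.Perm (Fin n)) (h : ∀ a, σ' (e a) = e (σ a))
    (f : α → Fin 3) : permRep n σ' (wordOp e f) = wordOp e (f ∘ ⇑σ⁻¹) := by
  rw [wordOp, wordOp, embedOp_apply, embedOp_apply, permRep_prodOp]
  congr 1
  funext k
  by_cases hk : ∃ b, e b = k
  · obtain ⟨b, rfl⟩ := hk
    have : σ'⁻¹ (e b) = e (σ⁻¹ b) := by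
      rw [Equiv.Perm.inv_eq_iff_eq, h]; simp
    rw [this, siteMats_apply, siteMats_apply, Function.comp_apply]
  · push Not at hk
    rw [siteMats_of_notMem e _ hk, siteMats_of_notMem]
    intro a ha
    apply hk (σ a)
    rw [← h, ha]; simp

end Words

/-! ### Weight spaces and tensor operators -/

/-- The operators in `W` of weight `w`. -/
def weightSpace {n : ℕ} (W : Submodule ℂ (Op n)) (w : ℤ) : Submodule ℂ (Op n) :=
  W ⊓ Module.End.eigenspace (adTotal n spinZ) (w : ℂ)

theorem mem_weightSpace {n : ℕ} {W : Submodule ℂ (Op n)} {w : ℤ} {X : Op n} :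
    X ∈ weightSpace W w ↔ X ∈ W ∧ adTotal n spinZ X = (w : ℂ) • X := by
  rw [weightSpace, Submodule.mem_inf, Module.End.mem_eigenspace_iff]

/-- The highest weight vectors of weight `j` in `W`. -/
def highestWeights {n : ℕ} (W : Submodule ℂ (Op n)) (j : ℕ) : Submodule ℂ (Op n) :=
  weightSpace W j ⊓ LinearMap.ker (adTotal n spinRaise)

/-- `W` is stable under the commutators with `J₊` and `J₋`. -/
structure LadderStable {n : ℕ} (W : Submodule ℂ (Op n)) : Prop where
  raise : ∀ X ∈ W, adTotal n spinRaise X ∈ W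
  lower : ∀ X ∈ W, adTotal n spinLower X ∈ W

theorem weight_orthogonal {n : ℕ} {X Y : Op n} {v w : ℤ} (hX : adTotal n spinZ X = (v : ℂ) • X)
    (hY : adTotal n spinZ Y = (w : ℂ) • Y) (h : v ≠ w) : ip X Y = 0 := by
  have h1 := ip_adTotal spinZ X Y
  rw [conjTranspose_spinZ, hX, hY, ip_smul_left, ip_smul_right] at h1
  have h2 : ((v : ℂ) - w) * ip X Y = 0 := by
    rw [sub_mul, ← h1]
    simp
  refine (mul_eq_zero.1 h2).resolve_left ?_
  rw [sub_eq_zero]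
  exact_mod_cast h

theorem eq_zero_of_ip_smul_eq {n : ℕ} {X Y : Op n} {c : ℝ} (hc : c < 0)
    (h : ip Y Y = (c : ℂ) * ip X X) : X = 0 := by
  rw [ip_self_eq_re X, ip_self_eq_re Y, ← Complex.ofReal_mul, Complex.ofReal_inj] at h
  have h1 := ip_self_re_nonneg X
  have h2 := ip_self_re_nonneg Y
  have h3 : (ip X X).re = 0 := by nlinarith
  rw [← ip_self_eq_zero, ip_self_eq_re, h3, Complex.ofReal_zero]

theorem ip_raise {n : ℕ} (X Y : Op n) :
    ip (adTotal n spinRaise X) Y = ip X (adTotal n spinLower Y) := by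
  rw [ip_adTotal, conjTranspose_spinRaise]

theorem ip_lower {n : ℕ} (X Y : Op n) :
    ip (adTotal n spinLower X) Y = ip X (adTotal n spinRaise Y) := by
  rw [ip_adTotal, conjTranspose_spinLower]

/-- If J₋X = 0, then [J₊, J₋] = 2J_z gives J₋J₊X = -2wX, so ‖J₊X‖² = -2w‖X‖², which is impossible
for w > 0 unless X vanishes. -/
theorem eq_zero_of_lower_eq_zero {n : ℕ} {X : Op n} {w : ℤ} (hw : 0 < w)
    (hX : adTotal n spinZ X = (w : ℂ) • X) (h : adTotal n spinLower X = 0) : X = 0 := by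
  have h1 := raise_lower X
  rw [h, map_zero, hX] at h1
  refine eq_zero_of_ip_smul_eq (Y := adTotal n spinRaise X) (c := -(2 * w)) ?_ ?_
  · have : (0 : ℝ) < w := by exact_mod_cast hw
    linarith
  · rw [ip_raise, eq_neg_of_add_eq_zero_left h1.symm, ← neg_smul, smul_smul, ip_smul_right]
    push_cast
    ring

theorem eq_zero_of_raise_eq_zero {n : ℕ} {X : Op n} {w : ℤ} (hw : w < 0)
    (hX : adTotal n spinZ X = (w : ℂ) • X) (h : adTotal n spinRaise X = 0) : X = 0 := by
  have h1 := raise_lower X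
  rw [h, map_zero, zero_add, hX] at h1
  refine eq_zero_of_ip_smul_eq (Y := adTotal n spinLower X) (c := 2 * w) ?_ ?_
  · have : (w : ℝ) < 0 := by exact_mod_cast hw
    linarith
  · rw [ip_lower, h1, smul_smul, ip_smul_right]
    push_cast
    ring

theorem raise_mem_weightSpace {n : ℕ} {W : Submodule ℂ (Op n)} (hW : LadderStable W) {w : ℤ}
    {X : Op n} (hX : X ∈ weightSpace W w) : adTotal n spinRaise X ∈ weightSpace W (w + 1) := by
  rw [mem_weightSpace] at hX ⊢
  refine ⟨hW.raise _ hX.1, ?_⟩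
  rw [weight_raise hX.2]
  push_cast
  rfl

theorem lower_mem_weightSpace {n : ℕ} {W : Submodule ℂ (Op n)} (hW : LadderStable W) {w : ℤ}
    {X : Op n} (hX : X ∈ weightSpace W w) : adTotal n spinLower X ∈ weightSpace W (w - 1) := by
  rw [mem_weightSpace] at hX ⊢
  refine ⟨hW.lower _ hX.1, ?_⟩
  rw [weight_lower hX.2]
  push_cast
  rfl

theorem exists_eq_of_injOn {n : ℕ} {W : Submodule ℂ (Op n)} (f : Op n →ₗ[ℂ] Op n)
    (hf : ∀ X ∈ W, f X ∈ W) (h0 : ∀ X ∈ W, f X = 0 → X = 0) {X : Op n} (hX : X ∈ W) :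
    ∃ Y ∈ W, f Y = X := by
  have hinj : Function.Injective (f.restrict hf) := by
    rw [← LinearMap.ker_eq_bot, LinearMap.ker_eq_bot']
    rintro ⟨Y, hY⟩ h
    exact Subtype.ext (h0 Y hY (congrArg Subtype.val h))
  obtain ⟨Y, hY⟩ := LinearMap.injective_iff_surjective.1 hinj ⟨X, hX⟩
  exact ⟨Y, Y.2, congrArg Subtype.val hY⟩

/-- On the weight space of w + 1 > 0 the operator J₊J₋ is injective: its kernel is that of J₋ by
adjointness, and the latter is zero. By finite dimension it is surjective, so J₊ is surjective onto
this weight space. -/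
theorem exists_raise_eq {n : ℕ} {W : Submodule ℂ (Op n)} (hW : LadderStable W) {w : ℤ}
    (hw : 0 ≤ w) {X : Op n} (hX : X ∈ weightSpace W (w + 1)) :
    ∃ Y ∈ weightSpace W w, adTotal n spinRaise Y = X := by
  have h1 : ∀ Y ∈ weightSpace W (w + 1), adTotal n spinLower Y ∈ weightSpace W w := fun Y hY => by
    simpa using lower_mem_weightSpace hW hY
  obtain ⟨Y, hY, h⟩ := exists_eq_of_injOn (adTotal n spinRaise ∘ₗ adTotal n spinLower)
    (fun Y hY => raise_mem_weightSpace hW (h1 Y hY)) (fun Y hY h => by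
      refine eq_zero_of_lower_eq_zero (w := w + 1) (by omega) (mem_weightSpace.1 hY).2 ?_
      rw [← ip_self_eq_zero, ip_lower]
      rw [LinearMap.comp_apply] at h
      rw [h, ip_zero_right]) hX
  exact ⟨_, h1 Y hY, h⟩

theorem exists_lower_eq {n : ℕ} {W : Submodule ℂ (Op n)} (hW : LadderStable W) {w : ℤ}
    (hw : w ≤ 0) {X : Op n} (hX : X ∈ weightSpace W (w - 1)) :
    ∃ Y ∈ weightSpace W w, adTotal n spinLower Y = X := by
  have h1 : ∀ Y ∈ weightSpace W (w - 1), adTotal n spinRaise Y ∈ weightSpace W w := fun Y hY => by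
    simpa using raise_mem_weightSpace hW hY
  obtain ⟨Y, hY, h⟩ := exists_eq_of_injOn (adTotal n spinLower ∘ₗ adTotal n spinRaise)
    (fun Y hY => lower_mem_weightSpace hW (h1 Y hY)) (fun Y hY h => by
      refine eq_zero_of_raise_eq_zero (w := w - 1) (by omega) (mem_weightSpace.1 hY).2 ?_
      rw [← ip_self_eq_zero, ip_raise]
      rw [LinearMap.comp_apply] at h
      rw [h, ip_zero_right]) hX
  exact ⟨_, h1 Y hY, h⟩

/-- Rank-nullity for J₊ from weight j to weight j + 1, where it is surjective because j ≥ 0. -/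
theorem finrank_highestWeights {n : ℕ} {W : Submodule ℂ (Op n)} (hW : LadderStable W) (j : ℕ) :
    Module.finrank ℂ (highestWeights W j) + Module.finrank ℂ (weightSpace W (j + 1)) =
      Module.finrank ℂ (weightSpace W j) := by
  let f : weightSpace W j →ₗ[ℂ] weightSpace W (j + 1) :=
    (adTotal n spinRaise).restrict fun X hX => raise_mem_weightSpace hW hX
  have hf : LinearMap.range f = ⊤ := by
    rw [LinearMap.range_eq_top]
    rintro ⟨X, hX⟩
    obtain ⟨Y, hY, h⟩ := exists_raise_eq hW (by omega) hX
    exact ⟨⟨Y, hY⟩, Subtype.ext h⟩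
  have hk : Module.finrank ℂ (LinearMap.ker f) = Module.finrank ℂ (highestWeights W j) := by
    have : highestWeights W j = (LinearMap.ker f).map (weightSpace W j).subtype := by
      ext X
      rw [highestWeights, Submodule.mem_inf, LinearMap.mem_ker, Submodule.mem_map]
      constructor
      · rintro ⟨h1, h2⟩
        exact ⟨⟨X, h1⟩, Subtype.ext h2, rfl⟩
      · rintro ⟨⟨Y, h1⟩, h2, rfl⟩
        exact ⟨h1, congrArg Subtype.val h2⟩
    rw [this]
    exact (LinearEquiv.finrank_eq
      (Submodule.equivMapOfInjective _ (Submodule.subtype_injective _) _))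
  have h := f.finrank_range_add_finrank_ker
  rw [hf, finrank_top, hk] at h
  omega

/-! ### Tensor operators from highest weight vectors -/

theorem mem_tensorOperators {n : ℕ} {W : Submodule ℂ (Op n)} {j : ℕ} {T : ℤ → Op n} :
    T ∈ tensorOperators W j ↔ (∀ m, T m ∈ W) ∧ (∀ m, (j : ℤ) < |m| → T m = 0) ∧
      ∀ m : ℤ, |m| ≤ (j : ℤ) →
        adTotal n spinZ (T m) = (m : ℂ) • T m ∧
        adTotal n spinRaise (T m) =
          (Real.sqrt ((j : ℝ) * (j + 1) - m * (m + 1)) : ℂ) • T (m + 1) ∧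
        adTotal n spinLower (T m) =
          (Real.sqrt ((j : ℝ) * (j + 1) - m * (m - 1)) : ℂ) • T (m - 1) := by
  simp only [adTotal_apply, ← raiseOp_eq, ← lowerOp_eq]
  rfl

theorem sqrt_mul_sqrt_cast {x : ℝ} (hx : 0 ≤ x) :
    (Real.sqrt x : ℂ) * (Real.sqrt x : ℂ) = (x : ℂ) := by
  rw [← Complex.ofReal_mul, Real.mul_self_sqrt hx]

theorem ladder_nonneg {j : ℕ} {m : ℤ} (hm : |m| ≤ (j : ℤ)) :
    (0 : ℝ) ≤ (j : ℝ) * (j + 1) - m * (m + 1) := by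
  have h := abs_le.1 hm
  have h1 : (-(j : ℝ)) ≤ m := by exact_mod_cast h.1
  have h2 : (m : ℝ) ≤ j := by exact_mod_cast h.2
  nlinarith

theorem ladder_pos {j : ℕ} {m : ℤ} (hm : -(j : ℤ) ≤ m) (hm' : m < j) :
    (0 : ℝ) < (j : ℝ) * (j + 1) - m * (m + 1) := by
  have h1 : (-(j : ℝ)) ≤ m := by exact_mod_cast hm
  have h2 : (m : ℝ) + 1 ≤ j := by exact_mod_cast hm'
  nlinarith

/-- The raising coefficient at m and the lowering coefficient at m + 1 are the same square root; for
m = j both sides are zero. The eigenvalue separates the ranks at fixed m. -/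
theorem lower_raise_tensorOperator {n : ℕ} {W : Submodule ℂ (Op n)} {j : ℕ} {T : ℤ → Op n}
    (hT : T ∈ tensorOperators W j) {m : ℤ} (hm : |m| ≤ (j : ℤ)) :
    adTotal n spinLower (adTotal n spinRaise (T m)) =
      (((j : ℝ) * (j + 1) - m * (m + 1) : ℝ) : ℂ) • T m := by
  obtain ⟨-, h0, h⟩ := mem_tensorOperators.1 hT
  rw [(h m hm).2.1, map_smul]
  have hm' := abs_le.1 hm
  rcases hm'.2.lt_or_eq with hlt | rfl
  · have h1 : |m + 1| ≤ (j : ℤ) := abs_le.2 ⟨by omega, by omega⟩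
    rw [(h (m + 1) h1).2.2, smul_smul, add_sub_cancel_right]
    have h2 : ((j : ℝ) * (j + 1) - ((m + 1 : ℤ) : ℝ) * (((m + 1 : ℤ) : ℝ) - 1)) =
        (j : ℝ) * (j + 1) - m * (m + 1) := by
      push_cast
      ring
    rw [h2, sqrt_mul_sqrt_cast (ladder_nonneg hm)]
  · simp

/-- The top component determines all others, because the lowering coefficients do not vanish before
m = -j. -/
theorem tensorOperator_eq_zero {n : ℕ} {W : Submodule ℂ (Op n)} {j : ℕ} {T : ℤ → Op n}
    (hT : T ∈ tensorOperators W j) (h : T j = 0) : T = 0 := by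
  obtain ⟨-, h0, hT⟩ := mem_tensorOperators.1 hT
  have key : ∀ k : ℕ, k ≤ 2 * j → T (j - k) = 0 := by
    intro k
    induction k with
    | zero => intro _; simpa using h
    | succ k ih =>
      intro hk
      have h1 := (hT (j - k) (abs_le.2 ⟨by omega, by omega⟩)).2.2
      rw [ih (by omega), map_zero] at h1
      have h2 : ((j : ℤ) - (k + 1 : ℕ)) = j - k - 1 := by push_cast; ring
      rw [h2]
      refine (smul_eq_zero.1 h1.symm).resolve_left ?_
      rw [Complex.ofReal_eq_zero]
      have h3 := ladder_pos (j := j) (m := (j : ℤ) - k - 1) (by omega) (by omega)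
      refine (Real.sqrt_pos.2 (lt_of_lt_of_eq h3 ?_)).ne'
      push_cast
      ring
  funext m
  by_cases hm : |m| ≤ (j : ℤ)
  · have hm' := abs_le.1 hm
    have := key (j - m).toNat (by omega)
    rwa [Int.toNat_of_nonneg (by omega), sub_sub_cancel] at this
  · exact h0 m (not_le.1 hm)

/-- The normalised string of operators below a highest weight vector. -/
def ladder {n : ℕ} (j : ℕ) (X : Op n) : ℕ → Op n
  | 0 => X
  | k + 1 => (Real.sqrt ((2 * j - k) * (k + 1)) : ℂ)⁻¹ • adTotal n spinLower (ladder j X k)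

theorem ladder_mem {n : ℕ} {W : Submodule ℂ (Op n)} (hW : LadderStable W) {j : ℕ} {X : Op n}
    (hX : X ∈ W) (k : ℕ) : ladder j X k ∈ W := by
  induction k with
  | zero => exact hX
  | succ k ih => exact W.smul_mem _ (hW.lower _ ih)

theorem ladder_weight {n : ℕ} {j : ℕ} {X : Op n}
    (hX : adTotal n spinZ X = (j : ℂ) • X) (k : ℕ) :
    adTotal n spinZ (ladder j X k) = ((j : ℂ) - k) • ladder j X k := by
  induction k with
  | zero => simpa [ladder] using hX
  | succ k ih =>
    rw [ladder, map_smul, weight_lower ih, smul_comm]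
    push_cast
    rw [sub_sub]

theorem ladder_coeff_ne_zero {j k : ℕ} (hk : k < 2 * j) :
    (Real.sqrt ((2 * j - k) * (k + 1)) : ℂ) ≠ 0 := by
  rw [Ne, Complex.ofReal_eq_zero]
  have h : (k : ℝ) < 2 * j := by exact_mod_cast hk
  exact (Real.sqrt_pos.2 (mul_pos (by linarith) (by positivity))).ne'

theorem lower_ladder {n : ℕ} {j : ℕ} {X : Op n} {k : ℕ} (hk : k < 2 * j) :
    adTotal n spinLower (ladder j X k) =
      (Real.sqrt ((2 * j - k) * (k + 1)) : ℂ) • ladder j X (k + 1) := by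
  rw [ladder, smul_inv_smul₀ (ladder_coeff_ne_zero hk)]

/-- The two statements are proved together: raising the rung k + 1 means applying J₊J₋ = J₋J₊ + 2J_z
to the rung k, where J₋J₊ is already known to act by k(2j - k + 1). -/
theorem lower_raise_ladder {n : ℕ} {j : ℕ} {X : Op n}
    (hX : adTotal n spinZ X = (j : ℂ) • X) (hX' : adTotal n spinRaise X = 0) (k : ℕ)
    (hk : k ≤ 2 * j) :
    adTotal n spinLower (adTotal n spinRaise (ladder j X k)) =
      ((k : ℂ) * (2 * j - k + 1)) • ladder j X k ∧
    ∀ l, k = l + 1 → adTotal n spinRaise (ladder j X k) =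
      (Real.sqrt ((2 * j - l) * (l + 1)) : ℂ) • ladder j X l := by
  induction k with
  | zero => simp [ladder, hX']
  | succ k ih =>
    have h1 := (ih (by omega)).1
    have hpos : (0 : ℝ) ≤ (2 * j - k) * (k + 1) := by
      have h : (k : ℝ) + 1 ≤ 2 * j := by exact_mod_cast hk
      exact mul_nonneg (by linarith) (by positivity)
    have h2 : adTotal n spinRaise (ladder j X (k + 1)) =
        (Real.sqrt ((2 * j - k) * (k + 1)) : ℂ) • ladder j X k := by
      rw [ladder, map_smul, raise_lower, h1, ladder_weight hX, smul_smul, ← add_smul, smul_smul]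
      congr 1
      rw [inv_mul_eq_iff_eq_mul₀ (ladder_coeff_ne_zero (by omega)), sqrt_mul_sqrt_cast hpos]
      push_cast
      ring
    refine ⟨?_, fun l hl => ?_⟩
    · rw [h2, map_smul, lower_ladder (by omega), smul_smul, sqrt_mul_sqrt_cast hpos]
      congr 1
      push_cast
      ring
    · obtain rfl : k = l := by omega
      exact h2

/-- On the last rung J₊J₋ = J₋J₊ + 2J_z acts by 2j - 2j = 0, so the lowered operator has norm zero.
This is what makes the string stop at weight -j. -/
theorem lower_ladder_last {n : ℕ} {j : ℕ} {X : Op n}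
    (hX : adTotal n spinZ X = (j : ℂ) • X) (hX' : adTotal n spinRaise X = 0) :
    adTotal n spinLower (ladder j X (2 * j)) = 0 := by
  rw [← ip_self_eq_zero, ip_lower, raise_lower, (lower_raise_ladder hX hX' _ le_rfl).1,
    ladder_weight hX, smul_smul, ← add_smul, ip_smul_right]
  push_cast
  ring

theorem exists_tensorOperator {n : ℕ} {W : Submodule ℂ (Op n)} (hW : LadderStable W) {j : ℕ}
    {X : Op n} (hX : X ∈ highestWeights W j) : ∃ T ∈ tensorOperators W j, T j = X := by
  obtain ⟨h1, h3⟩ := Submodule.mem_inf.1 hX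
  obtain ⟨h1, h2⟩ := mem_weightSpace.1 h1
  rw [LinearMap.mem_ker] at h3
  rw [Int.cast_natCast] at h2
  refine ⟨fun m => if |m| ≤ (j : ℤ) then ladder j X (j - m).toNat else 0,
    mem_tensorOperators.2 ⟨fun m => ?_, fun m hm => if_neg (not_le.2 hm), fun m hm => ?_⟩, ?_⟩
  · split_ifs
    · exact ladder_mem hW h1 _
    · exact W.zero_mem
  · have hm' := abs_le.1 hm
    obtain ⟨k, hk⟩ : ∃ k : ℕ, m = j - k := ⟨(j - m).toNat, by omega⟩
    subst hk
    have hk : k ≤ 2 * j := by omega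
    have e0 : ((j : ℤ) - (j - k)).toNat = k := by omega
    simp only [if_pos hm, e0]
    refine ⟨?_, ?_, ?_⟩
    · rw [ladder_weight h2]
      push_cast
      rfl
    · rcases k with _ | k
      · simp [ladder, h3]
      · have h4 : |(j : ℤ) - (k + 1 : ℕ) + 1| ≤ (j : ℤ) := abs_le.2 ⟨by omega, by omega⟩
        have e1 : ((j : ℤ) - ((j : ℤ) - (k + 1 : ℕ) + 1)).toNat = k := by omega
        rw [if_pos h4, e1, (lower_raise_ladder h2 h3 _ hk).2 k rfl]
        congr 4
        push_cast
        ring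
    · rcases hk.lt_or_eq with hlt | rfl
      · have h4 : |(j : ℤ) - k - 1| ≤ (j : ℤ) := abs_le.2 ⟨by omega, by omega⟩
        have e1 : ((j : ℤ) - ((j : ℤ) - k - 1)).toNat = k + 1 := by omega
        rw [if_pos h4, e1, lower_ladder hlt]
        congr 4
        push_cast
        ring
      · rw [lower_ladder_last h2 h3, if_neg, smul_zero]
        rw [not_le, lt_abs]
        right
        push_cast
        omega
  · simp [ladder]

theorem tensorOperator_top_mem {n : ℕ} {W : Submodule ℂ (Op n)} {j : ℕ} {T : ℤ → Op n}
    (hT : T ∈ tensorOperators W j) : T j ∈ highestWeights W j := by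
  obtain ⟨h1, -, h⟩ := mem_tensorOperators.1 hT
  obtain ⟨h2, h3, -⟩ := h j (by simp)
  refine Submodule.mem_inf.2 ⟨mem_weightSpace.2 ⟨h1 _, h2⟩, ?_⟩
  rw [LinearMap.mem_ker, h3]
  simp

/-- Taking the top component is an isomorphism from the tensor operators to the highest weight
vectors, which turns the counting of tensor operators into the counting of weights. -/
theorem finrank_tensorOperators {n : ℕ} {W : Submodule ℂ (Op n)} (hW : LadderStable W) (j : ℕ) :
    Module.finrank ℂ (tensorOperators W j) + Module.finrank ℂ (weightSpace W (j + 1)) =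
      Module.finrank ℂ (weightSpace W j) := by
  rw [← finrank_highestWeights hW]
  congr 1
  refine LinearEquiv.finrank_eq (LinearEquiv.ofBijective
    (LinearMap.codRestrict (highestWeights W j)
      ((LinearMap.proj (R := ℂ) (φ := fun _ : ℤ => Op n) (j : ℤ)) ∘ₗ
        (tensorOperators W j).subtype) fun T => tensorOperator_top_mem T.2) ⟨?_, ?_⟩)
  · rw [← LinearMap.ker_eq_bot, LinearMap.ker_eq_bot']
    rintro ⟨T, hT⟩ h
    exact Subtype.ext (tensorOperator_eq_zero hT (congrArg Subtype.val h))
  · rintro ⟨X, hX⟩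
    obtain ⟨T, hT, h⟩ := exists_tensorOperator hW hX
    exact ⟨⟨T, hT⟩, Subtype.ext h⟩

/-! ### Spanning by tensor operators -/

/-- The span of the components of the tensor operators in `W`. -/
def componentSpan {n : ℕ} (W : Submodule ℂ (Op n)) : Submodule ℂ (Op n) :=
  Submodule.span ℂ {X | ∃ j : ℕ, ∃ T ∈ tensorOperators W j, ∃ m : ℤ, X = T m}

theorem component_mem {n : ℕ} {W : Submodule ℂ (Op n)} {j : ℕ} {T : ℤ → Op n}
    (hT : T ∈ tensorOperators W j) (m : ℤ) : T m ∈ componentSpan W :=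
  Submodule.subset_span ⟨j, T, hT, m, rfl⟩

theorem ladderStable_componentSpan {n : ℕ} (W : Submodule ℂ (Op n)) :
    LadderStable (componentSpan W) := by
  constructor
  · intro X hX
    refine Submodule.span_induction (p := fun X _ => adTotal n spinRaise X ∈ componentSpan W) ?_
      (by simp) (fun X Y _ _ hX hY => by rw [map_add]; exact Submodule.add_mem _ hX hY)
      (fun c X _ hX => by rw [map_smul]; exact Submodule.smul_mem _ _ hX) hX
    rintro _ ⟨j, T, hT, m, rfl⟩
    obtain ⟨-, h1, h2⟩ := mem_tensorOperators.1 hT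
    by_cases hm : |m| ≤ (j : ℤ)
    · rw [(h2 m hm).2.1]
      exact Submodule.smul_mem _ _ (component_mem hT _)
    · rw [h1 m (not_le.1 hm), map_zero]
      exact Submodule.zero_mem _
  · intro X hX
    refine Submodule.span_induction (p := fun X _ => adTotal n spinLower X ∈ componentSpan W) ?_
      (by simp) (fun X Y _ _ hX hY => by rw [map_add]; exact Submodule.add_mem _ hX hY)
      (fun c X _ hX => by rw [map_smul]; exact Submodule.smul_mem _ _ hX) hX
    rintro _ ⟨j, T, hT, m, rfl⟩
    obtain ⟨-, h1, h2⟩ := mem_tensorOperators.1 hT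
    by_cases hm : |m| ≤ (j : ℤ)
    · rw [(h2 m hm).2.2]
      exact Submodule.smul_mem _ _ (component_mem hT _)
    · rw [h1 m (not_le.1 hm), map_zero]
      exact Submodule.zero_mem _

theorem exists_weight_bound (n : ℕ) : ∃ N : ℕ, ∀ (W : Submodule ℂ (Op n)) (w : ℕ),
    N < w → weightSpace W w = ⊥ := by
  have h : {w : ℕ | Module.End.HasEigenvalue (adTotal n spinZ) (w : ℂ)}.Finite :=
    (Module.End.finite_hasEigenvalue (adTotal n spinZ)).preimage
      (Nat.cast_injective (R := ℂ)).injOn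
  obtain ⟨N, hN⟩ := h.bddAbove
  refine ⟨N, fun W w hw => ?_⟩
  have : ¬ Module.End.HasEigenvalue (adTotal n spinZ) (w : ℂ) := fun h => (hN h).not_gt hw
  rw [Module.End.HasEigenvalue, Module.End.HasUnifEigenvalue, not_not] at this
  rw [weightSpace, eq_bot_iff]
  refine inf_le_right.trans ?_
  rw [Int.cast_natCast]
  exact this.le

/-- Complete reducibility in concrete form. For weights w ≥ 0 descend from above all weights: J₊X
lies in the span by induction and equals J₊Y for some Y in the span, and X - Y is a highest weight
vector, hence the top of a tensor operator. Negative weights are reached from zero by lowering. -/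
theorem weightSpace_le_componentSpan {n : ℕ} {W : Submodule ℂ (Op n)} (hW : LadderStable W)
    (w : ℤ) : weightSpace W w ≤ componentSpan W := by
  have hC := ladderStable_componentSpan W
  obtain ⟨N, hN⟩ := exists_weight_bound n
  -- The auxiliary `k` bounds how far w lies below the region without weights; it is the variable of
  -- the descending induction.
  have hpos : ∀ k w : ℕ, N < w + k → weightSpace W w ≤ componentSpan W := by
    intro k
    induction k with
    | zero =>
      intro w hw
      rw [hN W w hw]
      exact bot_le
    | succ k ih =>
      intro w hw X hX
      have h1 := raise_mem_weightSpace hW hX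
      have h2 := ih (w + 1) (by omega) (by exact_mod_cast h1)
      obtain ⟨Y, hY, h3⟩ := exists_raise_eq hC (by omega)
        (mem_weightSpace.2 ⟨h2, (mem_weightSpace.1 h1).2⟩)
      have h4 : X - Y ∈ highestWeights ⊤ w := by
        refine Submodule.mem_inf.2 ⟨Submodule.sub_mem _ ?_ ?_, ?_⟩
        · exact mem_weightSpace.2 ⟨trivial, (mem_weightSpace.1 hX).2⟩
        · exact mem_weightSpace.2 ⟨trivial, (mem_weightSpace.1 hY).2⟩
        · rw [LinearMap.mem_ker, map_sub, h3, sub_self]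
      have hCW : componentSpan W ≤ W := by
        refine Submodule.span_le.2 ?_
        rintro _ ⟨j, T, hT, m, rfl⟩
        exact (mem_tensorOperators.1 hT).1 m
      have h5 : X - Y ∈ highestWeights W w :=
        Submodule.mem_inf.2 ⟨mem_weightSpace.2 ⟨W.sub_mem (mem_weightSpace.1 hX).1
          (hCW (mem_weightSpace.1 hY).1), (mem_weightSpace.1 (Submodule.mem_inf.1 h4).1).2⟩,
          (Submodule.mem_inf.1 h4).2⟩
      obtain ⟨T, hT, h6⟩ := exists_tensorOperator hW h5
      have h7 := Submodule.add_mem _ (component_mem hT w) (mem_weightSpace.1 hY).1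
      rwa [h6, sub_add_cancel] at h7
  have hneg : ∀ k : ℕ, weightSpace W (-k) ≤ componentSpan W := by
    intro k
    induction k with
    | zero => simpa using hpos (N + 1) 0 (by omega)
    | succ k ih =>
      intro X hX
      obtain ⟨Y, hY, rfl⟩ := exists_lower_eq (w := -k) hW (by omega)
        (by rwa [show (-(k : ℤ) - 1) = -((k + 1 : ℕ) : ℤ) by push_cast; ring])
      exact hC.lower _ (ih hY)
  obtain ⟨k, rfl | rfl⟩ := Int.eq_nat_or_neg w
  · exact hpos (N + 1) k (by omega)
  · exact hneg k

/-! ### Infinitesimal rotations -/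

/-- The action of a matrix on binary forms by a derivation. -/
def formDeriv (M : Qubit) : Derivation ℂ (MvPolynomial (Fin 2) ℂ) (MvPolynomial (Fin 2) ℂ) :=
  MvPolynomial.mkDerivation ℂ fun i => ∑ k, MvPolynomial.C (M k i) * MvPolynomial.X k

theorem formDeriv_X (M : Qubit) (i : Fin 2) :
    formDeriv M (MvPolynomial.X i) = ∑ k, MvPolynomial.C (M k i) * MvPolynomial.X k :=
  MvPolynomial.mkDerivation_X _ _ _

theorem formDeriv_add (M N : Qubit) : formDeriv (M + N) = formDeriv M + formDeriv N := by
  refine MvPolynomial.derivation_ext fun i => ?_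
  simp only [Derivation.add_apply, formDeriv_X, Matrix.add_apply, map_add, add_mul,
    Finset.sum_add_distrib]

theorem formDeriv_smul (c : ℂ) (M : Qubit) : formDeriv (c • M) = c • formDeriv M := by
  refine MvPolynomial.derivation_ext fun i => ?_
  simp only [Derivation.smul_apply, formDeriv_X, Matrix.smul_apply, smul_eq_mul, map_mul,
    Finset.smul_sum, MvPolynomial.smul_eq_C_mul, mul_assoc]

/-- The curve `cos θ + sin θ K`. -/
def rotCurve (K : Qubit) (θ : ℝ) : Qubit := (Real.cos θ : ℂ) • (1 : Qubit) + (Real.sin θ : ℂ) • K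

/-- For K² = -1 the curve is exp(θK), so this is the inverse law of a one-parameter group. The
trigonometric form makes the matrix exponential unnecessary. -/
theorem rotCurve_mul_neg {K : Qubit} (hK : K * K = -1) (θ : ℝ) :
    rotCurve K θ * rotCurve K (-θ) = 1 := by
  have h : (Real.cos θ : ℂ) * Real.cos θ + (Real.sin θ : ℂ) * Real.sin θ = 1 := by
    exact_mod_cast (by nlinarith [Real.cos_sq_add_sin_sq θ] :
      Real.cos θ * Real.cos θ + Real.sin θ * Real.sin θ = 1)
  simp only [rotCurve, Real.cos_neg, Real.sin_neg, Complex.ofReal_neg, neg_smul, mul_add, add_mul,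
    mul_neg, smul_mul_smul_comm, one_mul, mul_one, hK, smul_neg]
  rw [mul_comm (Real.sin θ : ℂ) (Real.cos θ)]
  rw [show ∀ A B C : Qubit, A + B + -(B + -C) = A + C from fun A B C => by abel, ← add_smul, h,
    one_smul]

theorem rotCurve_zero (K : Qubit) : rotCurve K 0 = 1 := by simp [rotCurve]

theorem hasDerivAt_rotCurve {K : Qubit} (hK : K * K = -1) (θ : ℝ) (i k : Fin 2) :
    HasDerivAt (fun θ => rotCurve K θ i k) ((K * rotCurve K θ) i k) θ := by
  have h1 := (Real.hasDerivAt_cos θ).ofReal_comp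
  have h2 := (Real.hasDerivAt_sin θ).ofReal_comp
  have h3 : K * rotCurve K θ = (-Real.sin θ : ℂ) • (1 : Qubit) + (Real.cos θ : ℂ) • K := by
    rw [rotCurve, mul_add, mul_smul_comm, mul_smul_comm, hK, mul_one, smul_neg, neg_smul, add_comm]
  rw [h3]
  have h4 := (h1.mul_const ((1 : Qubit) i k)).fun_add (h2.mul_const (K i k))
  simpa [rotCurve] using h4

/-- Differentiability is tested against linear functionals, so no topology on polynomials is
required. The functional stays universally quantified in the induction, because the step for p·X_i
applies the hypothesis to φ composed with multiplication by a variable. -/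
theorem hasDerivAt_substAlg {K : Qubit} (hK : K * K = -1) (θ : ℝ) (p : MvPolynomial (Fin 2) ℂ) :
    ∀ φ : MvPolynomial (Fin 2) ℂ →ₗ[ℂ] ℂ,
    HasDerivAt (fun θ => φ (substAlg (rotCurve K θ) p))
      (φ (formDeriv K (substAlg (rotCurve K θ) p))) θ := by
  induction p using MvPolynomial.induction_on with
  | C a =>
    intro φ
    have h : ∀ U, substAlg U (MvPolynomial.C a) = MvPolynomial.C a := fun U =>
      MvPolynomial.aeval_C _ _
    simp only [h, MvPolynomial.derivation_C, map_zero]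
    exact hasDerivAt_const _ _
  | add p q hp hq =>
    intro φ
    simp only [map_add]
    exact (hp φ).add (hq φ)
  | mul_X p i hp =>
    intro φ
    have hs : ∀ U, substAlg U (p * MvPolynomial.X i) =
        ∑ k, U k i • (substAlg U p * MvPolynomial.X k) := by
      intro U
      rw [map_mul, substAlg, MvPolynomial.aeval_X, Finset.mul_sum]
      refine Finset.sum_congr rfl fun k _ => ?_
      rw [MvPolynomial.smul_eq_C_mul]
      ring
    have hφ : ∀ k, HasDerivAt (fun θ => φ (substAlg (rotCurve K θ) p * MvPolynomial.X k))
        (φ (formDeriv K (substAlg (rotCurve K θ) p) * MvPolynomial.X k)) θ := fun k =>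
      hp (φ ∘ₗ LinearMap.mulRight ℂ (MvPolynomial.X k))
    have h1 : HasDerivAt (fun θ => ∑ k, rotCurve K θ k i *
        φ (substAlg (rotCurve K θ) p * MvPolynomial.X k))
        (∑ k, ((K * rotCurve K θ) k i * φ (substAlg (rotCurve K θ) p * MvPolynomial.X k) +
          rotCurve K θ k i * φ (formDeriv K (substAlg (rotCurve K θ) p) * MvPolynomial.X k))) θ :=
      HasDerivAt.fun_sum fun k _ => (hasDerivAt_rotCurve hK θ k i).mul (hφ k)
    have h2 : ∀ (q : MvPolynomial (Fin 2) ℂ) (U : Qubit),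
        φ (formDeriv K (∑ k, U k i • (q * MvPolynomial.X k))) =
          ∑ k, ((K * U) k i * φ (q * MvPolynomial.X k) +
            U k i * φ (formDeriv K q * MvPolynomial.X k)) := by
      intro q U
      have h3 : ∀ (c : ℂ) (k : Fin 2),
          q * (MvPolynomial.C c * MvPolynomial.X k) = c • (q * MvPolynomial.X k) := by
        intro c k
        rw [MvPolynomial.smul_eq_C_mul]
        ring
      simp only [Derivation.map_smul, Derivation.leibniz, formDeriv_X, map_add, map_smul,
        Fin.sum_univ_two, Matrix.mul_apply, smul_eq_mul, mul_add, h3,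
        mul_comm (MvPolynomial.X _) (formDeriv K _)]
      ring
    simp only [hs]
    rw [h2]
    simpa only [map_sum, map_smul, smul_eq_mul] using h1

theorem hasDerivAt_mul_apply {n : ℕ} {F G : ℝ → Op n} {F' G' : Op n} {θ : ℝ}
    (hF : ∀ s t, HasDerivAt (fun θ => F θ s t) (F' s t) θ)
    (hG : ∀ s t, HasDerivAt (fun θ => G θ s t) (G' s t) θ) (s t : Fin n → Fin 2) :
    HasDerivAt (fun θ => (F θ * G θ) s t) ((F' * G θ + F θ * G') s t) θ := by
  simp only [Matrix.mul_apply, Matrix.add_apply, ← Finset.sum_add_distrib]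
  exact HasDerivAt.fun_sum fun u _ => (hF s u).mul (hG u t)

/-- Simultaneous rotation by `cos θ + sin θ K`. -/
def rotOp (n : ℕ) (K : Qubit) (θ : ℝ) : Op n := prodOp fun _ => rotCurve K θ

theorem rotOp_mul_neg {K : Qubit} (hK : K * K = -1) (n : ℕ) (θ : ℝ) :
    rotOp n K θ * rotOp n K (-θ) = 1 := by
  rw [rotOp, rotOp, prodOp_mul, rotCurve_mul_neg hK, prodOp_one]

theorem rotOp_neg_mul {K : Qubit} (hK : K * K = -1) (n : ℕ) (θ : ℝ) :
    rotOp n K (-θ) * rotOp n K θ = 1 := by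
  have := rotOp_mul_neg hK n (-θ)
  rwa [neg_neg] at this

theorem totalOp_mul_rotOp (n : ℕ) (K : Qubit) (θ : ℝ) :
    totalOp n K * rotOp n K θ = rotOp n K θ * totalOp n K := by
  rw [rotOp, totalOp_mul_prodOp, prodOp_mul_totalOp]
  refine Finset.sum_congr rfl fun k _ => ?_
  congr 2
  simp [rotCurve, mul_add, add_mul]

theorem hasDerivAt_rotOp {n : ℕ} {K : Qubit} (hK : K * K = -1) (θ : ℝ) (s t : Fin n → Fin 2) :
    HasDerivAt (fun θ => rotOp n K θ s t) ((totalOp n K * rotOp n K θ) s t) θ := by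
  have h : HasDerivAt (fun θ => ∏ k, rotCurve K θ (s k) (t k))
      (∑ k, (∏ l ∈ Finset.univ.erase k, rotCurve K θ (s l) (t l)) •
        (K * rotCurve K θ) (s k) (t k)) θ :=
    HasDerivAt.fun_finsetProd fun k _ => hasDerivAt_rotCurve hK θ (s k) (t k)
  have h1 : totalOp n K * rotOp n K θ = _ := totalOp_mul_prodOp K fun _ => rotCurve K θ
  have h2 : (totalOp n K * rotOp n K θ) s t =
      ∑ k, (∏ l ∈ Finset.univ.erase k, rotCurve K θ (s l) (t l)) •
        (K * rotCurve K θ) (s k) (t k) := by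
    rw [h1, Matrix.sum_apply]
    refine Finset.sum_congr rfl fun k _ => ?_
    rw [prodOp_apply, ← Finset.mul_prod_erase _ _ (Finset.mem_univ k), Function.update_self,
      smul_eq_mul, mul_comm]
    congr 1
    refine Finset.prod_congr rfl fun l hl => ?_
    rw [Function.update_of_ne (Finset.ne_of_mem_erase hl)]
  rw [h2]
  exact h

/-- Rotating the form forward and the operator backward gives a curve whose derivative is the defect
of infinitesimal equivariance, conjugated by rotations. Both directions of the comparison between
group and Lie algebra are read off from it. -/
theorem hasDerivAt_rotated {n : ℕ} {K : Qubit} (hK : K * K = -1)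
    (T : MvPolynomial (Fin 2) ℂ →ₗ[ℂ] Op n) (p : MvPolynomial (Fin 2) ℂ) (θ : ℝ)
    (s t : Fin n → Fin 2) :
    HasDerivAt (fun θ => (rotOp n K (-θ) * T (substAlg (rotCurve K θ) p) * rotOp n K θ) s t)
      ((rotOp n K (-θ) * (T (formDeriv K (substAlg (rotCurve K θ) p)) -
        adTotal n K (T (substAlg (rotCurve K θ) p))) * rotOp n K θ) s t) θ := by
  have h1 : ∀ s t, HasDerivAt (fun θ => rotOp n K (-θ) s t)
      ((-(totalOp n K * rotOp n K (-θ))) s t) θ := fun s t => by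
    have := (hasDerivAt_rotOp hK (-θ) s t).scomp θ (hasDerivAt_neg θ)
    simpa [Function.comp_def] using this
  have h2 : ∀ s t, HasDerivAt (fun θ => T (substAlg (rotCurve K θ) p) s t)
      (T (formDeriv K (substAlg (rotCurve K θ) p)) s t) θ := fun s t =>
    hasDerivAt_substAlg hK θ p ((LinearMap.proj t ∘ₗ LinearMap.proj s : Op n →ₗ[ℂ] ℂ) ∘ₗ T)
  convert hasDerivAt_mul_apply (hasDerivAt_mul_apply h1 h2) (hasDerivAt_rotOp hK θ) s t using 2
  rw [adTotal_apply, totalOp_mul_rotOp n K (-θ)]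
  refine congrFun (congrFun ?_ s) t
  simp only [mul_sub, sub_mul, add_mul, mul_assoc, neg_mul]
  abel

/-- Equivariance makes the curve of `hasDerivAt_rotated` constant; its derivative at θ = 0 is the
claim. -/
theorem formDeriv_intertwines {n j : ℕ} {K : Qubit} (hK : K * K = -1)
    (T : MvPolynomial (Fin 2) ℂ →ₗ[ℂ] Op n)
    (h : ∀ θ, ∀ p : SpinSpace j, T (substAlg (rotCurve K θ) p) =
      rotOp n K θ * T p * rotOp n K (-θ)) (p : SpinSpace j) :
    T (formDeriv K p) = adTotal n K (T p) := by
  ext s t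
  have h1 := hasDerivAt_rotated hK T p.1 0 s t
  have h2 : ∀ θ, (rotOp n K (-θ) * T (substAlg (rotCurve K θ) p) * rotOp n K θ) = T p := by
    intro θ
    rw [h, mul_assoc, mul_assoc, rotOp_neg_mul hK, mul_one, ← mul_assoc, rotOp_neg_mul hK,
      one_mul]
  simp only [h2] at h1
  have h3 := h1.unique (hasDerivAt_const _ _)
  have h4 : rotOp n K 0 = 1 := by rw [rotOp, rotCurve_zero, prodOp_one]
  simp only [neg_zero, h4, one_mul, mul_one, rotCurve_zero, substAlg_one, AlgHom.id_apply,
    Matrix.sub_apply] at h3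
  exact sub_eq_zero.1 h3

/-- Conversely, rotated forms keep their degree, so the hypothesis applies at every θ, the
derivative of the same curve vanishes identically, and its values at θ and 0 agree. -/
theorem rotation_intertwines {n j : ℕ} {K : Qubit} (hK : K * K = -1)
    (T : MvPolynomial (Fin 2) ℂ →ₗ[ℂ] Op n)
    (h : ∀ p : SpinSpace j, T (formDeriv K p) = adTotal n K (T p)) (θ : ℝ) (p : SpinSpace j) :
    T (substAlg (rotCurve K θ) p) = rotOp n K θ * T p * rotOp n K (-θ) := by
  have h4 : rotOp n K 0 = 1 := by rw [rotOp, rotCurve_zero, prodOp_one]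
  have h1 : rotOp n K (-θ) * T (substAlg (rotCurve K θ) p) * rotOp n K θ = T p := by
    ext s t
    have h2 : ∀ θ, HasDerivAt
        (fun θ => (rotOp n K (-θ) * T (substAlg (rotCurve K θ) p) * rotOp n K θ) s t) 0 θ := by
      intro θ
      have h3 := hasDerivAt_rotated hK T p.1 θ s t
      have h5 : T (formDeriv K (substAlg (rotCurve K θ) p)) =
          adTotal n K (T (substAlg (rotCurve K θ) p)) :=
        h ⟨_, substAlg_homogeneous (rotCurve K θ) _ p.2⟩
      rw [h5, sub_self, mul_zero, zero_mul] at h3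
      exact h3
    have h3 := is_const_of_deriv_eq_zero (fun θ => (h2 θ).differentiableAt)
      (fun θ => (h2 θ).deriv) θ 0
    rw [h3, neg_zero, h4, rotCurve_zero, substAlg_one, one_mul, mul_one, AlgHom.id_apply]
  rw [← h1, ← mul_assoc, ← mul_assoc, rotOp_mul_neg hK, one_mul, mul_assoc, rotOp_mul_neg hK,
    mul_one]

/-! ### Polar form of the elements of `SU(2)` -/

theorem rotCurve_mem {K : Qubit} (hK : K * K = -1) (hK' : Kᴴ = -K) (ht : K.trace = 0)
    (hd : K.det = 1) (θ : ℝ) : rotCurve K θ ∈ Matrix.specialUnitaryGroup (Fin 2) ℂ := by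
  have hs : star (rotCurve K θ) = rotCurve K (-θ) := by
    rw [Matrix.star_eq_conjTranspose, rotCurve, Matrix.conjTranspose_add,
      Matrix.conjTranspose_smul, Matrix.conjTranspose_smul, hK', Matrix.conjTranspose_one, rotCurve,
      Complex.star_def, Complex.conj_ofReal, Complex.conj_ofReal]
    simp
  rw [Matrix.mem_specialUnitaryGroup_iff, Matrix.mem_unitaryGroup_iff, hs]
  refine ⟨rotCurve_mul_neg hK θ, ?_⟩
  have h : (Real.cos θ : ℂ) ^ 2 + (Real.sin θ : ℂ) ^ 2 = 1 := by
    exact_mod_cast Real.cos_sq_add_sin_sq θ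
  rw [Matrix.trace_fin_two] at ht
  rw [Matrix.det_fin_two] at hd
  rw [Matrix.det_fin_two]
  simp only [rotCurve, Matrix.add_apply, Matrix.smul_apply, Matrix.one_apply_eq, smul_eq_mul,
    Matrix.one_apply_ne (zero_ne_one' (Fin 2)), Matrix.one_apply_ne (one_ne_zero' (Fin 2))]
  linear_combination h + (Real.sin θ : ℂ) ^ 2 * hd + (Real.cos θ : ℂ) * Real.sin θ * ht

/-- With x = Re U₀₀ = cos θ the trace of U is 2x and its determinant is 1, so (U - x)² = -(1 - x²) =
-sin² θ by Cayley-Hamilton. Hence K = (U - x)/sin θ works when sin θ ≠ 0. -/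
theorem exists_rotCurve_eq (U : SU2) :
    ∃ K : Qubit, ∃ θ : ℝ, K * K = -1 ∧ K.trace = 0 ∧ U.1 = rotCurve K θ := by
  obtain ⟨hU, hd⟩ := Matrix.mem_specialUnitaryGroup_iff.1 U.2
  rw [Matrix.mem_unitaryGroup_iff] at hU
  have hadj : star U.1 = U.1.adjugate := by
    have h := Matrix.adjugate_mul U.1
    rw [hd, one_smul] at h
    calc star U.1 = U.1.adjugate * U.1 * star U.1 := by rw [h, one_mul]
      _ = U.1.adjugate := by rw [mul_assoc, hU, mul_one]
  rw [Matrix.adjugate_fin_two] at hadj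
  have h11 : U.1 1 1 = star (U.1 0 0) := by
    have := congrFun (congrFun hadj 0) 0
    simpa using this.symm
  have h01 : U.1 0 1 = -star (U.1 1 0) := by
    have := congrFun (congrFun hadj 0) 1
    simp only [Matrix.star_apply, Matrix.of_apply, Matrix.cons_val_zero, Matrix.cons_val_one] at this
    rw [this, neg_neg]
  have hd' := hd
  rw [Matrix.det_fin_two] at hd'
  set x : ℝ := (U.1 0 0).re with hx
  have hns : Complex.normSq (U.1 0 0) + Complex.normSq (U.1 1 0) = 1 := by
    have h : ((Complex.normSq (U.1 0 0) + Complex.normSq (U.1 1 0) : ℝ) : ℂ) = 1 := by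
      rw [Complex.ofReal_add, Complex.normSq_eq_conj_mul_self, Complex.normSq_eq_conj_mul_self]
      rw [h11, h01] at hd'
      simp only [Complex.star_def] at hd'
      linear_combination hd'
    exact_mod_cast h
  have hx1 : x ^ 2 ≤ 1 := by
    have h1 := Complex.normSq_apply (U.1 0 0)
    have h2 := Complex.normSq_nonneg (U.1 1 0)
    nlinarith [mul_self_nonneg (U.1 0 0).im]
  have htr : U.1 0 0 + U.1 1 1 = 2 * (x : ℂ) := by
    rw [h11, Complex.star_def, Complex.add_conj]
    push_cast
    rfl
  have hcos : Real.cos (Real.arccos x) = x :=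
    Real.cos_arccos (by nlinarith) (by nlinarith)
  have hsq : Real.sin (Real.arccos x) ^ 2 = 1 - x ^ 2 := by
    rw [Real.sin_sq, hcos]
  by_cases hs : Real.sin (Real.arccos x) = 0
  · have hx2 : x ^ 2 = 1 := by nlinarith
    have h1 := Complex.normSq_apply (U.1 0 0)
    have h2 := Complex.normSq_nonneg (U.1 1 0)
    have him : (U.1 0 0).im = 0 := by
      have : (U.1 0 0).im * (U.1 0 0).im = 0 := by
        nlinarith [mul_self_nonneg (U.1 0 0).im]
      exact mul_self_eq_zero.1 this
    have h10 : U.1 1 0 = 0 := by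
      refine Complex.normSq_eq_zero.1 ?_
      nlinarith [mul_self_nonneg (U.1 0 0).im]
    have h00 : U.1 0 0 = x := Complex.ext rfl (by simpa using him)
    -- Here U is x times the identity with x = ±1, and any K with square -1 and trace zero serves.
    refine ⟨!![Complex.I, 0; 0, -Complex.I], Real.arccos x, ?_, ?_, ?_⟩
    · ext i k
      fin_cases i <;> fin_cases k <;> simp
    · simp [Matrix.trace_fin_two]
    · rw [rotCurve, hs, hcos, Complex.ofReal_zero, zero_smul, add_zero]
      ext i k
      fin_cases i <;> fin_cases k <;> simp [h11, h01, h10, h00]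
  · have hs' : (Real.sin (Real.arccos x) : ℂ) ≠ 0 := by exact_mod_cast hs
    refine ⟨(Real.sin (Real.arccos x) : ℂ)⁻¹ • (U.1 - (x : ℂ) • 1), Real.arccos x, ?_, ?_, ?_⟩
    · have h : (U.1 - (x : ℂ) • (1 : Qubit)) * (U.1 - (x : ℂ) • 1) =
          (-(Real.sin (Real.arccos x) : ℂ) ^ 2) • (1 : Qubit) := by
        have hsq' : (Real.sin (Real.arccos x) : ℂ) ^ 2 = 1 - (x : ℂ) ^ 2 := by exact_mod_cast hsq
        rw [hsq']
        ext i k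
        fin_cases i <;> fin_cases k <;>
          simp [Matrix.mul_apply, Fin.sum_univ_two]
        · linear_combination (U.1 0 0) * htr - hd'
        · linear_combination (U.1 0 1) * htr
        · linear_combination (U.1 1 0) * htr
        · linear_combination (U.1 1 1) * htr - hd'
      rw [smul_mul_smul_comm, h, smul_smul]
      have : (Real.sin (Real.arccos x) : ℂ)⁻¹ * (Real.sin (Real.arccos x) : ℂ)⁻¹ *
          -(Real.sin (Real.arccos x) : ℂ) ^ 2 = -1 := by
        field_simp
      rw [this, neg_one_smul]
    · rw [Matrix.trace_smul, Matrix.trace_sub, Matrix.trace_fin_two, htr]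
      simp
      right
      ring
    · rw [rotCurve, hcos, smul_inv_smul₀ hs', add_sub_cancel]

/-- A linear map on binary forms is equivariant under `SU(2)` if and only if it intertwines the
derivations of the forms with the commutators. -/
theorem equivariant_iff {n j : ℕ} (T : MvPolynomial (Fin 2) ℂ →ₗ[ℂ] Op n) :
    (∀ U : SU2, ∀ p : SpinSpace j, T (spinRep j U p).1 = rotRep n U (T p)) ↔
      ∀ p : SpinSpace j, T (formDeriv spinZ p) = adTotal n spinZ (T p) ∧
        T (formDeriv spinRaise p) = adTotal n spinRaise (T p) ∧
        T (formDeriv spinLower p) = adTotal n spinLower (T p) := by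
  have hrot : ∀ (U : SU2) (K : Qubit) (θ : ℝ), K * K = -1 → U.1 = rotCurve K θ → ∀ X : Op n,
      rotRep n U X = rotOp n K θ * X * rotOp n K (-θ) := by
    intro U K θ hK hU X
    have h : (U⁻¹).1 = rotCurve K (-θ) := by
      have h1 : (U⁻¹).1 * U.1 = 1 := by
        rw [← Submonoid.coe_mul, inv_mul_cancel]
        rfl
      calc (U⁻¹).1 = (U⁻¹).1 * (U.1 * rotCurve K (-θ)) := by
            rw [hU, rotCurve_mul_neg hK, mul_one]
        _ = rotCurve K (-θ) := by rw [← mul_assoc, h1, one_mul]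
    change prodOp (fun _ => U.1) * (X * prodOp fun _ => (U⁻¹).1) = _
    rw [h, hU, ← mul_assoc]
    rfl
  constructor
  · intro h p
    have key : ∀ K : Qubit, K * K = -1 → Kᴴ = -K → K.trace = 0 → K.det = 1 →
        T (formDeriv K p) = adTotal n K (T p) := by
      intro K hK hK' ht hd
      refine formDeriv_intertwines hK T (fun θ q => ?_) p
      rw [← hrot ⟨_, rotCurve_mem hK hK' ht hd θ⟩ K θ hK rfl, ← h]
      rfl
    -- The matrices iσₓ, iσ_y and iσ_z generate one-parameter subgroups of SU(2). Both sides are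
    -- complex linear in K, so the relations for J_z, J₊ and J₋ follow.
    have hx := key !![0, Complex.I; Complex.I, 0]
      (by ext i k; fin_cases i <;> fin_cases k <;> simp)
      (by ext i k; fin_cases i <;> fin_cases k <;> simp)
      (by simp [Matrix.trace_fin_two]) (by simp [Matrix.det_fin_two])
    have hy := key !![0, 1; -1, 0]
      (by ext i k; fin_cases i <;> fin_cases k <;> simp)
      (by ext i k; fin_cases i <;> fin_cases k <;> simp)
      (by simp [Matrix.trace_fin_two]) (by simp [Matrix.det_fin_two])
    have hz := key !![Complex.I, 0; 0, -Complex.I]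
      (by ext i k; fin_cases i <;> fin_cases k <;> simp)
      (by ext i k; fin_cases i <;> fin_cases k <;> simp)
      (by simp [Matrix.trace_fin_two]) (by simp [Matrix.det_fin_two])
    have ez : spinZ = (-Complex.I / 2) • !![Complex.I, 0; 0, -Complex.I] := by
      ext i k
      fin_cases i <;> fin_cases k <;> simp [spinZ] <;> ring_nf <;> simp
      all_goals norm_num
    have er : spinRaise = (1 / 2 : ℂ) • !![0, 1; -1, 0] +
        (-Complex.I / 2) • !![0, Complex.I; Complex.I, 0] := by
      ext i k
      fin_cases i <;> fin_cases k <;> simp [spinRaise] <;> ring_nf <;> simp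
      norm_num
    have el : spinLower = (-1 / 2 : ℂ) • !![0, 1; -1, 0] +
        (-Complex.I / 2) • !![0, Complex.I; Complex.I, 0] := by
      ext i k
      fin_cases i <;> fin_cases k <;> simp [spinLower] <;> ring_nf <;> simp
      norm_num
    refine ⟨?_, ?_, ?_⟩
    · rw [ez, formDeriv_smul, adTotal_smul, Derivation.smul_apply, map_smul, hz,
        LinearMap.smul_apply]
    · rw [er, formDeriv_add, adTotal_add, formDeriv_smul, formDeriv_smul, adTotal_smul,
        adTotal_smul, Derivation.add_apply, Derivation.smul_apply, Derivation.smul_apply, map_add,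
        map_smul, map_smul, hx, hy]
      rfl
    · rw [el, formDeriv_add, adTotal_add, formDeriv_smul, formDeriv_smul, adTotal_smul,
        adTotal_smul, Derivation.add_apply, Derivation.smul_apply, Derivation.smul_apply, map_add,
        map_smul, map_smul, hx, hy]
      rfl
  · intro h U p
    obtain ⟨K, θ, hK, ht, hU⟩ := exists_rotCurve_eq U
    have hK' : K = (2 * K 0 0) • spinZ + (K 0 1 • spinRaise + K 1 0 • spinLower) := by
      rw [Matrix.trace_fin_two] at ht
      ext i k
      fin_cases i <;> fin_cases k <;> simp [spinZ, spinRaise, spinLower]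
      · ring
      · linear_combination ht
    have hi : ∀ p : SpinSpace j, T (formDeriv K p) = adTotal n K (T p) := by
      intro p
      obtain ⟨h1, h2, h3⟩ := h p
      rw [hK', formDeriv_add, formDeriv_add, formDeriv_smul, formDeriv_smul, formDeriv_smul,
        adTotal_add, adTotal_add, adTotal_smul, adTotal_smul, adTotal_smul]
      simp only [Derivation.add_apply, Derivation.smul_apply, map_add, map_smul, h1, h2, h3,
        LinearMap.add_apply, LinearMap.smul_apply]
    rw [hrot U K θ hK hU, ← rotation_intertwines hK T hi θ p, ← hU]
    rfl

/-! ### The standard basis of binary forms -/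

/-- The binary form `x^a y^b`. -/
def monomialForm (a b : ℕ) : MvPolynomial (Fin 2) ℂ := MvPolynomial.X 0 ^ a * MvPolynomial.X 1 ^ b

theorem monomialForm_mem (a b : ℕ) :
    monomialForm a b ∈ MvPolynomial.homogeneousSubmodule (Fin 2) ℂ (a + b) :=
  (MvPolynomial.isHomogeneous_X_pow 0 a).mul (MvPolynomial.isHomogeneous_X_pow 1 b)

theorem monomialForm_eq (a b : ℕ) : monomialForm a b =
    MvPolynomial.monomial (Finsupp.single 0 a + Finsupp.single 1 b) 1 := by
  rw [monomialForm, MvPolynomial.X_pow_eq_monomial, MvPolynomial.X_pow_eq_monomial,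
    MvPolynomial.monomial_mul, one_mul]

theorem formDeriv_pow (M : Qubit) (i : Fin 2) (a : ℕ) :
    formDeriv M (MvPolynomial.X i ^ a) = (a : ℂ) • (MvPolynomial.X i ^ (a - 1) *
      ∑ k, MvPolynomial.C (M k i) * MvPolynomial.X k) := by
  rw [Derivation.leibniz_pow, formDeriv_X, smul_eq_mul, ← Nat.cast_smul_eq_nsmul ℂ]

theorem formDeriv_spinZ (a b : ℕ) :
    formDeriv spinZ (monomialForm a b) = (((a : ℂ) - b) / 2) • monomialForm a b := by
  have ha : (a : ℂ) • (MvPolynomial.X 0 ^ (a - 1) *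
      (MvPolynomial.C (1 / 2) * MvPolynomial.X 0) : MvPolynomial (Fin 2) ℂ) =
      ((a : ℂ) / 2) • MvPolynomial.X 0 ^ a := by
    rcases a with _ | a
    · simp
    · simp only [MvPolynomial.smul_eq_C_mul, Nat.add_sub_cancel, div_eq_mul_inv, map_mul, one_mul]
      ring
  have hb : (b : ℂ) • (MvPolynomial.X 1 ^ (b - 1) *
      (MvPolynomial.C (-1 / 2) * MvPolynomial.X 1) : MvPolynomial (Fin 2) ℂ) =
      (-(b : ℂ) / 2) • MvPolynomial.X 1 ^ b := by
    rcases b with _ | b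
    · simp
    · simp only [MvPolynomial.smul_eq_C_mul, Nat.add_sub_cancel, div_eq_mul_inv, map_mul, neg_mul,
        one_mul, map_neg]
      ring
  rw [monomialForm, Derivation.leibniz, formDeriv_pow, formDeriv_pow]
  simp only [Fin.sum_univ_two, spinZ, Matrix.of_apply, Matrix.cons_val_zero, Matrix.cons_val_one,
    map_zero, zero_mul, zero_add, add_zero, ha, hb]
  simp only [MvPolynomial.smul_eq_C_mul, smul_eq_mul, div_eq_mul_inv, map_mul, map_sub, map_neg]
  ring

theorem formDeriv_spinRaise_zero (a : ℕ) : formDeriv spinRaise (monomialForm a 0) = 0 := by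
  rw [monomialForm, pow_zero, mul_one, formDeriv_pow]
  simp [spinRaise, Fin.sum_univ_two]

theorem formDeriv_spinRaise (a b : ℕ) : formDeriv spinRaise (monomialForm a (b + 1)) =
    ((b : ℂ) + 1) • monomialForm (a + 1) b := by
  rw [monomialForm, Derivation.leibniz, formDeriv_pow, formDeriv_pow]
  simp only [Fin.sum_univ_two, spinRaise, Matrix.of_apply, Matrix.cons_val_zero,
    Matrix.cons_val_one, map_zero, map_one, one_mul, zero_mul, add_zero, mul_zero, smul_zero,
    Nat.add_sub_cancel, monomialForm, MvPolynomial.smul_eq_C_mul, smul_eq_mul]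
  push_cast
  ring

theorem formDeriv_spinLower_zero (b : ℕ) : formDeriv spinLower (monomialForm 0 b) = 0 := by
  rw [monomialForm, pow_zero, one_mul, formDeriv_pow]
  simp [spinLower, Fin.sum_univ_two]

theorem formDeriv_spinLower (a b : ℕ) : formDeriv spinLower (monomialForm (a + 1) b) =
    ((a : ℂ) + 1) • monomialForm a (b + 1) := by
  rw [monomialForm, Derivation.leibniz, formDeriv_pow, formDeriv_pow]
  simp only [Fin.sum_univ_two, spinLower, Matrix.of_apply, Matrix.cons_val_zero,
    Matrix.cons_val_one, map_zero, map_one, one_mul, zero_mul, add_zero, zero_add, mul_zero,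
    smul_zero, Nat.add_sub_cancel, monomialForm, MvPolynomial.smul_eq_C_mul, smul_eq_mul]
  push_cast
  ring

/-- The standard basis `x^{j+m} y^{j-m} / √((j+m)! (j-m)!)` of `φ_j`, extended by zero. -/
def spinVec (j : ℕ) (m : ℤ) : SpinSpace j :=
  if h : |m| ≤ (j : ℤ) then
    (Real.sqrt ((j + m).toNat.factorial * (j - m).toNat.factorial) : ℂ)⁻¹ •
      ⟨monomialForm (j + m).toNat (j - m).toNat, by
        have h' := abs_le.1 h
        have h2 : 2 * j = (j + m).toNat + (j - m).toNat := by omega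
        rw [h2]
        exact monomialForm_mem _ _⟩
  else 0

theorem factorial_sqrt_ne_zero (a b : ℕ) :
    (Real.sqrt (a.factorial * b.factorial) : ℂ) ≠ 0 := by
  rw [Ne, Complex.ofReal_eq_zero]
  have h1 : (0 : ℝ) < a.factorial := by exact_mod_cast a.factorial_pos
  have h2 : (0 : ℝ) < b.factorial := by exact_mod_cast b.factorial_pos
  exact (Real.sqrt_pos.2 (mul_pos h1 h2)).ne'

theorem spinVec_of_lt {j : ℕ} {m : ℤ} (h : (j : ℤ) < |m|) : spinVec j m = 0 :=
  dif_neg (not_le.2 h)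

theorem spinVec_coe {j a b : ℕ} (h : a + b = 2 * j) :
    (spinVec j ((a : ℤ) - j)).1 =
      (Real.sqrt (a.factorial * b.factorial) : ℂ)⁻¹ • monomialForm a b := by
  have h1 : |(a : ℤ) - j| ≤ (j : ℤ) := abs_le.2 ⟨by omega, by omega⟩
  have h2 : ((j : ℤ) + (a - j)).toNat = a := by omega
  have h3 : ((j : ℤ) - (a - j)).toNat = b := by omega
  rw [spinVec, dif_pos h1]
  simp only [h2, h3, Submodule.coe_smul]

/-- The normalisation of the monomials turns the derivative factor b + 1 into the Condon-Shortley
coefficient √((a+1)(b+1)). With the roles of a and b exchanged it also serves for lowering. -/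
theorem sqrt_factorial_step (a b : ℕ) :
    (Real.sqrt (a.factorial * (b + 1).factorial) : ℂ)⁻¹ * ((b : ℂ) + 1) =
      (Real.sqrt (((b : ℝ) + 1) * (a + 1)) : ℂ) *
        (Real.sqrt ((a + 1).factorial * b.factorial) : ℂ)⁻¹ := by
  rw [inv_mul_eq_iff_eq_mul₀ (factorial_sqrt_ne_zero _ _), ← mul_assoc,
    eq_mul_inv_iff_mul_eq₀ (factorial_sqrt_ne_zero _ _)]
  have h : ((b : ℝ) + 1) * Real.sqrt ((a + 1).factorial * b.factorial) =
      Real.sqrt (a.factorial * (b + 1).factorial) * Real.sqrt (((b : ℝ) + 1) * (a + 1)) := by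
    have hb : (0 : ℝ) ≤ (b : ℝ) + 1 := by positivity
    rw [← Real.sqrt_mul (by positivity)]
    nth_rw 1 [← Real.sqrt_sq hb]
    rw [← Real.sqrt_mul (by positivity)]
    congr 1
    rw [Nat.factorial_succ, Nat.factorial_succ]
    push_cast
    ring
  exact_mod_cast h

theorem spinVec_relations {j : ℕ} {m : ℤ} (hm : |m| ≤ (j : ℤ)) :
    formDeriv spinZ (spinVec j m).1 = (m : ℂ) • (spinVec j m).1 ∧
    formDeriv spinRaise (spinVec j m).1 =
      (Real.sqrt ((j : ℝ) * (j + 1) - m * (m + 1)) : ℂ) • (spinVec j (m + 1)).1 ∧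
    formDeriv spinLower (spinVec j m).1 =
      (Real.sqrt ((j : ℝ) * (j + 1) - m * (m - 1)) : ℂ) • (spinVec j (m - 1)).1 := by
  obtain ⟨a, b, hab, rfl⟩ : ∃ a b : ℕ, a + b = 2 * j ∧ m = (a : ℤ) - j := by
    have := abs_le.1 hm
    exact ⟨(j + m).toNat, (j - m).toNat, by omega, by omega⟩
  have hj : (j : ℂ) = ((a : ℂ) + b) / 2 := by
    rw [eq_div_iff two_ne_zero, mul_comm]
    exact_mod_cast hab.symm
  have hj' : (j : ℝ) = ((a : ℝ) + b) / 2 := by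
    rw [eq_div_iff two_ne_zero, mul_comm]
    exact_mod_cast hab.symm
  rw [spinVec_coe hab]
  refine ⟨?_, ?_, ?_⟩
  · rw [Derivation.map_smul, formDeriv_spinZ, smul_comm]
    congr 1
    push_cast
    rw [hj]
    ring
  · rcases b with _ | b
    · rw [Derivation.map_smul, formDeriv_spinRaise_zero, smul_zero, spinVec_of_lt, Submodule.coe_zero,
        smul_zero]
      rw [lt_abs]
      omega
    · have h1 : (a : ℤ) - j + 1 = ((a + 1 : ℕ) : ℤ) - j := by push_cast; ring
      rw [h1, spinVec_coe (b := b) (by omega), Derivation.map_smul, formDeriv_spinRaise, smul_smul,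
        smul_smul, sqrt_factorial_step]
      congr 4
      push_cast
      rw [hj']
      push_cast
      ring
  · rcases a with _ | a
    · rw [Derivation.map_smul, formDeriv_spinLower_zero, smul_zero, spinVec_of_lt, Submodule.coe_zero,
        smul_zero]
      rw [lt_abs]
      omega
    · have h1 : ((a + 1 : ℕ) : ℤ) - j - 1 = (a : ℤ) - j := by push_cast; ring
      rw [h1, spinVec_coe (b := b + 1) (by omega), Derivation.map_smul, formDeriv_spinLower,
        smul_smul, smul_smul, mul_comm ((a + 1).factorial : ℝ), sqrt_factorial_step,
        mul_comm ((b + 1).factorial : ℝ)]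
      congr 4
      push_cast
      rw [hj']
      push_cast
      ring

theorem span_spinVec (j : ℕ) : Submodule.span ℂ (Set.range (spinVec j)) = ⊤ := by
  rw [eq_top_iff]
  rintro ⟨p, hp⟩ -
  have key : ∀ p ∈ MvPolynomial.homogeneousSubmodule (Fin 2) ℂ (2 * j),
      p ∈ (Submodule.span ℂ (Set.range (spinVec j))).map (Submodule.subtype _) := by
    intro p hp
    rw [MvPolynomial.as_sum p]
    refine Submodule.sum_mem _ fun s hs => ?_
    have h1 : s 0 + s 1 = 2 * j := by
      have := hp (MvPolynomial.mem_support_iff.1 hs)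
      rw [Finsupp.weight_apply, Finsupp.sum_fintype _ _ (by simp), Fin.sum_univ_two] at this
      simpa using this
    have h2 : MvPolynomial.monomial s (MvPolynomial.coeff s p) =
        (MvPolynomial.coeff s p * (Real.sqrt ((s 0).factorial * (s 1).factorial) : ℂ)) •
          (spinVec j ((s 0 : ℤ) - j)).1 := by
      have hs : s = Finsupp.single 0 (s 0) + Finsupp.single 1 (s 1) := by
        ext i
        fin_cases i <;> simp
      rw [spinVec_coe h1, smul_smul, mul_inv_cancel_right₀ (factorial_sqrt_ne_zero _ _),
        monomialForm_eq, ← hs, MvPolynomial.smul_monomial, smul_eq_mul, mul_one]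
    rw [h2]
    refine Submodule.smul_mem _ _ ⟨_, Submodule.subset_span ⟨_, rfl⟩, rfl⟩
  obtain ⟨q, hq, hqp⟩ := key p hp
  have : q = ⟨p, hp⟩ := Subtype.ext hqp
  rwa [← this]

/-! ### Equivariant maps and tensor operators -/

/-- The `SU(2)`-equivariant maps from `φ_j` to the operators with values in `W`. -/
def equivariantMaps {n : ℕ} (W : Submodule ℂ (Op n)) (j : ℕ) :
    Submodule ℂ (SpinSpace j →ₗ[ℂ] Op n) where
  carrier := {T | (∀ p, T p ∈ W) ∧ ∀ U p, T (spinRep j U p) = rotRep n U (T p)}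
  zero_mem' := by simp
  add_mem' := by
    rintro S T ⟨hS, hS'⟩ ⟨hT, hT'⟩
    exact ⟨fun p => W.add_mem (hS p) (hT p), fun U p => by
      simp only [LinearMap.add_apply, hS', hT', map_add]⟩
  smul_mem' := by
    rintro c T ⟨hT, hT'⟩
    exact ⟨fun p => W.smul_mem c (hT p), fun U p => by
      simp only [LinearMap.smul_apply, hT', map_smul]⟩

theorem mem_equivariantMaps {n : ℕ} {W : Submodule ℂ (Op n)} {j : ℕ} {T : SpinSpace j →ₗ[ℂ] Op n} :
    T ∈ equivariantMaps W j ↔ (∀ p, T p ∈ W) ∧ ∀ U p, T (spinRep j U p) = rotRep n U (T p) :=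
  Iff.rfl

/-- The components of a linear map on the standard basis. -/
def components (n j : ℕ) : (SpinSpace j →ₗ[ℂ] Op n) →ₗ[ℂ] (ℤ → Op n) where
  toFun T m := T (spinVec j m)
  map_add' _ _ := rfl
  map_smul' _ _ := rfl

theorem components_injective (n j : ℕ) : Function.Injective (components n j) := by
  intro S T h
  refine LinearMap.ext_on_range (v := spinVec j) ?_ fun m => congrFun h m
  rw [span_spinVec]

theorem components_mem {n j : ℕ} {W : Submodule ℂ (Op n)} {T : SpinSpace j →ₗ[ℂ] Op n}
    (hT : T ∈ equivariantMaps W j) : components n j T ∈ tensorOperators W j := by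
  -- `equivariant_iff` speaks of maps defined on all polynomials; any linear extension from the
  -- forms of degree 2j will do.
  obtain ⟨T', rfl⟩ := T.exists_extend
  have h := (equivariant_iff (j := j) T').1 hT.2
  refine mem_tensorOperators.2 ⟨fun m => hT.1 _, fun m hm => ?_, fun m hm => ?_⟩
  · change T' (spinVec j m).1 = 0
    rw [spinVec_of_lt hm, Submodule.coe_zero, map_zero]
  · obtain ⟨h1, h2, h3⟩ := h (spinVec j m)
    obtain ⟨r1, r2, r3⟩ := spinVec_relations hm
    rw [r1, map_smul] at h1
    rw [r2, map_smul] at h2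
    rw [r3, map_smul] at h3
    exact ⟨h1.symm, h2.symm, h3.symm⟩

theorem exists_components_eq {n j : ℕ} {W : Submodule ℂ (Op n)} {τ : ℤ → Op n}
    (hτ : τ ∈ tensorOperators W j) : ∃ T ∈ equivariantMaps W j, components n j T = τ := by
  obtain ⟨hW, h0, hr⟩ := mem_tensorOperators.1 hτ
  -- The factor undoes the normalisation of `spinVec`. Only the values on monomials of degree 2j
  -- matter.
  let T' : MvPolynomial (Fin 2) ℂ →ₗ[ℂ] Op n := (MvPolynomial.basisMonomials (Fin 2) ℂ).constr ℂ
    fun s => (Real.sqrt ((s 0).factorial * (s 1).factorial) : ℂ) • τ ((s 0 : ℤ) - j)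
  have hT' : ∀ m, T' (spinVec j m).1 = τ m := by
    intro m
    by_cases hm : |m| ≤ (j : ℤ)
    · obtain ⟨a, b, hab, rfl⟩ : ∃ a b : ℕ, a + b = 2 * j ∧ m = (a : ℤ) - j := by
        have := abs_le.1 hm
        exact ⟨(j + m).toNat, (j - m).toNat, by omega, by omega⟩
      rw [spinVec_coe hab, map_smul, monomialForm_eq]
      have := (MvPolynomial.basisMonomials (Fin 2) ℂ).constr_basis ℂ
        (fun s => (Real.sqrt ((s 0).factorial * (s 1).factorial) : ℂ) • τ ((s 0 : ℤ) - j))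
        (Finsupp.single 0 a + Finsupp.single 1 b)
      rw [MvPolynomial.coe_basisMonomials] at this
      change _ • T' _ = _
      rw [this]
      simp only [Finsupp.add_apply, Finsupp.single_eq_same, ne_eq, one_ne_zero, zero_ne_one,
        not_false_eq_true, Finsupp.single_eq_of_ne, add_zero, zero_add]
      rw [inv_smul_smul₀ (factorial_sqrt_ne_zero _ _)]
    · rw [spinVec_of_lt (not_le.1 hm), Submodule.coe_zero, map_zero, h0 m (not_le.1 hm)]
  refine ⟨T' ∘ₗ Submodule.subtype _, ⟨fun p => ?_, ?_⟩, funext hT'⟩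
  · have hp : p ∈ Submodule.span ℂ (Set.range (spinVec j)) := by rw [span_spinVec]; trivial
    induction hp using Submodule.span_induction with
    | mem x hx =>
      obtain ⟨m, rfl⟩ := hx
      change T' (spinVec j m).1 ∈ W
      rw [hT']
      exact hW m
    | zero => simp
    | add x y _ _ hx hy => rw [map_add]; exact W.add_mem hx hy
    | smul c x _ hx => rw [map_smul]; exact W.smul_mem _ hx
  · refine (equivariant_iff (j := j) T').2 fun p => ?_
    have hp : p ∈ Submodule.span ℂ (Set.range (spinVec j)) := by rw [span_spinVec]; trivial
    induction hp using Submodule.span_induction with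
    | mem x hx =>
      obtain ⟨m, rfl⟩ := hx
      by_cases hm : |m| ≤ (j : ℤ)
      · obtain ⟨r1, r2, r3⟩ := spinVec_relations hm
        obtain ⟨s1, s2, s3⟩ := hr m hm
        rw [r1, r2, r3, map_smul, map_smul, map_smul, hT', hT', hT']
        exact ⟨s1.symm, s2.symm, s3.symm⟩
      · rw [spinVec_of_lt (not_le.1 hm)]
        simp
    | zero => simp
    | add x y _ _ hx hy =>
      simp only [Submodule.coe_add, map_add, hx.1, hx.2.1, hx.2.2, hy.1, hy.2.1, hy.2.2, and_self]
    | smul c x _ hx =>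
      simp only [Submodule.coe_smul, Derivation.map_smul, map_smul, hx.1, hx.2.1, hx.2.2, and_self]

/-- Components on the standard basis give an isomorphism: the passage from the group SU(2) to
Racah's commutation relations. No stability of `W` is needed. -/
theorem finrank_equivariantMaps {n : ℕ} (W : Submodule ℂ (Op n)) (j : ℕ) :
    Module.finrank ℂ (equivariantMaps W j) = Module.finrank ℂ (tensorOperators W j) := by
  have h : (equivariantMaps W j).map (components n j) = tensorOperators W j := by
    refine le_antisymm ?_ fun τ hτ => ?_
    · rintro _ ⟨T, hT, rfl⟩
      exact components_mem hT
    · obtain ⟨T, hT, rfl⟩ := exists_components_eq hτ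
      exact ⟨T, hT, rfl⟩
  rw [← h]
  exact LinearEquiv.finrank_eq (Submodule.equivMapOfInjective _ (components_injective n j) _)

/-! ### Row and column sums -/

theorem eq_zero_of_eq_neg {M : Type*} [AddCommGroup M] [Module ℂ M] {x : M} (h : x = -x) :
    x = 0 := by
  have h2 : (2 : ℂ) • x = 0 := by
    rw [two_smul]
    nth_rw 1 [h]
    exact neg_add_cancel x
  exact (smul_eq_zero.1 h2).resolve_left two_ne_zero


section Symmetrizer

variable {μ : YoungDiagram} {α : Type} [Fintype α] [LinearOrder α]

/-- `σ` permutes the rows of `t`. -/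
def RowPreserving (t : μ.cells ≃ α) (σ : Equiv.Perm α) : Prop := ∀ x, rowOf t (σ x) = rowOf t x

/-- `σ` permutes the columns of `t`. -/
def ColPreserving (t : μ.cells ≃ α) (σ : Equiv.Perm α) : Prop := ∀ x, colOf t (σ x) = colOf t x

theorem RowPreserving.mul {t : μ.cells ≃ α} {σ τ : Equiv.Perm α} (hσ : RowPreserving t σ)
    (hτ : RowPreserving t τ) : RowPreserving t (σ * τ) := fun x => (hσ _).trans (hτ x)

theorem RowPreserving.inv {t : μ.cells ≃ α} {σ : Equiv.Perm α} (hσ : RowPreserving t σ) :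
    RowPreserving t σ⁻¹ := fun x => by
  have := hσ (σ⁻¹ x)
  rw [← this]
  simp

theorem ColPreserving.mul {t : μ.cells ≃ α} {σ τ : Equiv.Perm α} (hσ : ColPreserving t σ)
    (hτ : ColPreserving t τ) : ColPreserving t (σ * τ) := fun x => (hσ _).trans (hτ x)

theorem ColPreserving.inv {t : μ.cells ≃ α} {σ : Equiv.Perm α} (hσ : ColPreserving t σ) :
    ColPreserving t σ⁻¹ := fun x => by
  have := hσ (σ⁻¹ x)
  rw [← this]
  simp

theorem rowPreserving_swap {t : μ.cells ≃ α} {a b : α} (h : rowOf t a = rowOf t b) :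
    RowPreserving t (Equiv.swap a b) := fun x => by
  rw [Equiv.swap_apply_def]
  split_ifs with h1 h2
  · rw [h1, h]
  · rw [h2, h]
  · rfl

theorem colPreserving_swap {t : μ.cells ≃ α} {a b : α} (h : colOf t a = colOf t b) :
    ColPreserving t (Equiv.swap a b) := fun x => by
  rw [Equiv.swap_apply_def]
  split_ifs with h1 h2
  · rw [h1, h]
  · rw [h2, h]
  · rfl

theorem cell_ext {t : μ.cells ≃ α} {a b : α} (h : rowOf t a = rowOf t b)
    (h' : colOf t a = colOf t b) : a = b :=
  t.symm.injective (Subtype.ext (Prod.ext h h'))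

theorem eq_one_of_preserving {t : μ.cells ≃ α} {σ : Equiv.Perm α} (h : RowPreserving t σ)
    (h' : ColPreserving t σ) : σ = 1 :=
  Equiv.ext fun x => cell_ext (h x) (h' x)

open scoped Classical in
theorem rowSum_eq (t : μ.cells ≃ α) : rowSum t =
    ∑ σ : Equiv.Perm α with RowPreserving t σ, MonoidAlgebra.of ℂ _ σ := by
  rw [rowSum]
  congr!

open scoped Classical in
theorem colSum_eq (t : μ.cells ≃ α) : colSum t =
    ∑ σ : Equiv.Perm α with ColPreserving t σ,
      ((Equiv.Perm.sign σ : ℤ) : ℂ) • MonoidAlgebra.of ℂ _ σ := by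
  rw [colSum]
  congr!

theorem of_mul_rowSum {t : μ.cells ≃ α} {σ : Equiv.Perm α} (h : RowPreserving t σ) :
    MonoidAlgebra.of ℂ _ σ * rowSum t = rowSum t := by
  classical
  rw [rowSum_eq, Finset.mul_sum]
  refine Finset.sum_equiv (Equiv.mulLeft σ) (fun τ => ?_) fun τ _ => ?_
  · simp only [Finset.mem_filter, Finset.mem_univ, true_and, Equiv.coe_mulLeft]
    exact ⟨h.mul, fun h' => by simpa using h.inv.mul h'⟩
  · rw [← map_mul]; rfl

theorem rowSum_mul_of {t : μ.cells ≃ α} {σ : Equiv.Perm α} (h : RowPreserving t σ) :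
    rowSum t * MonoidAlgebra.of ℂ _ σ = rowSum t := by
  classical
  rw [rowSum_eq, Finset.sum_mul]
  refine Finset.sum_equiv (Equiv.mulRight σ) (fun τ => ?_) fun τ _ => ?_
  · simp only [Finset.mem_filter, Finset.mem_univ, true_and, Equiv.coe_mulRight]
    exact ⟨fun h' => h'.mul h, fun h' => by simpa using h'.mul h.inv⟩
  · rw [← map_mul]; rfl

theorem sign_cast_mul_self (σ : Equiv.Perm α) :
    ((Equiv.Perm.sign σ : ℤ) : ℂ) * ((Equiv.Perm.sign σ : ℤ) : ℂ) = 1 := by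
  have h : (Equiv.Perm.sign σ : ℤ) * (Equiv.Perm.sign σ : ℤ) = 1 := by
    rw [← Units.val_mul, Int.units_mul_self, Units.val_one]
  exact_mod_cast h

theorem of_mul_colSum {t : μ.cells ≃ α} {σ : Equiv.Perm α} (h : ColPreserving t σ) :
    MonoidAlgebra.of ℂ _ σ * colSum t = ((Equiv.Perm.sign σ : ℤ) : ℂ) • colSum t := by
  classical
  rw [colSum_eq, Finset.mul_sum, Finset.smul_sum]
  refine Finset.sum_equiv (Equiv.mulLeft σ) (fun τ => ?_) fun τ _ => ?_
  · simp only [Finset.mem_filter, Finset.mem_univ, true_and, Equiv.coe_mulLeft]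
    exact ⟨h.mul, fun h' => by simpa using h.inv.mul h'⟩
  · rw [mul_smul_comm, ← map_mul, Equiv.coe_mulLeft, smul_smul, Equiv.Perm.sign_mul, Units.val_mul,
      Int.cast_mul, ← mul_assoc, sign_cast_mul_self, one_mul]

theorem swap_mul_colSum {t : μ.cells ≃ α} {a b : α} (hab : a ≠ b) (h : colOf t a = colOf t b) :
    MonoidAlgebra.of ℂ _ (Equiv.swap a b) * colSum t = -colSum t := by
  rw [of_mul_colSum (colPreserving_swap h), Equiv.Perm.sign_swap hab]
  simp

/-! ### The Young symmetrizer is idempotent up to a scalar -/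

/-- The elements of s outside {0, …, k-1} are at least k, and they are as many as the missing ones,
each at most k - 1. Equality therefore forces s to be the initial segment. -/
theorem sum_le_of_card {s : Finset ℕ} {k : ℕ} (hs : s.card = k) :
    ∑ i ∈ Finset.range k, i ≤ ∑ i ∈ s, i ∧
      (∑ i ∈ s, i ≤ ∑ i ∈ Finset.range k, i → s = Finset.range k) := by
  have hc : (s \ Finset.range k).card = (Finset.range k \ s).card := by
    have h1 := Finset.card_sdiff_add_card_inter s (Finset.range k)
    have h2 := Finset.card_sdiff_add_card_inter (Finset.range k) s
    rw [Finset.inter_comm, Finset.card_range] at h2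
    omega
  have h1 : ∑ i ∈ s \ Finset.range k, i ≥ (s \ Finset.range k).card * k := by
    rw [← smul_eq_mul, ← Finset.sum_const]
    refine Finset.sum_le_sum fun i hi => ?_
    simpa using (Finset.mem_sdiff.1 hi).2
  have h2 : ∑ i ∈ Finset.range k \ s, (i + 1) ≤ (Finset.range k \ s).card * k := by
    rw [← smul_eq_mul, ← Finset.sum_const]
    refine Finset.sum_le_sum fun i hi => ?_
    simpa using (Finset.mem_sdiff.1 hi).1
  rw [Finset.sum_add_distrib, Finset.sum_const, smul_eq_mul, mul_one] at h2
  have h3 := Finset.sum_sdiff (f := fun i : ℕ => i) (Finset.inter_subset_left (s₁ := s)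
    (s₂ := Finset.range k))
  have h4 := Finset.sum_sdiff (f := fun i : ℕ => i) (Finset.inter_subset_left
    (s₁ := Finset.range k) (s₂ := s))
  rw [Finset.sdiff_inter_self_left] at h3 h4
  rw [Finset.inter_comm] at h4
  rw [hc] at h1
  refine ⟨by omega, fun h => ?_⟩
  have h5 : (Finset.range k \ s).card = 0 := by omega
  have h6 : Finset.range k ⊆ s := Finset.sdiff_eq_empty_iff_subset.1 (Finset.card_eq_zero.1 h5)
  exact (Finset.eq_of_subset_of_card_le h6 (by simp [hs])).symm

theorem card_row (t : μ.cells ≃ α) (i : ℕ) :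
    (Finset.univ.filter fun a => rowOf t a = i).card = μ.rowLen i := by
  rw [YoungDiagram.rowLen_eq_card]
  refine Finset.card_bij (fun a _ => (t.symm a).1) (fun a ha => ?_)
    (fun a _ b _ h => t.symm.injective (Subtype.ext h)) fun c hc => ?_
  · rw [YoungDiagram.mem_row_iff]
    exact ⟨(YoungDiagram.mem_cells _).1 (t.symm a).2, (Finset.mem_filter.1 ha).2⟩
  · obtain ⟨h1, h2⟩ := YoungDiagram.mem_row_iff.1 hc
    refine ⟨t ⟨c, (YoungDiagram.mem_cells _).2 h1⟩, ?_, by simp⟩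
    exact Finset.mem_filter.2 ⟨Finset.mem_univ _, by simpa [rowOf] using h2⟩

theorem image_row (t : μ.cells ≃ α) (i : ℕ) :
    (Finset.univ.filter fun a => rowOf t a = i).image (colOf t) = Finset.range (μ.rowLen i) := by
  refine Finset.eq_of_subset_of_card_le (fun j hj => ?_) ?_
  · obtain ⟨a, ha, rfl⟩ := Finset.mem_image.1 hj
    rw [Finset.mem_range, ← YoungDiagram.mem_iff_lt_rowLen, ← (Finset.mem_filter.1 ha).2]
    exact (YoungDiagram.mem_cells _).1 (t.symm a).2
  · rw [Finset.card_range, Finset.card_image_of_injOn, card_row]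
    intro a ha b hb h
    exact cell_ext (((Finset.mem_filter.1 ha).2).trans ((Finset.mem_filter.1 hb).2).symm) h

/-- If the elements of each row of `t` lie in different columns of the tableau `x t`, then each of
them can be moved within its row to its column of `x t`. -/
theorem mem_diagram_of_injective (t : μ.cells ≃ α) (x : Equiv.Perm α)
    (h : ∀ a b, rowOf t a = rowOf t b → colOf t (x a) = colOf t (x b) → a = b) (a : α) :
    (rowOf t a, colOf t (x a)) ∈ μ := by
  have key : ∀ i, (Finset.univ.filter fun a => rowOf t a = i).image (fun a => colOf t (x a)) =
      Finset.range (μ.rowLen i) := by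
    have hinj : ∀ i, Set.InjOn (fun a => colOf t (x a))
        (Finset.univ.filter fun a => rowOf t a = i) := by
      intro i a ha b hb h1
      simp only [Finset.coe_filter, Finset.mem_univ, true_and, Set.mem_ofPred_eq] at ha hb
      exact h a b (ha.trans hb.symm) h1
    have hinj' : ∀ i, Set.InjOn (colOf t) (Finset.univ.filter fun a => rowOf t a = i) := by
      intro i a ha b hb h1
      simp only [Finset.coe_filter, Finset.mem_univ, true_and, Set.mem_ofPred_eq] at ha hb
      exact cell_ext (ha.trans hb.symm) h1
    have hle : ∀ i, ∑ a with rowOf t a = i, colOf t a ≤ ∑ a with rowOf t a = i, colOf t (x a) ∧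
        (∑ a with rowOf t a = i, colOf t (x a) ≤ ∑ a with rowOf t a = i, colOf t a →
          (Finset.univ.filter fun a => rowOf t a = i).image (fun a => colOf t (x a)) =
            Finset.range (μ.rowLen i)) := by
      intro i
      have h1 := sum_le_of_card (s := (Finset.univ.filter fun a => rowOf t a = i).image
        (fun a => colOf t (x a))) (k := μ.rowLen i)
        (by rw [Finset.card_image_of_injOn (hinj i), card_row])
      rw [← image_row t i, Finset.sum_image (hinj i), Finset.sum_image (hinj' i), image_row t i]
        at h1
      exact h1
    -- Every row contributes at least its own sum of column numbers, and `x` being a permutation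
    -- leaves the total unchanged. So equality holds in each row, and there the new columns again
    -- form an initial segment.
    have htot : ∑ a, colOf t (x a) = ∑ a, colOf t a := Equiv.sum_comp x (colOf t)
    rw [← Finset.sum_fiberwise_of_maps_to (s := Finset.univ) (t := Finset.univ.image (rowOf t))
      (g := rowOf t) (fun a _ => Finset.mem_image_of_mem _ (Finset.mem_univ a))
      (fun a => colOf t (x a)),
      ← Finset.sum_fiberwise_of_maps_to (s := Finset.univ) (t := Finset.univ.image (rowOf t))
      (g := rowOf t) (fun a _ => Finset.mem_image_of_mem _ (Finset.mem_univ a)) (colOf t)] at htot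
    have heq := (Finset.sum_eq_sum_iff_of_le fun i _ => (hle i).1).1 htot.symm
    intro i
    by_cases hi : i ∈ Finset.univ.image (rowOf t)
    · exact (hle i).2 (heq i hi).ge
    · have h0 : (Finset.univ.filter fun a => rowOf t a = i) = ∅ := by
        refine Finset.filter_eq_empty_iff.2 fun a _ ha => hi ?_
        exact Finset.mem_image.2 ⟨a, Finset.mem_univ _, ha⟩
      have h1 := card_row t i
      rw [h0, Finset.card_empty] at h1
      rw [h0, ← h1]
      rfl
  rw [YoungDiagram.mem_iff_lt_rowLen, ← Finset.mem_range, ← key]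
  exact Finset.mem_image.2 ⟨a, by simp, rfl⟩

/-- Let u move each a within its row to the column of x⁻¹a. Then u is injective and preserves rows,
while ux preserves columns, and x = u⁻¹(ux). -/
theorem exists_preserving_of_injective (t : μ.cells ≃ α) (x : Equiv.Perm α)
    (h : ∀ a b, rowOf t a = rowOf t b → colOf t (x⁻¹ a) = colOf t (x⁻¹ b) → a = b) :
    ∃ σ τ : Equiv.Perm α, RowPreserving t σ ∧ ColPreserving t τ ∧ x = σ * τ := by
  let u : α → α := fun a => t ⟨_, (YoungDiagram.mem_cells _).2 (mem_diagram_of_injective t x⁻¹ h a)⟩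
  have hr : ∀ a, rowOf t (u a) = rowOf t a := fun a => by simp [u, rowOf]
  have hc : ∀ a, colOf t (u a) = colOf t (x⁻¹ a) := fun a => by simp [u, colOf]
  have hu : Function.Injective u := fun a b hab => by
    refine h a b ?_ ?_
    · rw [← hr, hab, hr]
    · rw [← hc, hab, hc]
  let σ : Equiv.Perm α := Equiv.ofBijective u (Finite.injective_iff_bijective.1 hu)
  have hσ : RowPreserving t σ := hr
  refine ⟨σ⁻¹, σ * x, hσ.inv, fun b => ?_, by simp⟩
  change colOf t (u (x b)) = _
  rw [hc]
  simp

/-- Von Neumann's lemma. Either x is a row permutation times a column permutation, and HxV = ±HV; or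
some a, b in one row have x⁻¹a, x⁻¹b in one column. In that case inserting the transposition (a b)
changes the sign of HxV, so it is zero. -/
theorem rowSum_mul_of_mul_colSum (t : μ.cells ≃ α) (x : Equiv.Perm α) :
    ∃ c : ℂ, rowSum t * MonoidAlgebra.of ℂ _ x * colSum t = c • (rowSum t * colSum t) := by
  by_cases h : ∀ a b, rowOf t a = rowOf t b → colOf t (x⁻¹ a) = colOf t (x⁻¹ b) → a = b
  · obtain ⟨σ, τ, hσ, hτ, rfl⟩ := exists_preserving_of_injective t x h
    refine ⟨((Equiv.Perm.sign τ : ℤ) : ℂ), ?_⟩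
    rw [map_mul, ← mul_assoc, rowSum_mul_of hσ, mul_assoc, of_mul_colSum hτ, mul_smul_comm]
  · push Not at h
    obtain ⟨a, b, h1, h2, hab⟩ := h
    refine ⟨0, ?_⟩
    rw [zero_smul]
    have h3 : Equiv.swap a b * x = x * Equiv.swap (x⁻¹ a) (x⁻¹ b) := by
      rw [Equiv.swap_apply_apply]
      simp [mul_assoc]
    have h4 : rowSum t * MonoidAlgebra.of ℂ _ x * colSum t =
        -(rowSum t * MonoidAlgebra.of ℂ _ x * colSum t) := by
      nth_rw 1 [← rowSum_mul_of (rowPreserving_swap h1)]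
      rw [mul_assoc (rowSum t), ← map_mul, h3, map_mul, mul_assoc, mul_assoc,
        swap_mul_colSum (x⁻¹.injective.ne hab) h2, mul_neg, mul_neg, mul_assoc]
    exact eq_zero_of_eq_neg h4

theorem exists_symmetrizer_sq (t : μ.cells ≃ α) :
    ∃ c : ℂ, rowSum t * colSum t * (rowSum t * colSum t) = c • (rowSum t * colSum t) := by
  have key : ∀ y : MonoidAlgebra ℂ (Equiv.Perm α),
      ∃ c : ℂ, rowSum t * y * colSum t = c • (rowSum t * colSum t) := by
    intro y
    induction y using MonoidAlgebra.induction_on with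
    | of x => exact rowSum_mul_of_mul_colSum t x
    | add f g hf hg =>
      obtain ⟨c, hc⟩ := hf
      obtain ⟨d, hd⟩ := hg
      exact ⟨c + d, by rw [mul_add, add_mul, hc, hd, add_smul]⟩
    | smul r f hf =>
      obtain ⟨c, hc⟩ := hf
      exact ⟨r * c, by rw [mul_smul_comm, smul_mul_assoc, hc, smul_smul]⟩
  obtain ⟨c, hc⟩ := key (colSum t * rowSum t)
  exact ⟨c, by rw [← hc]; simp only [mul_assoc]⟩

end Symmetrizer

section JucysMurphy

variable {μ : YoungDiagram} {α : Type} [Fintype α] [LinearOrder α]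

/-! ### Jucys-Murphy elements -/

/-- The Jucys-Murphy element of `k`: the sum of the transpositions `(i k)` with `i < k`. -/
def jucysMurphy (k : α) : MonoidAlgebra ℂ (Equiv.Perm α) :=
  ∑ i with i < k, MonoidAlgebra.of ℂ _ (Equiv.swap i k)

theorem swap_inv_mul (h : Equiv.Perm α) (k y : α) :
    Equiv.swap k (h y) * h = h * Equiv.swap (h⁻¹ k) y := by
  have : Equiv.swap k (h y) = h * Equiv.swap (h⁻¹ k) y * h⁻¹ := by
    rw [← Equiv.swap_apply_apply]
    simp
  rw [this, inv_mul_cancel_right]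

/-- Expand H = Σ h. For each h let y be the element of row s in the column of h⁻¹k; it exists
because s lies above the row of k. The term i = hy gives (hy k)hV = h(y h⁻¹k)V = -hV, and these
terms add up to -HV. The remaining terms cancel in pairs. -/
theorem sum_swap_mul_symmetrizer (t : μ.cells ≃ α) (k : α) {s : ℕ} (hs : s < rowOf t k) :
    ∑ i with rowOf t i = s, MonoidAlgebra.of ℂ _ (Equiv.swap i k) * (rowSum t * colSum t) =
      -(rowSum t * colSum t) := by
  classical
  have hbox : ∀ h : Equiv.Perm α, RowPreserving t h → (s, colOf t (h⁻¹ k)) ∈ μ.cells := by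
    intro h hh
    refine (YoungDiagram.mem_cells _).2 (μ.up_left_mem hs.le le_rfl (j2 := colOf t (h⁻¹ k)) ?_)
    rw [← hh.inv k]
    exact (YoungDiagram.mem_cells _).1 (t.symm (h⁻¹ k)).2
  -- the element of row `s` in the column of `h⁻¹ k`
  let y : Equiv.Perm α → α := fun h =>
    if hh : RowPreserving t h then t ⟨_, hbox h hh⟩ else k
  have hy_row : ∀ h, RowPreserving t h → rowOf t (y h) = s := fun h hh => by
    simp [y, hh, rowOf]
  have hy_col : ∀ h, RowPreserving t h → colOf t (y h) = colOf t (h⁻¹ k) := fun h hh => by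
    simp [y, hh, colOf]
  have hy_ne : ∀ h, RowPreserving t h → h⁻¹ k ≠ y h := fun h hh he => by
    have := hh.inv k
    rw [he, hy_row h hh] at this
    omega
  have hyr : ∀ h, RowPreserving t h → rowOf t (h (y h)) = s := fun h hh => by
    rw [hh, hy_row h hh]
  have hyk : ∀ h, RowPreserving t h → k ≠ h (y h) := fun h hh he => by
    have := hyr h hh
    rw [← he] at this
    omega
  have hneg : ∀ h, RowPreserving t h →
      MonoidAlgebra.of ℂ _ (Equiv.swap k (h (y h))) * (MonoidAlgebra.of ℂ _ h * colSum t) =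
        -(MonoidAlgebra.of ℂ _ h * colSum t) := by
    intro h hh
    rw [← mul_assoc, ← map_mul, swap_inv_mul, map_mul, mul_assoc,
      swap_mul_colSum (hy_ne h hh) (hy_col h hh).symm, mul_neg]
  let F : Equiv.Perm α × α → MonoidAlgebra ℂ (Equiv.Perm α) := fun p =>
    MonoidAlgebra.of ℂ _ (Equiv.swap p.2 k) * (MonoidAlgebra.of ℂ _ p.1 * colSum t)
  let R : Finset (Equiv.Perm α) := Finset.univ.filter (RowPreserving t)
  let S : Finset α := Finset.univ.filter fun i => rowOf t i = s
  have hR : ∀ {h}, h ∈ R ↔ RowPreserving t h := by simp [R]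
  have hS : ∀ {i}, i ∈ S ↔ rowOf t i = s := by simp [S]
  have hHV : rowSum t * colSum t = ∑ h ∈ R, MonoidAlgebra.of ℂ _ h * colSum t := by
    rw [rowSum_eq, Finset.sum_mul]
  have htot : ∑ i with rowOf t i = s,
      MonoidAlgebra.of ℂ _ (Equiv.swap i k) * (rowSum t * colSum t) = ∑ p ∈ R ×ˢ S, F p := by
    rw [Finset.sum_product_right]
    refine Finset.sum_congr rfl fun i _ => ?_
    rw [hHV, Finset.mul_sum]
  rw [htot, ← Finset.sum_filter_add_sum_filter_not _ fun p : Equiv.Perm α × α => p.2 = p.1 (y p.1)]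
  have h1 : ∑ p ∈ (R ×ˢ S).filter (fun p => p.2 = p.1 (y p.1)), F p = -(rowSum t * colSum t) := by
    rw [hHV, ← Finset.sum_neg_distrib]
    symm
    refine Finset.sum_bij (fun h _ => (h, h (y h))) (fun h hh => ?_) (fun a _ b _ hab => ?_)
      (fun p hp => ?_) fun h hh => ?_
    · simp only [Finset.mem_filter, Finset.mem_product, hS, and_true]
      exact ⟨hh, hyr h (hR.1 hh)⟩
    · exact (Prod.ext_iff.1 hab).1
    · obtain ⟨hp1, hp2⟩ := Finset.mem_filter.1 hp
      exact ⟨p.1, (Finset.mem_product.1 hp1).1, Prod.ext rfl hp2.symm⟩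
    · change _ = MonoidAlgebra.of ℂ _ (Equiv.swap (h (y h)) k) * _
      rw [Equiv.swap_comm, hneg h (hR.1 hh)]
  have h2 : ∑ p ∈ (R ×ˢ S).filter (fun p => ¬ p.2 = p.1 (y p.1)), F p = 0 := by
    -- The term (h, i) is paired with ((i hy)h, hy). The new row permutation has the same y and
    -- sends it to i, so the pairing is an involution; the two terms are opposite because (i k)(k
    -- hy) = (hy k)(i hy).
    have hkey : ∀ p : Equiv.Perm α × α, RowPreserving t p.1 → rowOf t p.2 = s →
        p.2 ≠ p.1 (y p.1) →
        RowPreserving t (Equiv.swap p.2 (p.1 (y p.1)) * p.1) ∧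
        (Equiv.swap p.2 (p.1 (y p.1)) * p.1) (y (Equiv.swap p.2 (p.1 (y p.1)) * p.1)) = p.2 ∧
        F p + F (Equiv.swap p.2 (p.1 (y p.1)) * p.1, p.1 (y p.1)) = 0 := by
      rintro ⟨h, i⟩ hh hi hne
      dsimp only at hh hi hne ⊢
      have hik : i ≠ k := fun he => by rw [he] at hi; omega
      have hrow : RowPreserving t (Equiv.swap i (h (y h)) * h) :=
        (rowPreserving_swap (by rw [hi, hyr h hh])).mul hh
      have hinv : (Equiv.swap i (h (y h)) * h)⁻¹ k = h⁻¹ k := by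
        rw [mul_inv_rev, Equiv.swap_inv, Equiv.Perm.mul_apply,
          Equiv.swap_apply_of_ne_of_ne hik.symm (hyk h hh)]
      have hyy : y (Equiv.swap i (h (y h)) * h) = y h :=
        cell_ext (t := t) (by rw [hy_row _ hrow, hy_row _ hh])
          (by rw [hy_col _ hrow, hy_col _ hh, hinv])
      refine ⟨hrow, ?_, ?_⟩
      · rw [hyy, Equiv.Perm.mul_apply, Equiv.swap_apply_right]
      · have hcomp : Equiv.swap i k * Equiv.swap k (h (y h)) =
            Equiv.swap (h (y h)) k * Equiv.swap i (h (y h)) := by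
          ext z
          simp only [Equiv.Perm.mul_apply, Equiv.swap_apply_def]
          have := hyk h hh
          split_ifs <;> simp_all
        change MonoidAlgebra.of ℂ _ (Equiv.swap i k) * (MonoidAlgebra.of ℂ _ h * colSum t) +
          MonoidAlgebra.of ℂ _ (Equiv.swap (h (y h)) k) *
            (MonoidAlgebra.of ℂ _ (Equiv.swap i (h (y h)) * h) * colSum t) = 0
        rw [map_mul, mul_assoc, ← mul_assoc (MonoidAlgebra.of ℂ _ (Equiv.swap (h (y h)) k)),
          ← map_mul, ← hcomp, map_mul, mul_assoc, hneg h hh, mul_neg, add_neg_cancel]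
    refine Finset.sum_involution
      (fun p _ => (Equiv.swap p.2 (p.1 (y p.1)) * p.1, p.1 (y p.1))) ?_ ?_ ?_ ?_
    · intro p hp
      obtain ⟨hp1, hp2⟩ := Finset.mem_filter.1 hp
      obtain ⟨hp3, hp4⟩ := Finset.mem_product.1 hp1
      exact (hkey p (hR.1 hp3) (hS.1 hp4) hp2).2.2
    · intro p hp _ he
      exact (Finset.mem_filter.1 hp).2 (congrArg Prod.snd he).symm
    · intro p hp
      obtain ⟨hp1, hp2⟩ := Finset.mem_filter.1 hp
      obtain ⟨hp3, hp4⟩ := Finset.mem_product.1 hp1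
      obtain ⟨k1, k2, -⟩ := hkey p (hR.1 hp3) (hS.1 hp4) hp2
      refine Finset.mem_filter.2 ⟨Finset.mem_product.2 ⟨hR.2 k1, hS.2 (hyr _ (hR.1 hp3))⟩, ?_⟩
      dsimp only
      rw [k2]
      exact fun he => hp2 he.symm
    · intro p hp
      obtain ⟨hp1, hp2⟩ := Finset.mem_filter.1 hp
      obtain ⟨hp3, hp4⟩ := Finset.mem_product.1 hp1
      obtain ⟨k1, k2, -⟩ := hkey p (hR.1 hp3) (hS.1 hp4) hp2
      refine Prod.ext ?_ k2
      dsimp only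
      rw [k2, ← mul_assoc, Equiv.swap_comm, Equiv.swap_mul_self, one_mul]
  rw [h1, h2, add_zero]

/-- The content (column minus row) of the box of `k`. -/
def content (t : μ.cells ≃ α) (k : α) : ℤ := (colOf t k : ℤ) - rowOf t k

/-- The entries increase along the rows, read one after the other. -/
def IsRowReading (t : μ.cells ≃ α) : Prop := StrictMono fun a => toLex (t.symm a).1

theorem IsRowReading.lt_iff {t : μ.cells ≃ α} (ht : IsRowReading t) {a b : α} :
    a < b ↔ rowOf t a < rowOf t b ∨ rowOf t a = rowOf t b ∧ colOf t a < colOf t b := by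
  rw [← ht.lt_iff_lt, Prod.Lex.toLex_lt_toLex]
  rfl

theorem card_row_lt (t : μ.cells ≃ α) (k : α) :
    (Finset.univ.filter fun i => rowOf t i = rowOf t k ∧ colOf t i < colOf t k).card =
      colOf t k := by
  have hmem : ∀ j < colOf t k, (rowOf t k, j) ∈ μ.cells := fun j hj =>
    (YoungDiagram.mem_cells _).2 (μ.up_left_mem le_rfl hj.le
      ((YoungDiagram.mem_cells _).1 (t.symm k).2))
  conv_rhs => rw [← Finset.card_range (colOf t k)]
  refine Finset.card_bij (fun i _ => colOf t i) (fun i hi => ?_) (fun a ha b hb h => ?_)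
    fun j hj => ?_
  · exact Finset.mem_range.2 (Finset.mem_filter.1 hi).2.2
  · exact cell_ext ((Finset.mem_filter.1 ha).2.1.trans (Finset.mem_filter.1 hb).2.1.symm) h
  · rw [Finset.mem_range] at hj
    refine ⟨t ⟨_, hmem j hj⟩, Finset.mem_filter.2 ⟨Finset.mem_univ _, ?_⟩, ?_⟩ <;>
      simp [rowOf, colOf]
    exact hj

/-- In a row reading the entries below k are those to its left and those in the rows above. Each
entry on the left contributes 1 because its transposition is absorbed by H; each whole row above
contributes -1. The sum is column minus row. -/
theorem jucysMurphy_mul_symmetrizer {t : μ.cells ≃ α} (ht : IsRowReading t) (k : α) :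
    jucysMurphy k * (rowSum t * colSum t) = (content t k : ℂ) • (rowSum t * colSum t) := by
  classical
  have hsplit : (Finset.univ.filter fun i => i < k) =
      (Finset.univ.filter fun i => rowOf t i < rowOf t k) ∪
        (Finset.univ.filter fun i => rowOf t i = rowOf t k ∧ colOf t i < colOf t k) := by
    ext i
    simp [ht.lt_iff]
  have hdisj : Disjoint (Finset.univ.filter fun i => rowOf t i < rowOf t k)
      (Finset.univ.filter fun i => rowOf t i = rowOf t k ∧ colOf t i < colOf t k) := by
    rw [Finset.disjoint_filter]
    intro i _ h1 h2
    omega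
  rw [jucysMurphy, Finset.sum_mul, hsplit, Finset.sum_union hdisj]
  have h1 : ∑ i with rowOf t i = rowOf t k ∧ colOf t i < colOf t k,
      MonoidAlgebra.of ℂ _ (Equiv.swap i k) * (rowSum t * colSum t) =
        (colOf t k : ℂ) • (rowSum t * colSum t) := by
    rw [Finset.sum_congr rfl fun i hi => by
      rw [← mul_assoc, of_mul_rowSum (rowPreserving_swap (Finset.mem_filter.1 hi).2.1)],
      Finset.sum_const, card_row_lt, Nat.cast_smul_eq_nsmul]
  have h2 : ∑ i with rowOf t i < rowOf t k,
      MonoidAlgebra.of ℂ _ (Equiv.swap i k) * (rowSum t * colSum t) =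
        -((rowOf t k : ℂ) • (rowSum t * colSum t)) := by
    rw [← Finset.sum_fiberwise_of_maps_to (g := rowOf t) (t := Finset.range (rowOf t k))
      fun i hi => Finset.mem_range.2 (Finset.mem_filter.1 hi).2]
    rw [Finset.sum_congr rfl fun s hs => by
      rw [Finset.filter_filter, Finset.filter_congr (q := fun i => rowOf t i = s) fun i _ =>
        ⟨fun h => h.2, fun h => ⟨h ▸ Finset.mem_range.1 hs, h⟩⟩,
        sum_swap_mul_symmetrizer t k (Finset.mem_range.1 hs)]]
    rw [Finset.sum_const, Finset.card_range, smul_neg, Nat.cast_smul_eq_nsmul]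
  rw [h1, h2, content]
  push_cast
  rw [sub_smul]
  abel

theorem youngSymmetrizer_eq (t : μ.cells ≃ α) : youngSymmetrizer t =
    ((Nat.card (StdTableau μ α) : ℂ) / ((Fintype.card α).factorial : ℂ)) •
      (rowSum t * colSum t) := rfl

/-- The relation of the degenerate affine Hecke algebra. The transposition (a b) conjugates the
terms (i b) with i < a into (i a); the extra term (a b) of the element of b gives the 1. -/
theorem swap_mul_jucysMurphy {a b : α} (hab : a ⋖ b) :
    MonoidAlgebra.of ℂ _ (Equiv.swap a b) * jucysMurphy b =
      jucysMurphy a * MonoidAlgebra.of ℂ _ (Equiv.swap a b) + 1 := by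
  classical
  have h : (Finset.univ.filter fun i => i < b) =
      insert a (Finset.univ.filter fun i => i < a) := by
    ext i
    simp only [Finset.mem_filter, Finset.mem_univ, true_and, Finset.mem_insert]
    refine ⟨fun hi => ?_, ?_⟩
    · rcases lt_trichotomy i a with h | h | h
      · exact Or.inr h
      · exact Or.inl h
      · exact absurd hi (hab.2 h)
    · rintro (rfl | h)
      · exact hab.1
      · exact h.trans hab.1
  rw [jucysMurphy, h, Finset.sum_insert (by simp), mul_add, ← map_mul, Equiv.swap_mul_self, map_one,
    add_comm, jucysMurphy, Finset.mul_sum, Finset.sum_mul]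
  congr 1
  refine Finset.sum_congr rfl fun i hi => ?_
  have hia : i < a := (Finset.mem_filter.1 hi).2
  rw [← map_mul, ← map_mul, Equiv.mul_swap_eq_swap_mul, Equiv.swap_apply_right,
    Equiv.swap_apply_of_ne_of_ne hia.ne (hia.trans hab.1).ne]

theorem jucysMurphy_mul_swap {a b k : α} (hab : a ⋖ b) (ha : k ≠ a) (hb : k ≠ b) :
    jucysMurphy k * MonoidAlgebra.of ℂ _ (Equiv.swap a b) =
      MonoidAlgebra.of ℂ _ (Equiv.swap a b) * jucysMurphy k := by
  rw [jucysMurphy, Finset.mul_sum, Finset.sum_mul]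
  refine Finset.sum_equiv (Equiv.swap a b) (fun i => ?_) fun i _ => ?_
  · simp only [Finset.mem_filter, Finset.mem_univ, true_and]
    rw [Equiv.swap_apply_def]
    have h1 : a < k ↔ b < k := ⟨fun h => lt_of_le_of_ne (hab.ge_of_gt h) hb.symm, hab.1.trans⟩
    split_ifs with h2 h3
    · rw [h2, h1]
    · rw [h3, h1]
    · rfl
  · rw [← map_mul, ← map_mul, Equiv.mul_swap_eq_swap_mul (Equiv.swap a b),
      Equiv.swap_apply_of_ne_of_ne ha hb]
    simp

/-- With s = (a b) and d = c_a - c_b, the Hecke relation yields J_a(ds + 1)P = (d c_b s - d + c_a)P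
= c_b(ds + 1)P. Thus the factor is an intertwiner exchanging the eigenvalues of a and b and keeping
the others. -/
theorem jucysMurphy_step {a b : α} (hab : a ⋖ b) {P : MonoidAlgebra ℂ (Equiv.Perm α)} {c : α → ℂ}
    (hP : ∀ k, jucysMurphy k * P = c k • P) (k : α) :
    jucysMurphy k * (((c a - c b) • MonoidAlgebra.of ℂ _ (Equiv.swap a b) + 1) * P) =
      c (Equiv.swap a b k) • (((c a - c b) • MonoidAlgebra.of ℂ _ (Equiv.swap a b) + 1) * P) := by
  set s := MonoidAlgebra.of ℂ (Equiv.Perm α) (Equiv.swap a b) with hs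
  have hss : s * s = 1 := by rw [hs, ← map_mul, Equiv.swap_mul_self, map_one]
  have h1 : jucysMurphy a * s = s * jucysMurphy b - 1 := by rw [swap_mul_jucysMurphy hab]; abel
  have h2 : jucysMurphy b * s = s * jucysMurphy a + 1 := by
    have : s * (jucysMurphy a * s) * s = s * (s * jucysMurphy b - 1) * s := by rw [h1]
    rw [mul_assoc, mul_assoc, hss, mul_one, mul_sub, ← mul_assoc, hss, one_mul, mul_one, sub_mul,
      hss] at this
    rw [this]; abel
  rw [add_mul, one_mul, smul_mul_assoc, mul_add, mul_smul_comm, ← mul_assoc, hP]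
  by_cases ha : k = a
  · subst ha
    rw [h1, Equiv.swap_apply_left, sub_mul, one_mul, mul_assoc, hP, mul_smul_comm]
    module
  · by_cases hb : k = b
    · subst hb
      rw [h2, Equiv.swap_apply_right, add_mul, one_mul, mul_assoc, hP, mul_smul_comm]
      module
    · rw [jucysMurphy_mul_swap hab ha hb, Equiv.swap_apply_of_ne_of_ne ha hb, mul_assoc, hP,
        mul_smul_comm]
      module

end JucysMurphy

section Tableaux

variable {μ : YoungDiagram} {α : Type} [Fintype α] [LinearOrder α]

/-! ### Standard tableaux -/

theorem swap_lt_swap {a b x y : α} (hab : a ⋖ b) (hxy : x < y) (h : ¬ (x = a ∧ y = b)) :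
    Equiv.swap a b x < Equiv.swap a b y := by
  simp only [Equiv.swap_apply_def]
  have h1 : ∀ z, a < z → z ≠ b → b < z := fun z hz hzb =>
    lt_of_le_of_ne (hab.ge_of_gt hz) hzb.symm
  have h2 : ∀ z, z < b → z ≠ a → z < a := fun z hz hza =>
    lt_of_le_of_ne (hab.le_of_lt hz) hza
  have := hab.1
  split_ifs with c1 c2 c3 c4 c5 c6 c7 <;> subst_vars <;>
    first
      | exact absurd hxy (lt_irrefl _)
      | exact absurd ⟨rfl, rfl⟩ h
      | exact absurd (hxy.trans hab.1) (lt_irrefl _)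
      | exact h1 _ hxy ‹_›
      | exact hab.1.trans hxy
      | exact hxy.trans hab.1
      | exact h2 _ hxy ‹_›
      | exact hxy

theorem StdTableau.ext_entry {p q : StdTableau μ α} (h : p.entry = q.entry) : p = q := by
  cases p
  cases q
  cases h
  rfl

theorem StdTableau.entry_lt_of_row (q : StdTableau μ α) {a b : α}
    (h : rowOf q.entry a = rowOf q.entry b) (h' : colOf q.entry a < colOf q.entry b) : a < b := by
  simpa using q.row_strict (q.entry.symm a) (q.entry.symm b) h h'

theorem StdTableau.entry_lt_of_col (q : StdTableau μ α) {a b : α}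
    (h : colOf q.entry a = colOf q.entry b) (h' : rowOf q.entry a < rowOf q.entry b) : a < b := by
  simpa using q.col_strict (q.entry.symm a) (q.entry.symm b) h h'

/-- The entry at a box weakly above and to the left is not larger. -/
theorem StdTableau.exists_entry (q : StdTableau μ α) (b : α) {r c : ℕ} (hr : r ≤ rowOf q.entry b)
    (hc : c ≤ colOf q.entry b) : ∃ z, rowOf q.entry z = r ∧ colOf q.entry z = c := by
  have h : (r, c) ∈ μ.cells := (YoungDiagram.mem_cells _).2
    (μ.up_left_mem hr hc ((YoungDiagram.mem_cells _).1 (q.entry.symm b).2))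
  exact ⟨q.entry ⟨_, h⟩, by simp [rowOf], by simp [colOf]⟩

/-- Exchanging two consecutive entries in different rows and columns. -/
def StdTableau.swap (q : StdTableau μ α) {a b : α} (hab : a ⋖ b)
    (hr : rowOf q.entry a ≠ rowOf q.entry b) (hc : colOf q.entry a ≠ colOf q.entry b) :
    StdTableau μ α where
  entry := q.entry.trans (Equiv.swap a b)
  row_strict c c' h1 h2 := by
    refine swap_lt_swap hab (q.row_strict c c' h1 h2) ?_
    rintro ⟨rfl, rfl⟩
    simp [rowOf] at hr
    exact hr h1
  col_strict c c' h1 h2 := by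
    refine swap_lt_swap hab (q.col_strict c c' h1 h2) ?_
    rintro ⟨rfl, rfl⟩
    simp [colOf] at hc
    exact hc h1

/-- If one box lay strictly below and to the right of the other, the box at a corner between them
would hold an entry strictly between two consecutive ones, or the order would be reversed. So one is
strictly below and to the left, and the contents differ by at least 2. -/
theorem StdTableau.axial_distance (q : StdTableau μ α) {a b : α} (hab : a ⋖ b)
    (hr : rowOf q.entry a ≠ rowOf q.entry b) (hc : colOf q.entry a ≠ colOf q.entry b) :
    2 ≤ |content q.entry a - content q.entry b| := by
  have h1 : ¬ (rowOf q.entry a < rowOf q.entry b ∧ colOf q.entry a < colOf q.entry b) := by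
    rintro ⟨h1, h2⟩
    obtain ⟨z, hz1, hz2⟩ := q.exists_entry b h1.le le_rfl
    exact hab.2 (q.entry_lt_of_row hz1.symm (by omega)) (q.entry_lt_of_col hz2 (by omega))
  have h2 : ¬ (rowOf q.entry b < rowOf q.entry a ∧ colOf q.entry b < colOf q.entry a) := by
    rintro ⟨h1, h2⟩
    obtain ⟨z, hz1, hz2⟩ := q.exists_entry a h1.le le_rfl
    exact lt_asymm hab.1 ((q.entry_lt_of_row hz1.symm (by omega)).trans
      (q.entry_lt_of_col hz2 (by omega)))
  rw [content, content, le_abs]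
  omega

/-- Two entries in a common row or column have their order forced, so they cannot be exchanged with
both tableaux standard. -/
theorem StdTableau.distinct_of_swap {p q : StdTableau μ α} {a b : α} (hab : a ⋖ b)
    (hp : p.entry = q.entry.trans (Equiv.swap a b)) :
    rowOf q.entry a ≠ rowOf q.entry b ∧ colOf q.entry a ≠ colOf q.entry b := by
  have hrow : ∀ x, rowOf p.entry x = rowOf q.entry (Equiv.swap a b x) := fun x => by
    simp [rowOf, hp]
  have hcol : ∀ x, colOf p.entry x = colOf q.entry (Equiv.swap a b x) := fun x => by
    simp [colOf, hp]
  constructor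
  · intro h
    rcases lt_trichotomy (colOf q.entry a) (colOf q.entry b) with h1 | h1 | h1
    · refine lt_asymm hab.1 (p.entry_lt_of_row ?_ ?_) <;>
        simp only [hrow, hcol, Equiv.swap_apply_left, Equiv.swap_apply_right]
      · exact h
      · exact h1
    · exact hab.1.ne (cell_ext h h1)
    · exact lt_asymm hab.1 (q.entry_lt_of_row h.symm h1)
  · intro h
    rcases lt_trichotomy (rowOf q.entry a) (rowOf q.entry b) with h1 | h1 | h1
    · refine lt_asymm hab.1 (p.entry_lt_of_col ?_ ?_) <;>
        simp only [hrow, hcol, Equiv.swap_apply_left, Equiv.swap_apply_right]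
      · exact h
      · exact h1
    · exact hab.1.ne (cell_ext h1 h)
    · exact lt_asymm hab.1 (q.entry_lt_of_col h.symm h1)

/-- If τ is not filled row by row, some consecutive a, b have the box of b earlier in the reading
order. Then b is in a strictly higher row and a different column, and the exchange puts the smaller
label first. -/
theorem StdTableau.isRowReading_or_exists_before (τ : StdTableau μ α) :
    IsRowReading τ.entry ∨ ∃ (q : StdTableau μ α) (a b : α), a ⋖ b ∧ q.Before τ ∧
      τ.entry = q.entry.trans (Equiv.swap a b) := by
  let _ : LocallyFiniteOrder α := Fintype.toLocallyFiniteOrder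
  by_cases h : IsRowReading τ.entry
  · exact Or.inl h
  · right
    rw [IsRowReading, strictMono_iff_forall_covBy] at h
    push Not at h
    obtain ⟨a, b, hab, h⟩ := h
    have hlt : toLex (τ.entry.symm b).1 < toLex (τ.entry.symm a).1 := by
      refine lt_of_le_of_ne h fun he => hab.1.ne ?_
      exact (τ.entry.symm.injective (Subtype.ext (toLex.injective he))).symm
    have hlt' := hlt
    rw [Prod.Lex.toLex_lt_toLex] at hlt'
    have hr : rowOf τ.entry a ≠ rowOf τ.entry b := by
      intro he
      rcases hlt' with h1 | ⟨h1, h2⟩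
      · exact h1.ne he.symm
      · exact lt_asymm hab.1 (τ.entry_lt_of_row he.symm h2)
    have hr' : rowOf τ.entry b < rowOf τ.entry a := by
      rcases hlt' with h1 | ⟨h1, h2⟩
      · exact h1
      · exact absurd h1.symm hr
    have hc : colOf τ.entry a ≠ colOf τ.entry b := fun he =>
      lt_asymm hab.1 (τ.entry_lt_of_col he.symm hr')
    refine ⟨τ.swap hab hr hc, a, b, hab, ⟨τ.entry.symm b, ?_, fun c' hc' => ?_⟩, ?_⟩
    · simpa [StdTableau.swap] using hab.1
    · change Equiv.swap a b (τ.entry c') = _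
      refine Equiv.swap_apply_of_ne_of_ne ?_ ?_
      · rintro rfl
        simp only [Equiv.symm_apply_apply] at hlt
        exact lt_asymm hlt hc'
      · rintro rfl
        simp at hc'
    · ext c
      simp [StdTableau.swap]

theorem StdTableau.isRowReading_of_first {q : StdTableau μ α}
    (hq : ∀ p : StdTableau μ α, ¬ p.Before q) : IsRowReading q.entry := by
  rcases q.isRowReading_or_exists_before with h | ⟨p, -, -, -, h, -⟩
  · exact h
  · exact absurd h (hq p)

theorem StdTableau.first_of_isRowReading {q : StdTableau μ α} (hq : IsRowReading q.entry)
    (p : StdTableau μ α) : ¬ p.Before q := by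
  rintro ⟨c, hc, h⟩
  have h1 : toLex (q.entry.symm (p.entry c)).1 < toLex c.1 := by
    have := hq hc
    simpa using this
  have h2 := h _ h1
  rw [Equiv.apply_symm_apply] at h2
  have h3 := p.entry.injective h2
  rw [h3] at h1
  exact lt_irrefl _ h1

theorem StdTableau.exists_isYoungOperator (τ : StdTableau μ α) :
    ∃ P, IsYoungOperator τ P := by
  -- `Before` is the lexicographic order on functions from finitely many boxes to a finite chain.
  have hwf : WellFounded (StdTableau.Before (μ := μ) (α := α)) := by
    let r : μ.cells → μ.cells → Prop := fun c c' => toLex c.1 < toLex c'.1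
    have : IsStrictTotalOrder μ.cells r :=
      { irrefl := fun c => lt_irrefl (toLex c.1)
        trans := fun a b c h h' => lt_trans h h'
        trichotomous := fun a b h h' =>
          Subtype.ext (toLex.injective (le_antisymm (not_lt.1 h') (not_lt.1 h))) }
    have h := Pi.Lex.wellFounded (ι := μ.cells) (α := fun _ => α) (s := fun _ => (· < ·)) r
      fun _ => wellFounded_lt
    refine Subrelation.wf ?_ (InvImage.wf (fun p : StdTableau μ α => (p.entry : μ.cells → α)) h)
    rintro p q ⟨c, hc, hc'⟩
    exact ⟨c, hc', hc⟩
  induction τ using hwf.induction with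
  | _ τ ih =>
    rcases τ.isRowReading_or_exists_before with h | ⟨q, a, b, hab, hq, he⟩
    · exact ⟨_, IsYoungOperator.first τ (StdTableau.first_of_isRowReading h)⟩
    · obtain ⟨P, hP⟩ := ih q hq
      exact ⟨_, IsYoungOperator.step q τ P a b hP hq hab he⟩

theorem step_coeff_eq (q : StdTableau μ α) (a b : α) :
    (((rowOf q.entry b : ℤ) - rowOf q.entry a + (colOf q.entry a - colOf q.entry b) : ℤ) : ℂ) =
      (content q.entry a : ℂ) - content q.entry b := by
  simp only [content]
  push_cast
  ring

/-- The first tableau of a shape is its row reading, and the coefficient d of each step is exactly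
the difference of contents that `jucysMurphy_step` requires. -/
theorem IsYoungOperator.jucysMurphy_mul {τ : StdTableau μ α}
    {P : MonoidAlgebra ℂ (Equiv.Perm α)} (hP : IsYoungOperator τ P) (k : α) :
    jucysMurphy k * P = (content τ.entry k : ℂ) • P := by
  induction hP generalizing k with
  | first q hq =>
    rw [youngSymmetrizer_eq, mul_smul_comm,
      jucysMurphy_mul_symmetrizer (StdTableau.isRowReading_of_first hq), smul_comm]
  | step q p P a b hP hqp hab hp ih =>
    rw [step_coeff_eq, jucysMurphy_step hab (c := fun k => (content q.entry k : ℂ)) ih]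
    congr 2
    simp [content, rowOf, colOf, hp]

/-- (ds + 1)(1 - ds) = 1 - d² is nonzero because |d| ≥ 2, so every step multiplies by a unit.
Dimensions for any τ can therefore be computed from a product HV for its shape. -/
theorem IsYoungOperator.exists_unit_mul {τ : StdTableau μ α}
    {P : MonoidAlgebra ℂ (Equiv.Perm α)} (hP : IsYoungOperator τ P) :
    ∃ (q : StdTableau μ α) (u : MonoidAlgebra ℂ (Equiv.Perm α)),
      IsUnit u ∧ P = u * (rowSum q.entry * colSum q.entry) := by
  induction hP with
  | first q hq =>
    refine ⟨q, algebraMap ℂ _ ((Nat.card (StdTableau μ α) : ℂ) / ((Fintype.card α).factorial : ℂ)),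
      IsUnit.map _ (IsUnit.mk0 _ (div_ne_zero ?_ ?_)), ?_⟩
    · have : Finite (StdTableau μ α) := Finite.of_injective (fun p : StdTableau μ α => p.entry)
        fun p q h => StdTableau.ext_entry h
      have : Nonempty (StdTableau μ α) := ⟨q⟩
      exact_mod_cast Nat.card_pos.ne'
    · exact_mod_cast (Nat.factorial_pos _).ne'
    · rw [youngSymmetrizer_eq, Algebra.smul_def]
  | step q p P a b hP hqp hab hp ih =>
    obtain ⟨q', u, hu, rfl⟩ := ih
    refine ⟨q', _, IsUnit.mul ?_ hu, (mul_assoc _ _ _).symm⟩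
    obtain ⟨hr, hc⟩ := StdTableau.distinct_of_swap hab hp
    have hd := q.axial_distance hab hr hc
    rw [step_coeff_eq]
    set s := MonoidAlgebra.of ℂ (Equiv.Perm α) (Equiv.swap a b) with hs
    have hss : s * s = 1 := by rw [hs, ← map_mul, Equiv.swap_mul_self, map_one]
    set d : ℤ := content q.entry a - content q.entry b with hd'
    have hdd : (content q.entry a : ℂ) - content q.entry b = (d : ℂ) := by rw [hd']; push_cast; rfl
    rw [hdd]
    have hne : (1 - (d : ℂ) * d) ≠ 0 := by
      have : 1 - d * d ≠ 0 := by
        rw [le_abs] at hd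
        rcases hd with hd | hd <;> nlinarith
      exact_mod_cast this
    have h1 : ((d : ℂ) • s + 1) * (1 - (d : ℂ) • s) =
        algebraMap ℂ (MonoidAlgebra ℂ (Equiv.Perm α)) (1 - (d : ℂ) * d) := by
      rw [Algebra.algebraMap_eq_smul_one, sub_smul, one_smul]
      simp only [add_mul, mul_sub, one_mul, mul_one, smul_mul_smul_comm, hss]
      abel
    have h2 : (1 - (d : ℂ) • s) * ((d : ℂ) • s + 1) =
        algebraMap ℂ (MonoidAlgebra ℂ (Equiv.Perm α)) (1 - (d : ℂ) * d) := by
      rw [Algebra.algebraMap_eq_smul_one, sub_smul, one_smul]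
      simp only [mul_add, sub_mul, one_mul, mul_one, smul_mul_smul_comm, hss]
      abel
    have hcomm : Commute ((d : ℂ) • s + 1) (1 - (d : ℂ) • s) := h1.trans h2.symm
    exact (hcomm.isUnit_mul_iff.1 (h1 ▸ IsUnit.map _ (IsUnit.mk0 _ hne))).1

/-- Induction on k. Both boxes of k lie on one diagonal. If they differed, the upper left of the two
would also be a box of the other tableau, holding there some z < k; by induction z occupies that box
in both tableaux, where one of them has k. -/
theorem StdTableau.cell_eq_of_content {μ' : YoungDiagram} (p : StdTableau μ α)
    (q : StdTableau μ' α) (h : ∀ k, content p.entry k = content q.entry k) (k : α) :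
    rowOf p.entry k = rowOf q.entry k ∧ colOf p.entry k = colOf q.entry k := by
  induction k using WellFoundedLT.induction with
  | _ k ih =>
    have hk := h k
    rw [content, content] at hk
    rcases lt_trichotomy (rowOf p.entry k) (rowOf q.entry k) with h1 | h1 | h1
    · exfalso
      obtain ⟨z, hz1, hz2⟩ := q.exists_entry k h1.le (c := colOf p.entry k) (by omega)
      obtain ⟨w, hw1, hw2⟩ := q.exists_entry k (r := rowOf q.entry k) le_rfl
        (c := colOf p.entry k) (by omega)
      have hzk : z < k := (q.entry_lt_of_col (a := z) (b := w) (by omega) (by omega)).trans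
        (q.entry_lt_of_row hw1 (by omega))
      obtain ⟨i1, i2⟩ := ih z hzk
      exact hzk.ne (cell_ext (t := p.entry) (by omega) (by omega))
    · exact ⟨h1, by omega⟩
    · exfalso
      obtain ⟨z, hz1, hz2⟩ := p.exists_entry k h1.le (c := colOf q.entry k) (by omega)
      obtain ⟨w, hw1, hw2⟩ := p.exists_entry k (r := rowOf p.entry k) le_rfl
        (c := colOf q.entry k) (by omega)
      have hzk : z < k := (p.entry_lt_of_col (a := z) (b := w) (by omega) (by omega)).trans
        (p.entry_lt_of_row hw1 (by omega))
      obtain ⟨i1, i2⟩ := ih z hzk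
      exact hzk.ne (cell_ext (t := q.entry) (by omega) (by omega))

/-- A standard tableau is determined by its contents. -/
theorem StdTableau.eq_of_content {μ' : YoungDiagram} (p : StdTableau μ α) (q : StdTableau μ' α)
    (h : ∀ k, content p.entry k = content q.entry k) :
    (⟨μ, p⟩ : Σ ν, StdTableau ν α) = ⟨μ', q⟩ := by
  have hcell := p.cell_eq_of_content q h
  have hμ : μ = μ' := by
    refine YoungDiagram.ext (Finset.ext fun c => ⟨fun hc => ?_, fun hc => ?_⟩)
    · have h1 := hcell (p.entry ⟨c, hc⟩)
      have h2 : c = (q.entry.symm (p.entry ⟨c, hc⟩)).1 := by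
        refine Prod.ext ?_ ?_
        · rw [← rowOf, ← h1.1]; simp [rowOf]
        · rw [← colOf, ← h1.2]; simp [colOf]
      rw [h2]
      exact Subtype.property _
    · have h1 := hcell (q.entry ⟨c, hc⟩)
      have h2 : c = (p.entry.symm (q.entry ⟨c, hc⟩)).1 := by
        refine Prod.ext ?_ ?_
        · rw [← rowOf, h1.1]; simp [rowOf]
        · rw [← colOf, h1.2]; simp [colOf]
      rw [h2]
      exact Subtype.property _
  subst hμ
  refine Sigma.ext rfl (heq_of_eq (StdTableau.ext_entry ?_))
  have : p.entry.symm = q.entry.symm :=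
    Equiv.ext fun k => Subtype.ext (Prod.ext (hcell k).1 (hcell k).2)
  exact Equiv.symm_bijective.injective this

end Tableaux

/-! ### Traces of quasi-idempotents -/

/-- The rank of a quasi-idempotent operator that maps basis vectors to combinations of basis
vectors. -/
theorem mul_finrank_map {V : Type*} [AddCommGroup V] [Module ℂ V] {ι K : Type*} [Fintype ι]
    [DecidableEq ι] {v : ι → V} (hv : LinearIndependent ℂ v) (L : V →ₗ[ℂ] V) (s : Finset K)
    (a : K → ℂ) (π : K → ι → ι) (hL : ∀ i, L (v i) = ∑ k ∈ s, a k • v (π k i)) {c : ℂ}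
    (hc : c ≠ 0) (hLL : ∀ x, L (L x) = c • L x) :
    c * (Module.finrank ℂ ((Submodule.span ℂ (Set.range v)).map L) : ℂ) =
      ∑ k ∈ s, a k * ((Finset.univ.filter fun i => π k i = i).card : ℂ) := by
  set M := Submodule.span ℂ (Set.range v) with hMdef
  have hvM : ∀ i, v i ∈ M := fun i => Submodule.subset_span ⟨i, rfl⟩
  have hM : ∀ x ∈ M, L x ∈ M := by
    intro x hx
    have : M ≤ M.comap L := by
      refine Submodule.span_le.2 ?_
      rintro _ ⟨i, rfl⟩
      change L (v i) ∈ M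
      rw [hL]
      exact Submodule.sum_mem _ fun k _ => Submodule.smul_mem _ _ (hvM _)
    exact this hx
  let b : Module.Basis ι ℂ M := Module.Basis.span hv
  have hb : ∀ i, (b i : V) = v i := fun i => congrArg Subtype.val (Module.Basis.span_apply hv i)
  have : Module.Finite ℂ M := Module.Finite.of_basis b
  let f : M →ₗ[ℂ] M := L.restrict hM
  have hf : ∀ i, f (b i) = ∑ k ∈ s, a k • b (π k i) := by
    intro i
    apply Subtype.ext
    rw [LinearMap.coe_restrict_apply, hb, hL, AddSubmonoidClass.coe_finsetSum]
    simp [hb]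
  have htrace : LinearMap.trace ℂ M f =
      ∑ k ∈ s, a k * ((Finset.univ.filter fun i => π k i = i).card : ℂ) := by
    rw [LinearMap.trace_eq_matrix_trace ℂ b, Matrix.trace]
    simp only [Matrix.diag_apply, LinearMap.toMatrix_apply, hf, map_sum, map_smul,
      Module.Basis.repr_self, Finsupp.finsetSum_apply, Finsupp.smul_apply, Finsupp.single_apply,
      smul_eq_mul]
    rw [Finset.sum_comm]
    refine Finset.sum_congr rfl fun k _ => ?_
    rw [← Finset.mul_sum, Finset.sum_boole]
  -- Rescaled by c⁻¹ the operator is idempotent, so its trace is its rank.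
  let g : M →ₗ[ℂ] M := c⁻¹ • f
  have hg : IsIdempotentElem g := by
    refine LinearMap.ext fun x => Subtype.ext ?_
    change c⁻¹ • L (c⁻¹ • L x) = c⁻¹ • L x
    rw [map_smul, hLL, smul_smul c⁻¹ c, inv_mul_cancel₀ hc, one_smul]
  have h1 : LinearMap.trace ℂ M g = (Module.finrank ℂ (LinearMap.range g) : ℂ) :=
    (LinearMap.IsIdempotentElem.isProj_range g hg).trace
  have h2 : LinearMap.range g = LinearMap.range f := LinearMap.range_smul f c⁻¹ (inv_ne_zero hc)
  have h3 : M.map L = (LinearMap.range f).map M.subtype := by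
    ext x
    constructor
    · rintro ⟨y, hy, rfl⟩
      exact ⟨f ⟨y, hy⟩, ⟨_, rfl⟩, rfl⟩
    · rintro ⟨_, ⟨y, rfl⟩, rfl⟩
      exact ⟨y, y.2, rfl⟩
  rw [h3, Submodule.finrank_map_subtype_eq, ← h2, ← h1, ← htrace, map_smul, smul_eq_mul,
    mul_inv_cancel_left₀ hc]

/-! ### Scalar and traces of the product of row sum and signed column sum -/

section SymmetrizerTrace

variable {μ : YoungDiagram} {α : Type} [Fintype α] [LinearOrder α]

/-- The scalar `κ` with `e² = κ e` for the product `e` of the row sum and the signed column sum of a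
tableau with row function `r` and column function `c`. -/
def symmetrizerScalar (r c : α → ℕ) : ℤ :=
  ∑ h : Equiv.Perm α with ∀ x, r (h x) = r x, ∑ v : Equiv.Perm α with ∀ x, c (v x) = c x,
    ∑ w : Equiv.Perm α with ∀ x, c (w x) = c x,
      if ∀ x, r (v (h (w x))) = r x then (Equiv.Perm.sign v * Equiv.Perm.sign w : ℤ) else 0

/-- The trace of the product of the row sum and the signed column sum of a tableau with row function
`r` and column function `c` on the words whose weight satisfies `p`. -/
def symmetrizerTrace (r c : α → ℕ) (p : ℤ → Prop) [DecidablePred p] : ℤ :=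
  ∑ h : Equiv.Perm α with ∀ x, r (h x) = r x, ∑ v : Equiv.Perm α with ∀ x, c (v x) = c x,
    (Equiv.Perm.sign v : ℤ) *
      (Finset.univ.filter fun f : α → Fin 3 =>
        p (wordWeight f) ∧ ∀ x, f (h (v x)) = f x).card

theorem rowSum_mul_colSum_eq (t : μ.cells ≃ α) : rowSum t * colSum t =
    ∑ h : Equiv.Perm α with ∀ x, rowOf t (h x) = rowOf t x,
      ∑ v : Equiv.Perm α with ∀ x, colOf t (v x) = colOf t x,
        ((Equiv.Perm.sign v : ℤ) : ℂ) • MonoidAlgebra.of ℂ (Equiv.Perm α) (h * v) := by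
  rw [rowSum, colSum, Finset.sum_mul_sum]
  refine Finset.sum_congr rfl fun h _ => Finset.sum_congr rfl fun v _ => ?_
  rw [mul_smul_comm, map_mul]

theorem coeff_of_one (σ : Equiv.Perm α) :
    (MonoidAlgebra.of ℂ (Equiv.Perm α) σ).coeff 1 = if σ = 1 then 1 else 0 :=
  Finsupp.single_apply

/-- A permutation preserving both rows and columns is trivial, so hv = 1 only for h = v = 1. -/
theorem coeff_rowSum_mul_colSum (t : μ.cells ≃ α) : (rowSum t * colSum t).coeff 1 = 1 := by
  rw [rowSum_mul_colSum_eq]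
  simp only [MonoidAlgebra.coeff_sum, MonoidAlgebra.coeff_smul, Finsupp.finsetSum_apply,
    Finsupp.smul_apply, coeff_of_one]
  rw [Finset.sum_eq_single 1, Finset.sum_eq_single 1]
  · simp
  · intro v _ hv
    rw [one_mul, if_neg hv, smul_zero]
  · simp
  · intro h hh hne
    refine Finset.sum_eq_zero fun v hv => ?_
    rw [if_neg, smul_zero]
    intro he
    refine hne (eq_one_of_preserving (t := t) (Finset.mem_filter.1 hh).2 ?_)
    rw [eq_inv_of_mul_eq_one_left he]
    exact ColPreserving.inv (Finset.mem_filter.1 hv).2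
  · simp

/-- The scalar exists by von Neumann's lemma, and comparing coefficients of the identity determines
it: in hvh'w = 1 the factor h is forced, and the condition left is that vh'w preserves rows. -/
theorem symmetrizer_sq (t : μ.cells ≃ α) : rowSum t * colSum t * (rowSum t * colSum t) =
    (symmetrizerScalar (rowOf t) (colOf t) : ℂ) • (rowSum t * colSum t) := by
  obtain ⟨κ, hκ⟩ := exists_symmetrizer_sq t
  have h1 : (rowSum t * colSum t * (rowSum t * colSum t)).coeff 1 = κ := by
    rw [hκ, MonoidAlgebra.coeff_smul, Finsupp.smul_apply, coeff_rowSum_mul_colSum, smul_eq_mul,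
      mul_one]
  rw [hκ, ← h1]
  congr 1
  have hH : ∀ σ : Equiv.Perm α, (∀ x, rowOf t (σ⁻¹ x) = rowOf t x) ↔ ∀ x, rowOf t (σ x) = rowOf t x :=
    fun σ => ⟨fun h => by
      have h' := RowPreserving.inv (t := t) h
      rwa [inv_inv] at h', RowPreserving.inv (t := t)⟩
  rw [rowSum_mul_colSum_eq, Finset.sum_mul]
  simp only [Finset.sum_mul]
  simp only [Finset.mul_sum, smul_mul_smul_comm, ← map_mul, MonoidAlgebra.coeff_sum,
    MonoidAlgebra.coeff_smul, Finsupp.finsetSum_apply, Finsupp.smul_apply, coeff_of_one]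
  rw [Finset.sum_congr rfl fun h _ => Finset.sum_comm, Finset.sum_comm, symmetrizerScalar]
  push_cast
  refine Finset.sum_congr rfl fun h' _ => ?_
  rw [Finset.sum_comm]
  refine Finset.sum_congr rfl fun v _ => ?_
  rw [Finset.sum_comm]
  refine Finset.sum_congr rfl fun w _ => ?_
  have hiff : ∀ h : Equiv.Perm α, h * v * (h' * w) = 1 ↔ h = (v * h' * w)⁻¹ := fun h => by
    rw [← mul_eq_one_iff_eq_inv]
    simp only [mul_assoc]
  simp only [hiff, smul_eq_mul, mul_ite, mul_one, mul_zero, Finset.sum_ite_eq', Finset.mem_filter,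
    Finset.mem_univ, true_and]
  exact if_congr (hH (v * h' * w)) rfl rfl

end SymmetrizerTrace

/-! ### Images of group algebra elements and their weight spaces -/

section SymmetrizedOperators

variable {μ : YoungDiagram} {α : Type} [Fintype α] [LinearOrder α] {n : ℕ}

/-- The action of the group algebra of the permutations of `α` through permutations of the spins. -/
abbrev symAct (φ : Equiv.Perm α →* Equiv.Perm (Fin n)) :
    MonoidAlgebra ℂ (Equiv.Perm α) →ₐ[ℂ] Module.End ℂ (Op n) :=
  Representation.asAlgebraHom ((permRep n).comp φ)

theorem symAct_of (φ : Equiv.Perm α →* Equiv.Perm (Fin n)) (σ : Equiv.Perm α) :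
    symAct φ (MonoidAlgebra.of ℂ _ σ) = permRep n (φ σ) :=
  Representation.asAlgebraHom_of _ _

theorem symAct_adTotal (φ : Equiv.Perm α →* Equiv.Perm (Fin n))
    (x : MonoidAlgebra ℂ (Equiv.Perm α)) (M : Qubit) (X : Op n) :
    symAct φ x (adTotal n M X) = adTotal n M (symAct φ x X) := by
  induction x using MonoidAlgebra.induction_on with
  | of σ => rw [symAct_of, permRep_adTotal]
  | add x y hx hy => simp only [map_add, LinearMap.add_apply, hx, hy]
  | smul c x hx => simp only [map_smul, LinearMap.smul_apply, hx]

theorem symAct_mem {φ : Equiv.Perm α →* Equiv.Perm (Fin n)} {W : Submodule ℂ (Op n)}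
    (hW : ∀ σ, ∀ X ∈ W, permRep n (φ σ) X ∈ W) (x : MonoidAlgebra ℂ (Equiv.Perm α)) {X : Op n}
    (hX : X ∈ W) : symAct φ x X ∈ W := by
  induction x using MonoidAlgebra.induction_on with
  | of σ => rw [symAct_of]; exact hW σ X hX
  | add x y hx hy => simp only [map_add, LinearMap.add_apply]; exact W.add_mem hx hy
  | smul c x hx => simp only [map_smul, LinearMap.smul_apply]; exact W.smul_mem c hx

theorem ladderStable_map {φ : Equiv.Perm α →* Equiv.Perm (Fin n)} {G : Finset (Fin n)}
    (x : MonoidAlgebra ℂ (Equiv.Perm α)) : LadderStable ((linOps G).map (symAct φ x)) := by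
  constructor <;>
  · rintro _ ⟨X, hX, rfl⟩
    exact ⟨_, linOps_adTotal _ hX, symAct_adTotal _ _ _ _⟩

/-- The span of the words whose weight satisfies `p`. -/
def wordSpan (e : α ↪ Fin n) (p : ℤ → Prop) : Submodule ℂ (Op n) :=
  Submodule.span ℂ (Set.range fun f : {f : α → Fin 3 // p (wordWeight f)} => wordOp e f.1)

theorem wordOp_mem_wordSpan (e : α ↪ Fin n) {p : ℤ → Prop} {f : α → Fin 3}
    (h : p (wordWeight f)) : wordOp e f ∈ wordSpan e p :=
  Submodule.subset_span ⟨⟨f, h⟩, rfl⟩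

theorem wordSpan_true (e : α ↪ Fin n) :
    wordSpan e (fun _ => True) = linOps (Finset.univ.map e) := by
  rw [← span_wordOp, wordSpan]
  congr 1
  ext X
  simp

theorem wordWeight_comp (f : α → Fin 3) (σ : Equiv.Perm α) :
    wordWeight (f ∘ σ) = wordWeight f :=
  Equiv.sum_comp σ fun a => (((f a : ℕ) : ℤ) - 1)

variable {e : α ↪ Fin n} {φ : Equiv.Perm α →* Equiv.Perm (Fin n)}

theorem permRep_mem_wordSpan (hφ : ∀ σ a, φ σ (e a) = e (σ a)) {p : ℤ → Prop} (σ : Equiv.Perm α)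
    (X : Op n) (hX : X ∈ wordSpan e p) : permRep n (φ σ) X ∈ wordSpan e p := by
  have h : wordSpan e p ≤ (wordSpan e p).comap (permRep n (φ σ)) := by
    refine Submodule.span_le.2 ?_
    rintro _ ⟨f, rfl⟩
    change permRep n (φ σ) (wordOp e f.1) ∈ wordSpan e p
    rw [permRep_wordOp e σ (φ σ) (hφ σ)]
    exact wordOp_mem_wordSpan e (by rw [wordWeight_comp]; exact f.2)
  exact h hX

/-- Permutations permute the words and preserve their weights, so the trace of hv is the number of
words it fixes; the trace of a quasi-idempotent is its scalar times its rank. -/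
theorem scalar_mul_finrank (hφ : ∀ σ a, φ σ (e a) = e (σ a)) (t : μ.cells ≃ α) (p : ℤ → Prop)
    [DecidablePred p] (hκ : symmetrizerScalar (rowOf t) (colOf t) ≠ 0) :
    symmetrizerScalar (rowOf t) (colOf t) *
      (Module.finrank ℂ ((wordSpan e p).map (symAct φ (rowSum t * colSum t))) : ℤ) =
      symmetrizerTrace (rowOf t) (colOf t) p := by
  classical
  have hlin : LinearIndependent ℂ fun f : {f : α → Fin 3 // p (wordWeight f)} => wordOp e f.1 :=
    (linearIndependent_wordOp e).comp _ Subtype.val_injective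
  have key := mul_finrank_map (K := Equiv.Perm α × Equiv.Perm α) hlin
    (symAct φ (rowSum t * colSum t))
    ((Finset.univ.filter fun h : Equiv.Perm α => ∀ x, rowOf t (h x) = rowOf t x) ×ˢ
      (Finset.univ.filter fun v : Equiv.Perm α => ∀ x, colOf t (v x) = colOf t x))
    (fun k => ((Equiv.Perm.sign k.2 : ℤ) : ℂ))
    (fun k f => ⟨f.1 ∘ ⇑(k.1 * k.2)⁻¹, by rw [wordWeight_comp]; exact f.2⟩)
    (fun f => by
      rw [rowSum_mul_colSum_eq, Finset.sum_product]
      simp only [map_sum, map_smul, LinearMap.sum_apply, LinearMap.smul_apply, symAct_of]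
      refine Finset.sum_congr rfl fun h _ => Finset.sum_congr rfl fun v _ => ?_
      rw [permRep_wordOp e (h * v) _ (hφ _)])
    (c := (symmetrizerScalar (rowOf t) (colOf t) : ℂ)) (by exact_mod_cast hκ)
    (fun X => by
      rw [← Module.End.mul_apply, ← map_mul, symmetrizer_sq, map_smul, LinearMap.smul_apply])
  rw [Finset.sum_product] at key
  have hcard : ∀ σ : Equiv.Perm α,
      (Finset.univ.filter fun f : {f : α → Fin 3 // p (wordWeight f)} =>
        (⟨f.1 ∘ ⇑σ⁻¹, by rw [wordWeight_comp]; exact f.2⟩ :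
          {f : α → Fin 3 // p (wordWeight f)}) = f).card =
      (Finset.univ.filter fun f : α → Fin 3 =>
        p (wordWeight f) ∧ ∀ x, f (σ x) = f x).card := by
    intro σ
    refine Finset.card_bij (fun f _ => f.1) (fun f hf => ?_)
      (fun f _ f' _ h => Subtype.ext h) fun f hf => ?_
    · have h := congrArg Subtype.val (Finset.mem_filter.1 hf).2
      refine Finset.mem_filter.2 ⟨Finset.mem_univ _, f.2, fun x => ?_⟩
      have := congrFun h (σ x)
      simpa using this.symm
    · obtain ⟨-, h1, h2⟩ := Finset.mem_filter.1 hf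
      refine ⟨⟨f, h1⟩, Finset.mem_filter.2 ⟨Finset.mem_univ _, Subtype.ext (funext fun x => ?_)⟩, rfl⟩
      have := h2 (σ⁻¹ x)
      simpa using this.symm
  simp only [hcard] at key
  rw [symmetrizerTrace, wordSpan]
  exact_mod_cast key

/-- Symmetrising preserves weights. If the image of Y has weight w, then the part of Y of other
weights has an image of weight w that is spanned by words of other weights; it is orthogonal to
itself, hence zero. -/
theorem weightSpace_map (hφ : ∀ σ a, φ σ (e a) = e (σ a)) (x : MonoidAlgebra ℂ (Equiv.Perm α))
    (w : ℤ) : weightSpace ((linOps (Finset.univ.map e)).map (symAct φ x)) w =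
      (wordSpan e (· = w)).map (symAct φ x) := by
  have hw : ∀ X ∈ wordSpan e (· = w), adTotal n spinZ X = (w : ℂ) • X := by
    have : wordSpan e (· = w) ≤ Module.End.eigenspace (adTotal n spinZ) (w : ℂ) := by
      refine Submodule.span_le.2 ?_
      rintro _ ⟨f, rfl⟩
      rw [SetLike.mem_coe, Module.End.mem_eigenspace_iff, wordOp_weight, f.2]
    exact fun X hX => Module.End.mem_eigenspace_iff.1 (this hX)
  have hle : wordSpan e (· = w) ≤ linOps (Finset.univ.map e) := by
    rw [← wordSpan_true]
    refine Submodule.span_le.2 ?_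
    rintro _ ⟨f, rfl⟩
    exact wordOp_mem_wordSpan e trivial
  refine le_antisymm (fun X hX => ?_) ?_
  · obtain ⟨⟨Y, hY, rfl⟩, hX⟩ := mem_weightSpace.1 hX
    have hsup : linOps (Finset.univ.map e) ≤ wordSpan e (· = w) ⊔ wordSpan e (· ≠ w) := by
      rw [← span_wordOp]
      refine Submodule.span_le.2 ?_
      rintro _ ⟨f, rfl⟩
      by_cases h : wordWeight f = w
      · exact Submodule.mem_sup_left (wordOp_mem_wordSpan e h)
      · exact Submodule.mem_sup_right (wordOp_mem_wordSpan e h)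
    obtain ⟨Y1, hY1, Y2, hY2, rfl⟩ := Submodule.mem_sup.1 (hsup hY)
    have h2 : symAct φ x Y2 ∈ wordSpan e (· ≠ w) := symAct_mem (permRep_mem_wordSpan hφ) x hY2
    have h1 : adTotal n spinZ (symAct φ x Y2) = (w : ℂ) • symAct φ x Y2 := by
      have h3 : adTotal n spinZ (symAct φ x Y1) = (w : ℂ) • symAct φ x Y1 := by
        rw [← symAct_adTotal, hw Y1 hY1, map_smul]
      rw [map_add, map_add, h3, smul_add, add_right_inj] at hX
      exact hX
    have h0 : symAct φ x Y2 = 0 := by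
      rw [← ip_self_eq_zero]
      refine ip_eq_zero_of_span (s := {symAct φ x Y2}) ?_ (Submodule.mem_span_singleton_self _) h2
      rintro _ rfl _ ⟨f, rfl⟩
      exact weight_orthogonal h1 (wordOp_weight e f.1) f.2.symm
    exact ⟨Y1, hY1, by rw [map_add, h0, add_zero]⟩
  · rintro _ ⟨Y, hY, rfl⟩
    exact mem_weightSpace.2 ⟨⟨Y, hle hY, rfl⟩, by rw [← symAct_adTotal, hw Y hY, map_smul]⟩

/-- Multiplication by a unit of the group algebra does not change dimensions. -/
theorem finrank_map_unit_mul {u : MonoidAlgebra ℂ (Equiv.Perm α)} (hu : IsUnit u)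
    (x : MonoidAlgebra ℂ (Equiv.Perm α)) (W : Submodule ℂ (Op n)) :
    Module.finrank ℂ (W.map (symAct φ (u * x))) = Module.finrank ℂ (W.map (symAct φ x)) := by
  obtain ⟨v, rfl⟩ := hu
  have hinj : Function.Injective (symAct φ v) := by
    refine Function.LeftInverse.injective (g := symAct φ (v⁻¹ : (MonoidAlgebra ℂ (Equiv.Perm α))ˣ)) fun X => ?_
    rw [← Module.End.mul_apply, ← map_mul, Units.inv_mul, map_one, Module.End.one_apply]
  rw [map_mul, Module.End.mul_eq_comp, Submodule.map_comp]
  exact (Submodule.equivMapOfInjective _ hinj _).finrank_eq.symm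

end SymmetrizedOperators

/-! ### The multiplicity as a dimension of tensor operators -/

section RankMultiplicity

theorem IsRowReading.rowReading (μ : YoungDiagram) : IsRowReading (rowReading μ) := by
  intro a b hab
  let e := (μ.cells.map (toLex (α := ℕ × ℕ)).toEmbedding).orderIsoOfFin
      (k := μ.card) (by rw [Finset.card_map])
  have h : ∀ a, toLex ((SpinTensor.rowReading μ).symm a).1 = (e a).1 := fun a => rfl
  change toLex _ < toLex _
  rw [h, h]
  exact e.strictMono hab

variable {lam : YoungDiagram}

/-- The linear operators symmetrized by the row-by-row tableau. -/
def symmetrizedOps (lam : YoungDiagram) : Submodule ℂ (Op lam.card) :=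
  (linOps Finset.univ).map (symAct (MonoidHom.id (Equiv.Perm (Fin lam.card)))
    (rowSum (rowReading lam) * colSum (rowReading lam)))

theorem rotRep_symAct {n : ℕ} (U : SU2) (x : MonoidAlgebra ℂ (Equiv.Perm (Fin n))) (X : Op n) :
    rotRep n U (symAct (MonoidHom.id _) x X) = symAct (MonoidHom.id _) x (rotRep n U X) := by
  induction x using MonoidAlgebra.induction_on with
  | of σ =>
    rw [symAct_of]
    exact LinearMap.congr_fun (rot_perm_commute U σ) X
  | add x y hx hy => simp only [map_add, LinearMap.add_apply, hx, hy]
  | smul c x hx => simp only [map_smul, LinearMap.smul_apply, hx]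

/-- The tableau filled row by row. -/
def rowReadingTableau (lam : YoungDiagram) : StdTableau lam (Fin lam.card) where
  entry := rowReading lam
  row_strict c c' h h' := by
    rw [← (IsRowReading.rowReading lam).lt_iff_lt, Prod.Lex.toLex_lt_toLex]
    right
    simpa using ⟨h, h'⟩
  col_strict c c' h h' := by
    rw [← (IsRowReading.rowReading lam).lt_iff_lt, Prod.Lex.toLex_lt_toLex]
    left
    simpa using h'

theorem exists_youngSymmetrizer_eq (lam : YoungDiagram) : ∃ k : ℂ, k ≠ 0 ∧
    youngSymmetrizer (rowReading lam) =
      k • (rowSum (rowReading lam) * colSum (rowReading lam)) := by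
  refine ⟨_, div_ne_zero ?_ ?_, youngSymmetrizer_eq _⟩
  · have : Finite (StdTableau lam (Fin lam.card)) :=
      Finite.of_injective (fun p : StdTableau lam (Fin lam.card) => p.entry)
        fun p q h => StdTableau.ext_entry h
    have : Nonempty (StdTableau lam (Fin lam.card)) := ⟨rowReadingTableau lam⟩
    exact_mod_cast Nat.card_pos.ne'
  · exact_mod_cast (Nat.factorial_pos _).ne'

/-- The generator of the Specht module. -/
def spechtGenerator (lam : YoungDiagram) : spechtModule lam :=
  ⟨youngSymmetrizer (rowReading lam), ⟨1, one_mul _⟩⟩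

theorem mul_mem_spechtModule (z : MonoidAlgebra ℂ (Equiv.Perm (Fin lam.card)))
    (x : spechtModule lam) : z * x.1 ∈ spechtModule lam := by
  obtain ⟨_, ⟨y, rfl⟩⟩ := x
  exact ⟨z * y, mul_assoc _ _ _⟩

/-- The equivariant maps whose dimension is the multiplicity. -/
abbrev MultiplicitySpace (lam : YoungDiagram) (j : ℕ) : Type :=
  Representation.IntertwiningMap
    (Representation.tprod
      ((spinRep j).comp (MonoidHom.fst SU2 (Equiv.Perm (Fin lam.card))))
      ((spechtRep lam).comp (MonoidHom.snd SU2 (Equiv.Perm (Fin lam.card)))))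
    (linRep lam.card)

theorem MultiplicitySpace.apply_smul {j : ℕ} (Φ : MultiplicitySpace lam j) (U : SU2)
    (σ : Equiv.Perm (Fin lam.card)) (p : SpinSpace j) (x : spechtModule lam) :
    (Φ.toLinearMap (spinRep j U p ⊗ₜ spechtRep lam σ x) : Op lam.card) =
      rotRep _ U (permRep _ σ (Φ.toLinearMap (p ⊗ₜ x) : Op lam.card)) :=
  congrArg Subtype.val (LinearMap.congr_fun (Φ.isIntertwining' (U, σ)) (p ⊗ₜ x))

theorem MultiplicitySpace.apply_mul {j : ℕ} (Φ : MultiplicitySpace lam j)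
    (z : MonoidAlgebra ℂ (Equiv.Perm (Fin lam.card))) (p : SpinSpace j) (x : spechtModule lam) :
    (Φ.toLinearMap (p ⊗ₜ (⟨z * x.1, mul_mem_spechtModule z x⟩ : spechtModule lam)) : Op lam.card) =
      symAct (MonoidHom.id _) z (Φ.toLinearMap (p ⊗ₜ x) : Op lam.card) := by
  induction z using MonoidAlgebra.induction_on with
  | of σ =>
    have h := Φ.apply_smul 1 σ p x
    simp only [map_one, Module.End.one_apply] at h
    rw [symAct_of]
    exact h
  | add z z' h h' =>
    rw [map_add, LinearMap.add_apply, ← h, ← h', ← Submodule.coe_add, ← map_add,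
      ← TensorProduct.tmul_add]
    congr 4
    exact add_mul _ _ _
  | smul c z h =>
    rw [map_smul, LinearMap.smul_apply, ← h, ← Submodule.coe_smul, ← map_smul,
      ← TensorProduct.tmul_smul]
    congr 4
    exact smul_mul_assoc _ _ _

/-- Evaluation of an equivariant map at the generator of the Specht module. -/
def evalGenerator (lam : YoungDiagram) (j : ℕ) :
    MultiplicitySpace lam j →ₗ[ℂ] (SpinSpace j →ₗ[ℂ] Op lam.card) where
  toFun Φ := (linOps Finset.univ).subtype ∘ₗ Φ.toLinearMap ∘ₗ
    (TensorProduct.mk ℂ (SpinSpace j) (spechtModule lam)).flip (spechtGenerator lam)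
  map_add' _ _ := rfl
  map_smul' _ _ := rfl

theorem evalGenerator_injective (lam : YoungDiagram) (j : ℕ) :
    Function.Injective (evalGenerator lam j) := by
  intro Φ Ψ h
  refine Representation.IntertwiningMap.ext (TensorProduct.ext' fun p x => Subtype.ext ?_)
  obtain ⟨_, ⟨z, rfl⟩⟩ := x
  refine (Φ.apply_mul z p (spechtGenerator lam)).trans
    (Eq.trans ?_ (Ψ.apply_mul z p (spechtGenerator lam)).symm)
  exact congrArg _ (LinearMap.congr_fun h p)

/-- Write L for the g-linear operators. As E² = νE with ν ≠ 0, evaluation at E takes values in EL,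
and on EL the symmetrizer acts by ν. The inverse construction sends T to p ⊗ x ↦ ν⁻¹ x·T(p). -/
theorem range_evalGenerator (lam : YoungDiagram) (j : ℕ)
    (hκ : symmetrizerScalar (rowOf (rowReading lam)) (colOf (rowReading lam)) ≠ 0) :
    LinearMap.range (evalGenerator lam j) = equivariantMaps (symmetrizedOps lam) j := by
  obtain ⟨k, hk, hE⟩ := exists_youngSymmetrizer_eq lam
  set E := youngSymmetrizer (rowReading lam) with hEdef
  set ν : ℂ := k * symmetrizerScalar (rowOf (rowReading lam)) (colOf (rowReading lam)) with hν
  have hν0 : ν ≠ 0 := mul_ne_zero hk (by exact_mod_cast hκ)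
  have hEE : E * E = ν • E := by
    rw [hE, smul_mul_smul_comm, symmetrizer_sq, smul_smul, smul_smul]
    congr 1
    rw [hν]
    ring
  have hW : symmetrizedOps lam = (linOps Finset.univ).map (symAct (MonoidHom.id _) E) := by
    rw [hE, map_smul, Submodule.map_smul _ _ _ hk]
    rfl
  have hmem : ∀ X ∈ symmetrizedOps lam, symAct (MonoidHom.id _) E X = ν • X := by
    rw [hW]
    rintro _ ⟨X, -, rfl⟩
    rw [← Module.End.mul_apply, ← map_mul, hEE, map_smul, LinearMap.smul_apply]
  refine le_antisymm ?_ fun T hT => ?_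
  · rintro _ ⟨Φ, rfl⟩
    refine mem_equivariantMaps.2 ⟨fun p => ?_, fun U p => ?_⟩
    · change (Φ.toLinearMap (p ⊗ₜ spechtGenerator lam) : Op lam.card) ∈ _
      rw [hW]
      refine ⟨ν⁻¹ • (Φ.toLinearMap (p ⊗ₜ spechtGenerator lam) : Op lam.card),
        Submodule.smul_mem _ _ (Φ.toLinearMap _).2, ?_⟩
      rw [map_smul, ← Φ.apply_mul]
      have : (⟨E * (spechtGenerator lam).1, mul_mem_spechtModule _ _⟩ : spechtModule lam) =
          ν • spechtGenerator lam := Subtype.ext hEE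
      rw [this, TensorProduct.tmul_smul, map_smul, Submodule.coe_smul, smul_smul,
        inv_mul_cancel₀ hν0, one_smul]
    · have h := Φ.apply_smul U 1 p (spechtGenerator lam)
      simp only [map_one, Module.End.one_apply] at h
      exact h
  · obtain ⟨hT1, hT2⟩ := mem_equivariantMaps.1 hT
    have hlin : ∀ X ∈ symmetrizedOps lam, ∀ x, symAct (MonoidHom.id _) x X ∈ linOps Finset.univ := by
      have hstab : ∀ x, ∀ X ∈ linOps (Finset.univ : Finset (Fin lam.card)),
          symAct (MonoidHom.id _) x X ∈ linOps Finset.univ := by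
        intro x X hX
        refine symAct_mem (fun σ X hX => ?_) x hX
        have := linOps_invariant lam.card (1, σ) hX
        simpa [opRep] using this
      rintro _ ⟨X, hX, rfl⟩ x
      exact hstab x _ (hstab _ X hX)
    let B : SpinSpace j →ₗ[ℂ] spechtModule lam →ₗ[ℂ] linOps (Finset.univ : Finset (Fin lam.card)) :=
      LinearMap.mk₂ ℂ (fun p x => ⟨ν⁻¹ • symAct (MonoidHom.id _) x.1 (T p),
          Submodule.smul_mem _ _ (hlin _ (hT1 p) _)⟩)
        (fun p p' x => Subtype.ext (by simp)) (fun c p x => Subtype.ext (by simp [smul_comm c]))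
        (fun p x x' => Subtype.ext (by simp)) (fun c p x => Subtype.ext (by simp [smul_comm c]))
    have hB : ∀ p x, (TensorProduct.lift B (p ⊗ₜ x) : Op lam.card) =
        ν⁻¹ • symAct (MonoidHom.id _) x.1 (T p) := fun p x => rfl
    refine ⟨⟨TensorProduct.lift B, ?_⟩, ?_⟩
    · rintro ⟨U, σ⟩
      refine TensorProduct.ext' fun p x => Subtype.ext ?_
      change (TensorProduct.lift B (spinRep j U p ⊗ₜ spechtRep lam σ x) : Op lam.card) =
        rotRep _ U (permRep _ σ (TensorProduct.lift B (p ⊗ₜ x) : Op lam.card))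
      have hx : (spechtRep lam σ x).1 = MonoidAlgebra.of ℂ _ σ * x.1 := rfl
      rw [hB, hB, hx, hT2, ← rotRep_symAct, map_mul, Module.End.mul_apply, symAct_of, map_smul,
        map_smul]
      rfl
    · refine LinearMap.ext fun p => ?_
      change (TensorProduct.lift B (p ⊗ₜ spechtGenerator lam) : Op lam.card) = T p
      rw [hB]
      change ν⁻¹ • symAct (MonoidHom.id _) E (T p) = T p
      rw [hmem _ (hT1 p), smul_smul, inv_mul_cancel₀ hν0, one_smul]

theorem rankMultiplicity_eq (lam : YoungDiagram) (j : ℕ)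
    (hκ : symmetrizerScalar (rowOf (rowReading lam)) (colOf (rowReading lam)) ≠ 0) :
    rankMultiplicity lam j = Module.finrank ℂ (tensorOperators (symmetrizedOps lam) j) := by
  rw [← finrank_equivariantMaps, ← range_evalGenerator lam j hκ,
    LinearMap.finrank_range_of_inj (evalGenerator_injective lam j)]
  rfl

end RankMultiplicity

/-! ### Evaluation of the symmetrizer traces by lists -/

/-- The entry number `i` of a list. -/
def nth : List ℕ → ℕ → ℕ
  | [], _ => 0
  | a :: _, 0 => a
  | _ :: l, i + 1 => nth l i

/-- The composition of two functions given by their lists of values. -/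
def listComp (f p : List ℕ) : List ℕ := p.map (nth f)

/-- Equality of lists, decided from the left. -/
def eqList : List ℕ → List ℕ → Bool
  | [], [] => true
  | a :: l, b :: m => cond (Nat.beq a b) (eqList l m) false
  | _, _ => false

/-- The permutations of `{0, …, n - 1}`, as lists of values, together with their parities. -/
def signedPerms : ℕ → List (List ℕ × Bool)
  | 0 => [([], true)]
  | n + 1 => (List.range (n + 1)).flatMap fun p => (signedPerms n).map fun x =>
      (p :: x.1.map fun y => if y + 1 = p then 0 else y + 1, if p = 0 then x.2 else !x.2)

/-- The permutations that preserve the values of `r`. -/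
def stabilizer (r : List ℕ) : List (List ℕ × Bool) :=
  (signedPerms r.length).filter fun x => eqList (listComp r x.1) r

/-- The alternating sum of a function over a list of permutations. -/
def signedSum (F : List ℕ → ℤ) : List (List ℕ × Bool) → ℤ
  | [] => 0
  | x :: L => cond x.2 (F x.1) (-F x.1) + signedSum F L

/-- The sum of a function over a list of permutations. -/
def unsignedSum (F : List ℕ → ℤ) : List (List ℕ × Bool) → ℤ
  | [] => 0
  | x :: L => F x.1 + unsignedSum F L

/-- `symmetrizerScalar` for functions given by lists. -/
def scalarList (r c : List ℕ) : ℤ :=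
  unsignedSum (fun h => signedSum (fun v => signedSum (fun w =>
    cond (eqList (listComp (listComp r v) (listComp h w)) r) 1 0)
      (stabilizer c)) (stabilizer c)) (stabilizer r)

/-- Add `w` to the entry number `i`. -/
def addAt : List ℕ → ℕ → ℕ → List ℕ
  | [], _, _ => []
  | a :: l, 0, w => (a + w) :: l
  | a :: l, i + 1, w => a :: addAt l i w

/-- The generating function of the words of length `n` in three letters that are fixed by the
permutation `p`, where the letters at the place `i` are counted with the weight `ws i`. -/
def fixSum (B : ℕ) : ℕ → List ℕ → List ℕ → ℕ
  | n + 1, a :: p, w :: ws =>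
    match a with
    -- A fixed place carries a free letter. Otherwise place 0 must have the letter of place a + 1,
    -- so it is removed from its cycle and its weight is passed on.
    | 0 => (1 + B ^ w + B ^ (2 * w)) * fixSum B n (p.map Nat.pred) ws
    | a + 1 => fixSum B n (p.map fun y => Nat.rec a (fun y _ => y) y) (addAt ws a w)
  | _, _, _ => 1

/-- The generating function of the traces, for functions given by lists. -/
def traceList (B : ℕ) (r c : List ℕ) : ℤ :=
  unsignedSum (fun h => signedSum (fun v =>
    (fixSum B r.length (listComp h v) (r.map fun _ => 1) : ℕ)) (stabilizer c)) (stabilizer r)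

/-- The list of values of a permutation. -/
def permList {n : ℕ} (σ : Equiv.Perm (Fin n)) : List ℕ := List.ofFn fun i => (σ i : ℕ)

theorem eqList_iff : ∀ l m : List ℕ, eqList l m = true ↔ l = m
  | [], [] => by simp [eqList]
  | [], _ :: _ => by simp [eqList]
  | _ :: _, [] => by simp [eqList]
  | a :: l, b :: m => by
    rw [eqList, Bool.cond_false_right, Bool.and_eq_true, eqList_iff l m, Nat.beq_eq, List.cons.injEq]

theorem nth_ofFn {n : ℕ} (f : Fin n → ℕ) (i : Fin n) : nth (List.ofFn f) i = f i := by
  induction n with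
  | zero => exact i.elim0
  | succ n ih =>
    rw [List.ofFn_succ]
    refine Fin.cases ?_ (fun i => ?_) i
    · rfl
    · exact ih (fun i => f i.succ) i

theorem listComp_ofFn {n : ℕ} (f : Fin n → ℕ) (σ : Equiv.Perm (Fin n)) :
    listComp (List.ofFn f) (permList σ) = List.ofFn (f ∘ σ) := by
  rw [listComp, permList, List.map_ofFn]
  congr 1
  funext i
  exact nth_ofFn f _

theorem permList_mul {n : ℕ} (σ τ : Equiv.Perm (Fin n)) :
    listComp (permList σ) (permList τ) = permList (σ * τ) :=
  listComp_ofFn _ _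

/-- The recursion behind `signedPerms`: a permutation is the transposition (0 p) after one fixing 0,
which also yields the parity. -/
theorem permList_decomposeFin {n : ℕ} (p : Fin (n + 1)) (σ : Equiv.Perm (Fin n)) :
    permList (Equiv.Perm.decomposeFin.symm (p, σ)) =
      (p : ℕ) :: (permList σ).map fun y => if y + 1 = (p : ℕ) then 0 else y + 1 := by
  rw [permList, List.ofFn_succ, Equiv.Perm.decomposeFin_symm_apply_zero, permList, List.map_ofFn]
  congr 2
  funext i
  rw [Equiv.Perm.decomposeFin_symm_apply_succ, Equiv.swap_apply_def, if_neg (Fin.succ_ne_zero _)]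
  simp only [Fin.ext_iff, Fin.val_succ, Function.comp_apply]
  split_ifs <;> rfl

theorem sum_range_list {M : Type*} [AddCommMonoid M] (n : ℕ) (f : ℕ → M) :
    ((List.range n).map f).sum = ∑ i : Fin n, f i := by
  rw [Fin.sum_univ_eq_sum_range f n]
  rfl

theorem sum_signedPerms {M : Type*} [AddCommMonoid M] (n : ℕ) (F : List ℕ → Bool → M) :
    ((signedPerms n).map fun x => F x.1 x.2).sum =
      ∑ σ : Equiv.Perm (Fin n), F (permList σ) (decide (Equiv.Perm.sign σ = 1)) := by
  induction n generalizing F with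
  | zero => simp [signedPerms, permList]
  | succ n ih =>
    rw [← Equiv.sum_comp Equiv.Perm.decomposeFin.symm, Fintype.sum_prod_type, signedPerms,
      List.map_flatMap, List.flatMap, List.sum_flatten, List.map_map, sum_range_list]
    refine Finset.sum_congr rfl fun p _ => ?_
    rw [Function.comp_apply, List.map_map]
    refine (ih fun l b => F ((p : ℕ) :: l.map fun y => if y + 1 = (p : ℕ) then 0 else y + 1)
      (if (p : ℕ) = 0 then b else !b)).trans (Finset.sum_congr rfl fun σ _ => ?_)
    rw [permList_decomposeFin]
    congr 1
    rw [Equiv.Perm.decomposeFin.symm_sign]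
    rcases Int.units_eq_one_or (Equiv.Perm.sign σ) with h | h <;> rw [h] <;>
      by_cases hp : p = 0 <;> simp [hp]

theorem signedSum_eq (F : List ℕ → ℤ) (L : List (List ℕ × Bool)) :
    signedSum F L = (L.map fun x => cond x.2 (F x.1) (-F x.1)).sum := by
  induction L with
  | nil => rfl
  | cons x L ih => rw [signedSum, ih, List.map_cons, List.sum_cons]

theorem unsignedSum_eq (F : List ℕ → ℤ) (L : List (List ℕ × Bool)) :
    unsignedSum F L = (L.map fun x => F x.1).sum := by
  induction L with
  | nil => rfl
  | cons x L ih => rw [unsignedSum, ih, List.map_cons, List.sum_cons]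

theorem sum_map_filter {β : Type*} (q : β → Bool) (G : β → ℤ) (L : List β) :
    ((L.filter q).map G).sum = (L.map fun x => if q x = true then G x else 0).sum := by
  induction L with
  | nil => rfl
  | cons x L ih =>
    rw [List.filter_cons, List.map_cons, List.sum_cons, ← ih]
    by_cases h : q x = true
    · rw [if_pos h, if_pos h, List.map_cons, List.sum_cons]
    · rw [if_neg h, if_neg h, zero_add]

theorem stabilizes_iff {n : ℕ} (r : Fin n → ℕ) (σ : Equiv.Perm (Fin n)) :
    eqList (listComp (List.ofFn r) (permList σ)) (List.ofFn r) = true ↔ ∀ x, r (σ x) = r x := by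
  rw [eqList_iff, listComp_ofFn, List.ofFn_inj, funext_iff]
  rfl

theorem unsignedSum_stabilizer {n : ℕ} (r : Fin n → ℕ) (F : List ℕ → ℤ) :
    unsignedSum F (stabilizer (List.ofFn r)) =
      ∑ σ : Equiv.Perm (Fin n) with ∀ x, r (σ x) = r x, F (permList σ) := by
  rw [unsignedSum_eq, stabilizer, sum_map_filter, List.length_ofFn]
  refine (sum_signedPerms n fun l _ =>
    if eqList (listComp (List.ofFn r) l) (List.ofFn r) = true then F l else 0).trans ?_
  rw [Finset.sum_filter]
  exact Finset.sum_congr rfl fun σ _ => if_congr (stabilizes_iff r σ) rfl rfl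

theorem signedSum_stabilizer {n : ℕ} (r : Fin n → ℕ) (F : List ℕ → ℤ) :
    signedSum F (stabilizer (List.ofFn r)) =
      ∑ σ : Equiv.Perm (Fin n) with ∀ x, r (σ x) = r x,
        (Equiv.Perm.sign σ : ℤ) * F (permList σ) := by
  rw [signedSum_eq, stabilizer, sum_map_filter, List.length_ofFn]
  refine (sum_signedPerms n fun l b => if eqList (listComp (List.ofFn r) l) (List.ofFn r) = true then
    cond b (F l) (-F l) else 0).trans ?_
  rw [Finset.sum_filter]
  refine Finset.sum_congr rfl fun σ _ => if_congr (stabilizes_iff r σ) ?_ rfl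
  rcases Int.units_eq_one_or (Equiv.Perm.sign σ) with h | h <;> rw [h] <;> simp

theorem scalarList_ofFn {n : ℕ} (r c : Fin n → ℕ) :
    scalarList (List.ofFn r) (List.ofFn c) = symmetrizerScalar r c := by
  rw [scalarList, unsignedSum_stabilizer, symmetrizerScalar]
  refine Finset.sum_congr (by congr!) fun h _ => ?_
  rw [signedSum_stabilizer]
  refine Finset.sum_congr (by congr!) fun v _ => ?_
  rw [signedSum_stabilizer, Finset.mul_sum]
  refine Finset.sum_congr (by congr!) fun w _ => ?_
  rw [listComp_ofFn, permList_mul, listComp_ofFn, Bool.cond_eq_ite, ← mul_assoc, mul_ite, mul_one,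
    mul_zero]
  have hiff : eqList (List.ofFn ((r ∘ v) ∘ ⇑(h * w))) (List.ofFn r) = true ↔
      ∀ x, r (v (h (w x))) = r x := by
    rw [eqList_iff, List.ofFn_inj, funext_iff]
    rfl
  simp only [hiff]
  split_ifs <;> rfl

theorem addAt_ofFn {n : ℕ} (f : Fin n → ℕ) (a : Fin n) (w : ℕ) :
    addAt (List.ofFn f) a w = List.ofFn fun i => f i + if i = a then w else 0 := by
  induction n with
  | zero => exact a.elim0
  | succ n ih =>
    rw [List.ofFn_succ, List.ofFn_succ]
    refine Fin.cases ?_ (fun a => ?_) a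
    · simp [addAt, Fin.succ_ne_zero]
    · rw [Fin.val_succ, addAt, ih]
      simp [Fin.succ_inj, (Fin.succ_ne_zero a).symm]

/-- Write the permutation as (0 p) after the extension of σ. A word is fixed exactly if its letters
at 0 and p agree and its tail is fixed by σ, which is the recursion of `fixSum`. -/
theorem fixSum_permList (B : ℕ) {n : ℕ} (σ : Equiv.Perm (Fin n)) (ws : Fin n → ℕ) :
    fixSum B n (permList σ) (List.ofFn ws) =
      ∑ f : Fin n → Fin 3 with ∀ x, f (σ x) = f x, B ^ ∑ i, ws i * (f i : ℕ) := by
  induction n with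
  | zero => simp [fixSum]
  | succ n ih =>
    obtain ⟨⟨p, σ⟩, rfl⟩ := Equiv.Perm.decomposeFin.symm.surjective σ
    rw [permList_decomposeFin, List.ofFn_succ, Finset.sum_filter,
      ← Equiv.sum_comp (Fin.consEquiv fun _ => Fin 3), Fintype.sum_prod_type]
    have hfix : ∀ (k : Fin 3) (f : Fin n → Fin 3),
        (∀ x, (Fin.cons k f : Fin (n + 1) → Fin 3) (Equiv.Perm.decomposeFin.symm (p, σ) x) =
          (Fin.cons k f : Fin (n + 1) → Fin 3) x) ↔
        (Fin.cons k f : Fin (n + 1) → Fin 3) p = k ∧ ∀ x, f (σ x) = f x := by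
      intro k f
      rw [Fin.forall_fin_succ, Equiv.Perm.decomposeFin_symm_apply_zero, Fin.cons_zero]
      refine and_congr_right fun h => forall_congr' fun x => ?_
      rw [Equiv.Perm.decomposeFin_symm_apply_succ, Fin.cons_succ, Equiv.swap_apply_def,
        if_neg (Fin.succ_ne_zero _)]
      split_ifs with hx
      · rw [Fin.cons_zero, ← h, ← hx, Fin.cons_succ]
      · rw [Fin.cons_succ]
    have hpow : ∀ (k : Fin 3) (f : Fin n → Fin 3),
        ∑ i, ws i * ((Fin.cons k f : Fin (n + 1) → Fin 3) i : ℕ) =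
          ws 0 * k + ∑ i, ws i.succ * (f i : ℕ) := fun k f => by
      rw [Fin.sum_univ_succ]
      simp
    simp only [Fin.consEquiv, Equiv.coe_fn_mk, hfix, hpow]
    refine Fin.cases ?_ (fun a => ?_) p
    · have hmap : ((permList σ).map fun y => if y + 1 = ((0 : Fin (n + 1)) : ℕ) then 0 else y + 1).map
          Nat.pred = permList σ := by
        rw [List.map_map]
        exact (List.map_congr_left fun y _ => rfl).trans (List.map_id _)
      rw [Fin.val_zero, fixSum]
      rw [Fin.val_zero] at hmap
      rw [hmap, ih]
      simp only [Fin.cons_zero, true_and, Fin.sum_univ_three, pow_add, ← Finset.sum_filter,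
        ← Finset.mul_sum]
      simp only [Fin.val_zero, Fin.val_one, Fin.val_two, mul_zero, mul_one, pow_zero, ← add_mul]
      rw [mul_comm (ws 0) 2]
    · have hmap : ((permList σ).map fun y => if y + 1 = (a.succ : ℕ) then 0 else y + 1).map
          (fun y => Nat.rec (a : ℕ) (fun y _ => y) y) = permList σ := by
        rw [List.map_map]
        refine (List.map_congr_left fun y _ => ?_).trans (List.map_id _)
        rw [Function.comp_apply, Fin.val_succ]
        by_cases h : y = (a : ℕ)
        · rw [if_pos (by rw [h]), h]
          rfl
        · rw [if_neg (by omega)]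
          rfl
      rw [Fin.val_succ, fixSum]
      rw [Fin.val_succ] at hmap
      rw [hmap, addAt_ofFn, ih, Finset.sum_comm, Finset.sum_filter]
      refine Finset.sum_congr rfl fun f _ => ?_
      simp only [Fin.cons_succ, ite_and]
      rw [Finset.sum_ite_eq]
      simp only [Finset.mem_univ, if_true]
      congr 2
      simp only [add_mul, ite_mul, zero_mul, Finset.sum_add_distrib, Finset.sum_ite_eq',
        Finset.mem_univ, if_true]
      rw [add_comm]

/-- The generating function of the traces of the symmetrizer on the words of given letter sum. -/
def traceSum {α : Type} [Fintype α] [LinearOrder α] (B : ℕ) (r c : α → ℕ) : ℤ :=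
  ∑ h : Equiv.Perm α with ∀ x, r (h x) = r x, ∑ v : Equiv.Perm α with ∀ x, c (v x) = c x,
    (Equiv.Perm.sign v : ℤ) *
      ((∑ f : α → Fin 3 with ∀ x, f (h (v x)) = f x, B ^ ∑ i, (f i : ℕ) : ℕ) : ℤ)

theorem traceList_ofFn (B : ℕ) {n : ℕ} (r c : Fin n → ℕ) :
    traceList B (List.ofFn r) (List.ofFn c) = traceSum B r c := by
  have h1 : (List.ofFn r).map (fun _ => 1) = List.ofFn fun _ : Fin n => 1 := by
    rw [List.map_ofFn]
    rfl
  rw [traceList, unsignedSum_stabilizer, traceSum]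
  refine Finset.sum_congr (by congr!) fun h _ => ?_
  rw [signedSum_stabilizer]
  refine Finset.sum_congr (by congr!) fun v _ => ?_
  rw [permList_mul, h1, List.length_ofFn, fixSum_permList]
  refine congrArg _ (congrArg _ (Finset.sum_congr (Finset.ext fun f => ?_) fun f _ => by
    simp only [one_mul]))
  -- The predicates agree definitionally; the decidability instances are left to unification.
  refine (@Finset.mem_filter _ _ (_) _ _).trans (Iff.trans ?_ (@Finset.mem_filter _ _ (_) _ _).symm)
  exact Iff.rfl

/-! ### Invariance under relabelling -/

section Transport

variable {α β : Type} [Fintype α] [LinearOrder α] [Fintype β] [LinearOrder β]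

theorem sum_stabilizer_equiv {M : Type*} [AddCommMonoid M] (ε : α ≃ β) (r : β → ℕ)
    (F : Equiv.Perm α → M) (G : Equiv.Perm β → M) (hFG : ∀ σ, F σ = G (ε.permCongr σ)) :
    ∑ σ : Equiv.Perm α with ∀ x, r (ε (σ x)) = r (ε x), F σ =
      ∑ σ : Equiv.Perm β with ∀ x, r (σ x) = r x, G σ := by
  refine Finset.sum_equiv ε.permCongr (fun σ => ?_) fun σ _ => hFG σ
  simp only [Finset.mem_filter, Finset.mem_univ, true_and, Equiv.permCongr_apply]
  exact ε.forall_congr fun {x} => by simp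

theorem symmetrizerScalar_comp (ε : α ≃ β) (r c : β → ℕ) :
    symmetrizerScalar (r ∘ ε) (c ∘ ε) = symmetrizerScalar r c := by
  refine sum_stabilizer_equiv ε r _ _ fun h => ?_
  refine sum_stabilizer_equiv ε c _ _ fun v => ?_
  refine sum_stabilizer_equiv ε c _ _ fun w => ?_
  rw [Equiv.Perm.sign_permCongr, Equiv.Perm.sign_permCongr]
  refine if_congr ?_ rfl rfl
  exact ε.forall_congr fun {x} => by simp

theorem traceSum_comp (B : ℕ) (ε : α ≃ β) (r c : β → ℕ) :
    traceSum B (r ∘ ε) (c ∘ ε) = traceSum B r c := by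
  refine sum_stabilizer_equiv ε r _ _ fun h => ?_
  refine sum_stabilizer_equiv ε c _ _ fun v => ?_
  rw [Equiv.Perm.sign_permCongr]
  congr 2
  refine Finset.sum_equiv (ε.arrowCongr (Equiv.refl (Fin 3))) (fun f => ?_) fun f _ => ?_
  · simp only [Finset.mem_filter, Finset.mem_univ, true_and]
    exact ε.forall_congr fun {x} => by simp
  · rw [← Equiv.sum_comp ε]
    simp

end Transport

/-! ### The boxes of a diagram, listed row by row -/

/-- The boxes of a diagram with given row lengths. -/
def boxes (rows : List ℕ) : List (ℕ × ℕ) :=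
  (List.range rows.length).flatMap fun i => (List.range (nth rows i)).map (Prod.mk i)

theorem nth_eq (l : List ℕ) (i : ℕ) (h : i < l.length) : nth l i = l[i] := by
  induction l generalizing i with
  | nil => simp at h
  | cons a l ih =>
    cases i with
    | zero => rfl
    | succ i => exact ih i (by simpa using h)

theorem mem_boxes (μ : YoungDiagram) (c : ℕ × ℕ) : c ∈ boxes μ.rowLens ↔ c ∈ μ.cells := by
  rw [YoungDiagram.mem_cells]
  obtain ⟨i, j⟩ := c
  simp only [boxes, List.mem_flatMap, List.mem_range, List.mem_map, Prod.mk.injEq,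
    YoungDiagram.length_rowLens]
  constructor
  · rintro ⟨i', h1, j', h2, rfl, rfl⟩
    rw [nth_eq _ _ (by simpa using h1), YoungDiagram.get_rowLens] at h2
    exact YoungDiagram.mem_iff_lt_rowLen.2 h2
  · intro h
    have h1 : i < μ.colLen 0 := YoungDiagram.mem_iff_lt_colLen.1 (μ.up_left_mem le_rfl (Nat.zero_le _) h)
    refine ⟨i, h1, j, ?_, rfl, rfl⟩
    rw [nth_eq _ _ (by simpa using h1), YoungDiagram.get_rowLens]
    exact YoungDiagram.mem_iff_lt_rowLen.1 h

theorem nodup_boxes (rows : List ℕ) : (boxes rows).Nodup := by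
  rw [boxes, List.nodup_flatMap]
  refine ⟨fun i _ => List.nodup_range.map (Prod.mk_right_injective i), ?_⟩
  refine (List.nodup_range (n := rows.length)).imp fun {a b} hab => ?_
  intro x hx hy
  simp only [List.mem_map] at hx hy
  obtain ⟨_, -, rfl⟩ := hx
  obtain ⟨_, -, h⟩ := hy
  exact hab (Prod.ext_iff.1 h).1.symm

/-- The bijective filling of a diagram along the list of its boxes. -/
def boxesEquiv (μ : YoungDiagram) : μ.cells ≃ Fin (boxes μ.rowLens).length :=
  (Equiv.subtypeEquivRight fun c => (mem_boxes μ c).symm).trans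
    ((nodup_boxes μ.rowLens).getEquiv _).symm

theorem ofFn_rowOf_boxesEquiv (μ : YoungDiagram) :
    List.ofFn (rowOf (boxesEquiv μ)) = (boxes μ.rowLens).map Prod.fst := by
  conv_rhs => rw [← List.ofFn_get (boxes μ.rowLens), List.map_ofFn]
  rfl

theorem ofFn_colOf_boxesEquiv (μ : YoungDiagram) :
    List.ofFn (colOf (boxesEquiv μ)) = (boxes μ.rowLens).map Prod.snd := by
  conv_rhs => rw [← List.ofFn_get (boxes μ.rowLens), List.map_ofFn]
  rfl

theorem card_eq_length_boxes (μ : YoungDiagram) : μ.card = (boxes μ.rowLens).length := by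
  have h := Fintype.card_congr (boxesEquiv μ)
  rwa [Fintype.card_fin, Fintype.card_coe] at h

theorem length_boxes (rows : List ℕ) : (boxes rows).length = rows.sum := by
  have h : (List.range rows.length).map (nth rows) = rows := by
    refine List.ext_getElem (by simp) fun i h1 h2 => ?_
    rw [List.getElem_map, List.getElem_range, nth_eq _ _ h2]
  rw [boxes, List.length_flatMap]
  simp only [List.length_map, List.length_range]
  rw [h]

theorem card_eq_sum_rowLens (μ : YoungDiagram) : μ.card = μ.rowLens.sum := by
  rw [card_eq_length_boxes, length_boxes]

section Shape

variable {μ : YoungDiagram} {α : Type} [Fintype α] [LinearOrder α]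

theorem rowOf_eq_comp (t : μ.cells ≃ α) :
    rowOf t = rowOf (boxesEquiv μ) ∘ (t.symm.trans (boxesEquiv μ)) := by
  funext x
  simp [rowOf]

theorem colOf_eq_comp (t : μ.cells ≃ α) :
    colOf t = colOf (boxesEquiv μ) ∘ (t.symm.trans (boxesEquiv μ)) := by
  funext x
  simp [colOf]

/-- Relabelling the entries conjugates all permutations, so the scalar depends on the shape only and
can be computed from the list of boxes. -/
theorem symmetrizerScalar_eq (t : μ.cells ≃ α) : symmetrizerScalar (rowOf t) (colOf t) =
    scalarList ((boxes μ.rowLens).map Prod.fst) ((boxes μ.rowLens).map Prod.snd) := by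
  rw [rowOf_eq_comp, colOf_eq_comp, symmetrizerScalar_comp, ← scalarList_ofFn,
    ofFn_rowOf_boxesEquiv, ofFn_colOf_boxesEquiv]

theorem traceSum_eq (B : ℕ) (t : μ.cells ≃ α) : traceSum B (rowOf t) (colOf t) =
    traceList B ((boxes μ.rowLens).map Prod.fst) ((boxes μ.rowLens).map Prod.snd) := by
  rw [rowOf_eq_comp, colOf_eq_comp, traceSum_comp, ← traceList_ofFn,
    ofFn_rowOf_boxesEquiv, ofFn_colOf_boxesEquiv]

theorem card_of_tableau (t : μ.cells ≃ α) : Fintype.card α = μ.card := by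
  rw [← Fintype.card_congr t, Fintype.card_coe]

end Shape

/-! ### Weight multiplicities of the symmetrized operators -/

theorem digits_unique {B : ℕ} (N : ℕ) {a b : ℕ → ℕ} (ha : ∀ s, a s < B) (hb : ∀ s, b s < B)
    (h : ∑ s ∈ Finset.range N, a s * B ^ s = ∑ s ∈ Finset.range N, b s * B ^ s) :
    ∀ s < N, a s = b s := by
  induction N generalizing a b with
  | zero => intro s hs; omega
  | succ N ih =>
    rw [Finset.sum_range_succ', Finset.sum_range_succ'] at h
    simp only [pow_zero, mul_one, pow_succ, ← mul_assoc, ← Finset.sum_mul] at h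
    have h0 : a 0 = b 0 := by
      have := congrArg (· % B) h
      simpa [Nat.add_mod, Nat.mod_eq_of_lt (ha 0), Nat.mod_eq_of_lt (hb 0)] using this
    rw [h0, add_left_inj] at h
    have hB : 0 < B := (Nat.zero_le _).trans_lt (ha 0)
    have h1 := ih (a := fun s => a (s + 1)) (b := fun s => b (s + 1)) (fun s => ha _)
      (fun s => hb _) (Nat.eq_of_mul_eq_mul_right hB h)
    intro s hs
    cases s with
    | zero => exact h0
    | succ s => exact h1 s (by omega)

/-- The multiplicity of the weight `s - g` for tensor operators of given ranks. -/
def weightCount (ranks : List ℕ) (g s : ℕ) : ℕ :=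
  -- Together the inequalities say |s - g| ≤ j without subtraction.
  ranks.countP fun j => Nat.ble s (g + j) && Nat.ble g (s + j)

/-- The generating function of the weight multiplicities for tensor operators of given ranks. -/
def weightSum (B : ℕ) (ranks : List ℕ) (g : ℕ) : ℕ :=
  ((List.range (2 * g + 1)).map fun s => weightCount ranks g s * B ^ s).sum

/-- The evaluation at `1000` of the generating function of the traces agrees with the ranks. -/
def checkShape (rows ranks : List ℕ) : Bool :=
  -- Ranks up to g keep all weights in the range of s; at most 999 ranks keep every count a digit in
  -- base 1000.
  (ranks.all fun j => Nat.ble j rows.sum) && Nat.ble ranks.length 999 &&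
    decide (scalarList ((boxes rows).map Prod.fst) ((boxes rows).map Prod.snd) ≠ 0) &&
    decide (traceList 1000 ((boxes rows).map Prod.fst) ((boxes rows).map Prod.snd) =
      scalarList ((boxes rows).map Prod.fst) ((boxes rows).map Prod.snd) *
        weightSum 1000 ranks rows.sum)

section Multiplicities

variable {μ : YoungDiagram} {α : Type} [Fintype α] [LinearOrder α] {n : ℕ} {e : α ↪ Fin n}
  {φ : Equiv.Perm α →* Equiv.Perm (Fin n)}

theorem wordWeight_eq (f : α → Fin 3) :
    wordWeight f = ((∑ a, (f a : ℕ) : ℕ) : ℤ) - Fintype.card α := by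
  rw [wordWeight, Finset.sum_sub_distrib]
  simp

theorem letterSum_le (f : α → Fin 3) : ∑ a, (f a : ℕ) ≤ 2 * Fintype.card α := by
  refine (Finset.sum_le_card_nsmul _ _ 2 fun a _ => by omega).trans ?_
  rw [Finset.card_univ, smul_eq_mul, mul_comm]

/-- Words are grouped by their letter sum s, which is the weight shifted by the number of letters.
-/
theorem traceSum_eq_sum (B : ℕ) (r c : α → ℕ) : traceSum B r c =
    ∑ s ∈ Finset.range (2 * Fintype.card α + 1),
      symmetrizerTrace r c (· = (s : ℤ) - Fintype.card α) * (B : ℤ) ^ s := by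
  simp only [traceSum, symmetrizerTrace, Finset.sum_mul]
  conv_rhs => rw [Finset.sum_comm]
  refine Finset.sum_congr rfl fun h _ => ?_
  conv_rhs => rw [Finset.sum_comm]
  refine Finset.sum_congr rfl fun v _ => ?_
  simp only [mul_assoc, ← Finset.mul_sum]
  congr 1
  rw [← Finset.sum_fiberwise_of_maps_to (g := fun f : α → Fin 3 => ∑ a, (f a : ℕ))
    (t := Finset.range (2 * Fintype.card α + 1))
    fun f _ => Finset.mem_range.2 (Nat.lt_succ_of_le (letterSum_le f)), Nat.cast_sum]
  refine Finset.sum_congr rfl fun s _ => ?_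
  rw [Finset.sum_congr rfl fun f hf => by rw [(Finset.mem_filter.1 hf).2], Finset.sum_const,
    Finset.filter_filter, smul_eq_mul, Nat.cast_mul, Nat.cast_pow]
  congr 3
  ext f
  simp only [Finset.mem_filter, Finset.mem_univ, true_and, wordWeight_eq, sub_left_inj, Nat.cast_inj]
  exact and_comm

theorem traceSum_one (r c : α → ℕ) : traceSum 1 r c = symmetrizerTrace r c fun _ => True := by
  simp [traceSum, symmetrizerTrace]

theorem finrank_wordSpan_map_le (e : α ↪ Fin n) (p : ℤ → Prop) (f : Op n →ₗ[ℂ] Op n) :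
    Module.finrank ℂ ((wordSpan e p).map f) ≤ 3 ^ Fintype.card α := by
  classical
  refine (Submodule.finrank_map_le _ _).trans ((finrank_range_le_card _).trans ?_)
  refine (Fintype.card_subtype_le _).trans ?_
  simp

theorem symmetrizerScalar_ne_zero {ranks : List ℕ} (h : checkShape μ.rowLens ranks = true)
    (t : μ.cells ≃ α) : symmetrizerScalar (rowOf t) (colOf t) ≠ 0 := by
  rw [symmetrizerScalar_eq]
  simp only [checkShape, Bool.and_eq_true, decide_eq_true_eq] at h
  exact h.1.2

/-- After division by κ, the verified equality says that two numbers with digits in base 1000 agree.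
The digits are the expected multiplicities and the actual dimensions, the latter at most 3^6 = 729.
-/
theorem finrank_wordSpan_map (hφ : ∀ σ a, φ σ (e a) = e (σ a)) (t : μ.cells ≃ α)
    {ranks : List ℕ} (h : checkShape μ.rowLens ranks = true) (hμ : μ.card ≤ 6) {s : ℕ}
    (hs : s ≤ 2 * μ.card) :
    Module.finrank ℂ ((wordSpan e (· = (s : ℤ) - μ.card)).map (symAct φ (rowSum t * colSum t))) =
      weightCount ranks μ.card s := by
  have hκ := symmetrizerScalar_ne_zero h t
  have h1 := traceSum_eq_sum 1000 (rowOf t) (colOf t)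
  rw [card_of_tableau t] at h1
  simp only [← scalar_mul_finrank hφ t _ hκ, mul_assoc, ← Finset.mul_sum] at h1
  simp only [checkShape, Bool.and_eq_true, decide_eq_true_eq, ← card_eq_sum_rowLens] at h
  rw [traceSum_eq, h.2, ← symmetrizerScalar_eq t, mul_right_inj' hκ] at h1
  have h2 : ∑ s ∈ Finset.range (2 * μ.card + 1), weightCount ranks μ.card s * 1000 ^ s =
      ∑ s ∈ Finset.range (2 * μ.card + 1), Module.finrank ℂ ((wordSpan e
        (· = (s : ℤ) - μ.card)).map (symAct φ (rowSum t * colSum t))) * 1000 ^ s := by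
    have h3 : weightSum 1000 ranks μ.card =
        ∑ s ∈ Finset.range (2 * μ.card + 1), weightCount ranks μ.card s * 1000 ^ s := rfl
    rw [← h3]
    exact_mod_cast h1
  refine (digits_unique _ (fun s => ?_) (fun s => ?_) h2 s (by omega)).symm
  · refine List.countP_le_length.trans_lt (Nat.lt_of_le_of_lt (Nat.le_of_ble_eq_true h.1.1.2) ?_)
    norm_num
  · refine (finrank_wordSpan_map_le _ _ _).trans_lt ?_
    rw [card_of_tableau t]
    exact (Nat.pow_le_pow_right (by norm_num) hμ).trans_lt (by norm_num)

theorem finrank_weightSpace (hφ : ∀ σ a, φ σ (e a) = e (σ a)) (t : μ.cells ≃ α)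
    {ranks : List ℕ} (h : checkShape μ.rowLens ranks = true) (hμ : μ.card ≤ 6) (w : ℕ) :
    Module.finrank ℂ (weightSpace
      ((linOps (Finset.univ.map e)).map (symAct φ (rowSum t * colSum t))) w) =
      ranks.countP (w ≤ ·) := by
  rw [weightSpace_map hφ]
  have hranks : ∀ j ∈ ranks, j ≤ μ.card := by
    simp only [checkShape, Bool.and_eq_true, List.all_eq_true, ← card_eq_sum_rowLens] at h
    exact fun j hj => Nat.le_of_ble_eq_true (h.1.1.1 j hj)
  by_cases hw : w ≤ μ.card
  · have h1 := finrank_wordSpan_map hφ t h hμ (s := w + μ.card) (by omega)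
    rw [Nat.cast_add, add_sub_cancel_right] at h1
    rw [h1, weightCount]
    refine List.countP_congr fun j _ => ?_
    simp only [Bool.and_eq_true, Nat.ble_eq, decide_eq_true_eq]
    omega
  · have hempty : wordSpan e (· = (w : ℤ)) = ⊥ := by
      rw [wordSpan, Submodule.span_eq_bot]
      rintro _ ⟨⟨f, hf⟩, rfl⟩
      exfalso
      rw [wordWeight_eq, card_of_tableau t] at hf
      have := letterSum_le f
      rw [card_of_tableau t] at this
      omega
    rw [hempty, Submodule.map_bot, finrank_bot, eq_comm, List.countP_eq_zero]
    intro j hj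
    have := hranks j hj
    simp only [decide_eq_true_eq]
    omega

theorem countP_le_eq (ranks : List ℕ) (j : ℕ) :
    ranks.countP (j ≤ ·) = ranks.count j + ranks.countP (j + 1 ≤ ·) := by
  induction ranks with
  | nil => rfl
  | cons a l ih =>
    rw [List.countP_cons, List.countP_cons, List.count_cons, ih]
    simp only [decide_eq_true_eq, beq_iff_eq]
    split_ifs <;> omega

/-- A weight w ≥ 0 occurs once for every rank ≥ w; the difference between w = j and w = j + 1 counts
the ranks equal to j. -/
theorem finrank_tensorOperators_map (hφ : ∀ σ a, φ σ (e a) = e (σ a)) (t : μ.cells ≃ α)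
    {ranks : List ℕ} (h : checkShape μ.rowLens ranks = true) (hμ : μ.card ≤ 6) (j : ℕ) :
    Module.finrank ℂ (tensorOperators
      ((linOps (Finset.univ.map e)).map (symAct φ (rowSum t * colSum t))) j) =
      ranks.count j := by
  have h1 := finrank_tensorOperators (ladderStable_map (φ := φ) (G := Finset.univ.map e)
    (rowSum t * colSum t)) j
  have h2 := finrank_weightSpace hφ t h hμ (j + 1)
  rw [finrank_weightSpace hφ t h hμ j, countP_le_eq] at h1
  rw [Nat.cast_succ] at h2
  omega

theorem finrank_map (hφ : ∀ σ a, φ σ (e a) = e (σ a)) (t : μ.cells ≃ α)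
    {ranks : List ℕ} (h : checkShape μ.rowLens ranks = true) (hμ : μ.card ≤ 6) :
    Module.finrank ℂ ((linOps (Finset.univ.map e)).map (symAct φ (rowSum t * colSum t))) =
      weightSum 1 ranks μ.card := by
  have hκ := symmetrizerScalar_ne_zero h t
  have h1 := traceSum_eq_sum 1 (rowOf t) (colOf t)
  rw [traceSum_one, ← scalar_mul_finrank hφ t _ hκ, wordSpan_true, card_of_tableau t] at h1
  simp only [← scalar_mul_finrank hφ t _ hκ, mul_assoc, ← Finset.mul_sum] at h1
  rw [mul_right_inj' hκ] at h1
  have h2 : weightSum 1 ranks μ.card =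
      ∑ s ∈ Finset.range (2 * μ.card + 1), weightCount ranks μ.card s * 1 ^ s := rfl
  rw [h2, Finset.sum_congr rfl fun s hs => by
    rw [← finrank_wordSpan_map hφ t h hμ (Nat.lt_succ_iff.1 (Finset.mem_range.1 hs))]]
  exact_mod_cast h1

theorem rankMultiplicity_eq_count {ranks : List ℕ} (h : checkShape μ.rowLens ranks = true)
    (hμ : μ.card ≤ 6) (j : ℕ) : rankMultiplicity μ j = ranks.count j := by
  rw [rankMultiplicity_eq μ j (symmetrizerScalar_ne_zero h _),
    ← finrank_tensorOperators_map (e := Function.Embedding.refl (Fin μ.card))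
      (φ := MonoidHom.id (Equiv.Perm (Fin μ.card))) (fun σ a => rfl) (rowReading μ) h hμ j,
    Finset.map_refl]
  rfl

end Multiplicities

/-! ### The shapes with at most five boxes -/

/-- The compositions of `n`. -/
def compositions : ℕ → List (List ℕ)
  | 0 => [[]]
  | n + 1 => (compositions n).flatMap fun l =>
    match l with
    | [] => [[1]]
    | a :: l => [1 :: a :: l, (a + 1) :: l]

/-- The partitions of `n`. -/
def partitions (n : ℕ) : List (List ℕ) :=
  (compositions n).filter fun l => decide (l.Pairwise (· ≥ ·))

theorem mem_compositions {l : List ℕ} (hl : ∀ x ∈ l, 0 < x) : l ∈ compositions l.sum := by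
  obtain ⟨n, hn⟩ : ∃ n, l.sum = n := ⟨_, rfl⟩
  rw [hn]
  induction n generalizing l with
  | zero =>
    cases l with
    | nil => simp [compositions]
    | cons a l =>
      have := hl a (by simp)
      rw [List.sum_cons] at hn
      omega
  | succ n ih =>
    rw [compositions, List.mem_flatMap]
    match l, hl, hn with
    | [], _, hn => simp at hn
    | 1 :: l, hl, hn =>
      rw [List.sum_cons, add_comm, Nat.succ.injEq] at hn
      refine ⟨l, ih (fun x hx => hl x (List.mem_cons_of_mem _ hx)) hn, ?_⟩
      cases l <;> simp
    | 0 :: l, hl, _ => exact absurd (hl 0 (by simp)) (lt_irrefl 0)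
    | (a + 2) :: l, hl, hn =>
      refine ⟨(a + 1) :: l, ih (fun x hx => ?_) ?_, by simp⟩
      · rcases List.mem_cons.1 hx with rfl | hx
        · omega
        · exact hl x (List.mem_cons_of_mem _ hx)
      · rw [List.sum_cons] at hn ⊢
        omega

theorem rowLens_mem_partitions (μ : YoungDiagram) : μ.rowLens ∈ partitions μ.card := by
  rw [partitions, List.mem_filter, card_eq_sum_rowLens]
  refine ⟨mem_compositions μ.pos_of_mem_rowLens, ?_⟩
  rw [decide_eq_true_eq]
  exact μ.rowLens_sorted.pairwise

/-- The ranks of the table, as a list. -/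
def tableRanks (rows : List ℕ) : List ℕ := (List.range 6).filter fun j => decide (j ∈ rankTable rows)

/-- A finite computation. Shapes with more than three rows fall under the empty default of the
table: antisymmetrising four letters out of three gives zero. -/
theorem checkShape_partitions : ∀ g ∈ List.range 6, ∀ rows ∈ partitions g,
    checkShape rows (tableRanks rows) = true := by
  decide +kernel

theorem checkShape_of_card_le {μ : YoungDiagram} (hμ : μ.card ≤ 5) :
    checkShape μ.rowLens (tableRanks μ.rowLens) = true :=
  checkShape_partitions μ.card (List.mem_range.2 (by omega)) _ (rowLens_mem_partitions μ)

theorem mem_tableRanks {rows : List ℕ} {j : ℕ} : j ∈ tableRanks rows ↔ j ∈ rankTable rows := by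
  have h : ∀ j ∈ rankTable rows, j < 6 := by
    unfold rankTable
    split <;> decide
  rw [tableRanks, List.mem_filter, List.mem_range, decide_eq_true_eq]
  exact ⟨fun hj => hj.2, fun hj => ⟨h j hj, hj⟩⟩

theorem rankMultiplicity_of_card_le {μ : YoungDiagram} (hμ : μ.card ≤ 5) (j : ℕ) :
    rankMultiplicity μ j = if j ∈ rankTable μ.rowLens then 1 else 0 := by
  have hn : (tableRanks μ.rowLens).Nodup := List.nodup_range.filter _
  rw [rankMultiplicity_eq_count (checkShape_of_card_le hμ) (by omega), hn.count]
  exact if_congr mem_tableRanks rfl rfl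

/-- The dimensions fit: the Schur functor of [4,2] on ℂ³ has dimension 27 = 1 + 5 + 5 + 7 + 9. -/
theorem checkShape_four_two : checkShape [4, 2] [0, 2, 2, 3, 4] = true := by
  decide +kernel

theorem rankMultiplicity_four_two :
    rankMultiplicity (YoungDiagram.ofRowLens [4, 2] (by decide)) 2 = 2 := by
  have h : (YoungDiagram.ofRowLens [4, 2] (by decide)).rowLens = [4, 2] :=
    YoungDiagram.rowLens_ofRowLens_eq_self (by decide)
  rw [rankMultiplicity_eq_count (ranks := [0, 2, 2, 3, 4]) (by rw [h]; exact checkShape_four_two)]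
  · rfl
  · rw [card_eq_sum_rowLens, h]
    rfl

/-! ### Orthogonality of the symmetry types -/

/-- Pairwise orthogonal subspaces with sufficiently large dimensions span. -/
theorem iSup_eq_of_orthogonal {n : ℕ} {ι : Type*} [Fintype ι] {V : ι → Submodule ℂ (Op n)}
    {W : Submodule ℂ (Op n)} (hV : ∀ i, V i ≤ W)
    (ho : ∀ i j, i ≠ j → ∀ X ∈ V i, ∀ Y ∈ V j, ip X Y = 0)
    (hd : Module.finrank ℂ W ≤ ∑ i, Module.finrank ℂ (V i)) : ⨆ i, V i = W := by
  classical
  let f : (∀ i, V i) →ₗ[ℂ] Op n := ∑ i, (V i).subtype ∘ₗ LinearMap.proj i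
  have hf : ∀ x, f x = ∑ i, (x i : Op n) := fun x => by simp [f]
  have hinj : Function.Injective f := by
    rw [← LinearMap.ker_eq_bot, LinearMap.ker_eq_bot']
    intro x hx
    funext i
    apply Subtype.ext
    have h : ip (x i : Op n) (f x) = 0 := by rw [hx, ip_zero_right]
    rw [hf, ip_sum_right, Finset.sum_eq_single i (fun j _ hj => ho i j hj.symm _ (x i).2 _ (x j).2)
      (by simp)] at h
    exact ip_self_eq_zero.1 h
  have hr : LinearMap.range f ≤ ⨆ i, V i := by
    rintro _ ⟨x, rfl⟩
    rw [hf]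
    exact Submodule.sum_mem _ fun i _ => Submodule.mem_iSup_of_mem i (x i).2
  have hW : LinearMap.range f = W := by
    refine Submodule.eq_of_le_of_finrank_le (hr.trans (iSup_le hV)) ?_
    rw [LinearMap.finrank_range_of_inj hinj, Module.finrank_pi_fintype]
    exact hd
  exact le_antisymm (iSup_le hV) (hW ▸ hr)

section JucysMurphySpaces

variable {μ : YoungDiagram} {α : Type} [Fintype α] [LinearOrder α] {n : ℕ} {e : α ↪ Fin n}
  {φ : Equiv.Perm α →* Equiv.Perm (Fin n)}

/-- Permutations act unitarily and transpositions are their own inverses, so these sums of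
transpositions are self-adjoint. -/
theorem ip_symAct_jucysMurphy (k : α) (X Y : Op n) :
    ip (symAct φ (jucysMurphy k) X) Y = ip X (symAct φ (jucysMurphy k) Y) := by
  simp only [jucysMurphy, map_sum, LinearMap.sum_apply, symAct_of, ip_sum_left, ip_sum_right]
  refine Finset.sum_congr rfl fun i _ => ?_
  rw [← ip_permRep (φ (Equiv.swap i k)) (permRep n (φ (Equiv.swap i k)) X), ← Module.End.mul_apply,
    ← map_mul, ← map_mul, Equiv.swap_mul_self, map_one, map_one, Module.End.one_apply]

/-- The operators in `W` on which the Jucys-Murphy elements act by the contents of `t`. -/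
def contentSpace (φ : Equiv.Perm α →* Equiv.Perm (Fin n)) (W : Submodule ℂ (Op n))
    (t : μ.cells ≃ α) : Submodule ℂ (Op n) :=
  W ⊓ ⨅ k, Module.End.eigenspace (symAct φ (jucysMurphy k)) (content t k : ℂ)

theorem mem_contentSpace {W : Submodule ℂ (Op n)} {t : μ.cells ≃ α} {X : Op n} :
    X ∈ contentSpace φ W t ↔
      X ∈ W ∧ ∀ k, symAct φ (jucysMurphy k) X = (content t k : ℂ) • X := by
  simp only [contentSpace, Submodule.mem_inf, Submodule.mem_iInf, Module.End.mem_eigenspace_iff]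

/-- Some entry has different contents in the two tableaux, and eigenspaces of a self-adjoint
operator for different eigenvalues are orthogonal. -/
theorem ip_contentSpace {μ' : YoungDiagram} {W : Submodule ℂ (Op n)} {p : StdTableau μ α}
    {q : StdTableau μ' α} (h : (⟨μ, p⟩ : Σ ν, StdTableau ν α) ≠ ⟨μ', q⟩) {X Y : Op n}
    (hX : X ∈ contentSpace φ W p.entry) (hY : Y ∈ contentSpace φ W q.entry) : ip X Y = 0 := by
  obtain ⟨k, hk⟩ : ∃ k, content p.entry k ≠ content q.entry k := by
    by_contra hne
    push Not at hne
    exact h (p.eq_of_content q hne)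
  have h1 := ip_symAct_jucysMurphy (φ := φ) k X Y
  rw [(mem_contentSpace.1 hX).2, (mem_contentSpace.1 hY).2, ip_smul_left, ip_smul_right] at h1
  have h2 : ((content p.entry k : ℂ) - content q.entry k) * ip X Y = 0 := by
    rw [sub_mul, ← h1]
    simp
  refine (mul_eq_zero.1 h2).resolve_left ?_
  rw [sub_eq_zero]
  exact_mod_cast hk

theorem symAct_mem_linOps (hφ : ∀ σ a, φ σ (e a) = e (σ a)) (x : MonoidAlgebra ℂ (Equiv.Perm α))
    {X : Op n} (hX : X ∈ linOps (Finset.univ.map e)) :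
    symAct φ x X ∈ linOps (Finset.univ.map e) := by
  rw [← wordSpan_true] at hX ⊢
  exact symAct_mem (permRep_mem_wordSpan hφ) x hX

theorem map_le_contentSpace (hφ : ∀ σ a, φ σ (e a) = e (σ a)) {τ : StdTableau μ α}
    {P : MonoidAlgebra ℂ (Equiv.Perm α)} (hP : IsYoungOperator τ P) :
    (linOps (Finset.univ.map e)).map (symAct φ P) ≤
      contentSpace φ (linOps (Finset.univ.map e)) τ.entry := by
  rintro _ ⟨X, hX, rfl⟩
  refine mem_contentSpace.2 ⟨symAct_mem_linOps hφ P hX, fun k => ?_⟩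
  rw [← Module.End.mul_apply, ← map_mul, hP.jucysMurphy_mul, map_smul, LinearMap.smul_apply]

/-- The operators of symmetry type `τ`, by means of one of the Young operators. -/
def symmetrySpace (e : α ↪ Fin n) (φ : Equiv.Perm α →* Equiv.Perm (Fin n)) (τ : StdTableau μ α) :
    Submodule ℂ (Op n) :=
  (linOps (Finset.univ.map e)).map (symAct φ τ.exists_isYoungOperator.choose)

theorem symmetrySpace_le (hφ : ∀ σ a, φ σ (e a) = e (σ a)) (τ : StdTableau μ α) :
    symmetrySpace e φ τ ≤ contentSpace φ (linOps (Finset.univ.map e)) τ.entry :=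
  map_le_contentSpace hφ τ.exists_isYoungOperator.choose_spec

theorem finrank_symmetrySpace (hφ : ∀ σ a, φ σ (e a) = e (σ a)) (τ : StdTableau μ α)
    {ranks : List ℕ} (h : checkShape μ.rowLens ranks = true) (hμ : μ.card ≤ 6) :
    Module.finrank ℂ (symmetrySpace e φ τ) = weightSum 1 ranks μ.card := by
  obtain ⟨q, u, hu, hP⟩ := τ.exists_isYoungOperator.choose_spec.exists_unit_mul
  rw [symmetrySpace, hP, finrank_map_unit_mul hu, finrank_map hφ q.entry h hμ]

theorem finrank_tensorOperators_unit_mul (hφ : ∀ σ a, φ σ (e a) = e (σ a))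
    {u : MonoidAlgebra ℂ (Equiv.Perm α)} (hu : IsUnit u) (x : MonoidAlgebra ℂ (Equiv.Perm α))
    (j : ℕ) :
    Module.finrank ℂ (tensorOperators ((linOps (Finset.univ.map e)).map (symAct φ (u * x))) j) =
      Module.finrank ℂ (tensorOperators ((linOps (Finset.univ.map e)).map (symAct φ x)) j) := by
  have h1 := finrank_tensorOperators
    (ladderStable_map (φ := φ) (G := Finset.univ.map e) (u * x)) j
  have h2 := finrank_tensorOperators (ladderStable_map (φ := φ) (G := Finset.univ.map e) x) j
  rw [weightSpace_map hφ, weightSpace_map hφ, finrank_map_unit_mul hu, finrank_map_unit_mul hu] at h1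
  rw [weightSpace_map hφ, weightSpace_map hφ] at h2
  omega

theorem finrank_tensorOperators_symmetrySpace (hφ : ∀ σ a, φ σ (e a) = e (σ a))
    (τ : StdTableau μ α) {ranks : List ℕ} (h : checkShape μ.rowLens ranks = true)
    (hμ : μ.card ≤ 6) (j : ℕ) :
    Module.finrank ℂ (tensorOperators (symmetrySpace e φ τ) j) = ranks.count j := by
  obtain ⟨q, u, hu, hP⟩ := τ.exists_isYoungOperator.choose_spec.exists_unit_mul
  rw [symmetrySpace, hP, finrank_tensorOperators_unit_mul hφ hu,
    finrank_tensorOperators_map hφ q.entry h hμ]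

theorem finrank_linOps (e : α ↪ Fin n) :
    Module.finrank ℂ (linOps (Finset.univ.map e)) = 3 ^ Fintype.card α := by
  classical
  rw [← span_wordOp, finrank_span_eq_card (linearIndependent_wordOp e)]
  simp

end JucysMurphySpaces

/-! ### Counting standard tableaux -/

/-- Whether the list `l` of entries of the boxes with rows `r` and columns `c` is standard. -/
def isStandardList (r c l : List ℕ) : Bool :=
  (List.range r.length).all fun i => (List.range r.length).all fun k =>
    (!(Nat.beq (nth r i) (nth r k) && Nat.blt (nth c i) (nth c k)) || Nat.blt (nth l i) (nth l k)) &&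
    (!(Nat.beq (nth c i) (nth c k) && Nat.blt (nth r i) (nth r k)) || Nat.blt (nth l i) (nth l k))

/-- The number of standard tableaux whose rows have given lengths. -/
def tableauCount (rows : List ℕ) : ℕ :=
  ((signedPerms (boxes rows).length).map fun x =>
    if isStandardList ((boxes rows).map Prod.fst) ((boxes rows).map Prod.snd) x.1 = true
    then 1 else 0).sum

theorem isStandardList_iff {n : ℕ} (r c : Fin n → ℕ) (σ : Equiv.Perm (Fin n)) :
    isStandardList (List.ofFn r) (List.ofFn c) (permList σ) = true ↔
      ∀ i k, (r i = r k → c i < c k → σ i < σ k) ∧ (c i = c k → r i < r k → σ i < σ k) := by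
  have hall : ∀ f : ℕ → Bool, ((List.range (List.ofFn r).length).all f = true) ↔
      ∀ i : Fin n, f i = true := by
    intro f
    rw [List.all_eq_true, List.length_ofFn]
    exact ⟨fun h i => h _ (List.mem_range.2 i.2), fun h i hi => h ⟨i, List.mem_range.1 hi⟩⟩
  have hblt : ∀ a b : ℕ, Nat.blt a b = true ↔ a < b := fun a b => by
    rw [Nat.blt, Nat.ble_eq, Nat.succ_le_iff]
  rw [isStandardList, hall]
  refine forall_congr' fun i => ?_
  rw [hall]
  refine forall_congr' fun k => ?_
  have hnth : ∀ i : Fin n, nth (permList σ) i = σ i := fun i => nth_ofFn _ i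
  simp only [nth_ofFn, hnth, Bool.and_eq_true, Bool.or_eq_true, Bool.not_eq_true', hblt,
    Nat.beq_eq, ← Bool.not_eq_true]
  refine and_congr ?_ ?_ <;>
  · rw [Fin.lt_def, or_iff_not_imp_left]
    push Not
    tauto

/-- Only this inequality is needed: for completeness a lower bound on the number of tableaux
suffices. -/
theorem tableauCount_le {μ : YoungDiagram} {α : Type} [Fintype α] [LinearOrder α]
    (hα : Fintype.card α = μ.card) : tableauCount μ.rowLens ≤ Nat.card (StdTableau μ α) := by
  classical
  have hlen : Fintype.card α = (boxes μ.rowLens).length := by rw [hα, card_eq_length_boxes]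
  let ε : Fin (boxes μ.rowLens).length ≃o α := Fintype.orderIsoFinOfCardEq α hlen
  let t := boxesEquiv μ
  let S := {σ : Equiv.Perm (Fin (boxes μ.rowLens).length) // ∀ i k,
    (rowOf t i = rowOf t k → colOf t i < colOf t k → σ i < σ k) ∧
    (colOf t i = colOf t k → rowOf t i < rowOf t k → σ i < σ k)}
  have h1 : tableauCount μ.rowLens = Fintype.card S := by
    rw [tableauCount, ← ofFn_rowOf_boxesEquiv, ← ofFn_colOf_boxesEquiv]
    refine (sum_signedPerms _ fun l _ => if isStandardList (List.ofFn (rowOf t))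
      (List.ofFn (colOf t)) l = true then 1 else 0).trans ?_
    simp only [isStandardList_iff, Finset.sum_boole, Nat.cast_id]
    rw [Fintype.card_subtype]
  let f : S → StdTableau μ α := fun σ =>
    { entry := (t.trans σ.1).trans ε.toEquiv
      row_strict := fun c c' h h' => ε.strictMono
        ((σ.2 (t c) (t c')).1 (by simpa [rowOf] using h) (by simpa [colOf] using h'))
      col_strict := fun c c' h h' => ε.strictMono
        ((σ.2 (t c) (t c')).2 (by simpa [colOf] using h) (by simpa [rowOf] using h')) }
  have hf : Function.Injective f := by
    intro σ σ' h
    refine Subtype.ext (Equiv.ext fun x => ?_)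
    have := congrArg (fun p : StdTableau μ α => p.entry (t.symm x)) h
    simpa [f] using this
  have : Finite (StdTableau μ α) := Finite.of_injective (fun p : StdTableau μ α => p.entry)
    fun p q h => StdTableau.ext_entry h
  rw [h1, ← Nat.card_eq_fintype_card]
  exact Nat.card_le_card_of_injective f hf

theorem partitions_spec : ∀ g ∈ List.range 6, (partitions g).Nodup ∧
    ∀ rows ∈ partitions g, rows.Pairwise (· ≥ ·) ∧ (∀ x ∈ rows, 0 < x) ∧ rows.sum = g := by
  decide +kernel

/-- The dimension count of Schur-Weyl duality for (ℂ³)^{⊗g}. -/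
theorem sum_tableauCount : ∀ g ∈ List.range 6,
    ((partitions g).map fun rows => tableauCount rows * weightSum 1 (tableRanks rows) g).sum =
      3 ^ g := by
  decide +kernel

/-! ### Completeness of the symmetry types -/

section Completeness

variable {μ : YoungDiagram} {α : Type} [Fintype α] [LinearOrder α] {n : ℕ} {e : α ↪ Fin n}
  {φ : Equiv.Perm α →* Equiv.Perm (Fin n)}

/-- The symmetry types are pairwise orthogonal, so their dimensions add; the sum reaches 3^g, the
dimension of the whole space. The list of partitions supplies a finite family of shapes. -/
theorem iSup_symmetrySpace (hφ : ∀ σ a, φ σ (e a) = e (σ a)) (hα : Fintype.card α ≤ 5) :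
    ⨆ x : Σ ν, StdTableau ν α, symmetrySpace e φ x.2 = linOps (Finset.univ.map e) := by
  classical
  set g := Fintype.card α with hg
  have hgr : g ∈ List.range 6 := List.mem_range.2 (by omega)
  obtain ⟨hnd, hspec⟩ := partitions_spec g hgr
  let row : Fin (partitions g).length → List ℕ := fun i => (partitions g)[i.1]
  have hrow : ∀ i, row i ∈ partitions g := fun i => List.getElem_mem _
  let shape : Fin (partitions g).length → YoungDiagram := fun i =>
    YoungDiagram.ofRowLens (row i) (hspec _ (hrow i)).1.sortedGE
  have hlens : ∀ i, (shape i).rowLens = row i := fun i =>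
    YoungDiagram.rowLens_ofRowLens_eq_self (hspec _ (hrow i)).2.1
  have hcard : ∀ i, (shape i).card = g := fun i => by
    rw [card_eq_sum_rowLens, hlens, (hspec _ (hrow i)).2.2]
  have hfin : ∀ ν, Finite (StdTableau ν α) := fun ν =>
    Finite.of_injective (fun p : StdTableau ν α => p.entry) fun p q h => StdTableau.ext_entry h
  let _ : ∀ i, Fintype (StdTableau (shape i) α) := fun i => Fintype.ofFinite _
  let ι := Σ i : Fin (partitions g).length, StdTableau (shape i) α
  have hle : ∀ x : Σ ν, StdTableau ν α, symmetrySpace e φ x.2 ≤ linOps (Finset.univ.map e) :=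
    fun x X hX => (mem_contentSpace.1 (symmetrySpace_le hφ x.2 hX)).1
  refine le_antisymm (iSup_le hle) ?_
  rw [← iSup_eq_of_orthogonal (ι := ι) (V := fun x => symmetrySpace e φ x.2)
    (W := linOps (Finset.univ.map e)) (fun x => hle ⟨_, x.2⟩) ?_ ?_]
  · exact iSup_le fun x => le_iSup (fun x : Σ ν, StdTableau ν α => symmetrySpace e φ x.2) ⟨_, x.2⟩
  · rintro ⟨i, p⟩ ⟨k, q⟩ hne X hX Y hY
    refine ip_contentSpace (p := p) (q := q) (fun h => hne ?_) (symmetrySpace_le hφ p hX)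
      (symmetrySpace_le hφ q hY)
    have hik : i = k := by
      have h0 : shape i = shape k := congrArg Sigma.fst h
      have h1 : row i = row k := by rw [← hlens, ← hlens, h0]
      exact Fin.ext ((hnd.getElem_inj_iff).1 h1)
    subst hik
    rw [eq_of_heq (Sigma.mk.inj_iff.1 h).2]
  · have hd : ∀ x : ι, Module.finrank ℂ (symmetrySpace e φ x.2) =
        weightSum 1 (tableRanks (row x.1)) g := fun x => by
      have h1 := checkShape_of_card_le (μ := shape x.1) (by rw [hcard]; exact hα)
      have h2 := finrank_symmetrySpace hφ x.2 h1 (by rw [hcard]; omega)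
      rw [h2, hcard, hlens]
    rw [finrank_linOps, Finset.sum_congr rfl fun x _ => hd x, Fintype.sum_sigma,
      ← sum_tableauCount g hgr, ← Fin.sum_univ_fun_getElem]
    refine Finset.sum_le_sum fun i _ => ?_
    change _ ≤ ∑ _y : StdTableau (shape i) α, weightSum 1 (tableRanks (row i)) g
    rw [Finset.sum_const, smul_eq_mul, Finset.card_univ, ← Nat.card_eq_fintype_card]
    refine Nat.mul_le_mul_right _ ?_
    have h1 := tableauCount_le (μ := shape i) (α := α) (by rw [hcard])
    rwa [hlens] at h1

/-- By completeness X = Y + Z with Y of type τ and Z in the sum of the other types. But Z = X - Y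
also has the contents of τ, so it is orthogonal to itself. -/
theorem contentSpace_le_symmetrySpace (hφ : ∀ σ a, φ σ (e a) = e (σ a))
    (hα : Fintype.card α ≤ 5) (τ : StdTableau μ α) :
    contentSpace φ (linOps (Finset.univ.map e)) τ.entry ≤ symmetrySpace e φ τ := by
  intro X hX
  have hsup : linOps (Finset.univ.map e) ≤ symmetrySpace e φ τ ⊔
      ⨆ x : {x : Σ ν, StdTableau ν α // x ≠ ⟨μ, τ⟩}, symmetrySpace e φ x.1.2 := by
    rw [← iSup_symmetrySpace hφ hα]
    refine iSup_le fun x => ?_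
    by_cases hx : x = ⟨μ, τ⟩
    · subst hx
      exact le_sup_left
    · exact le_sup_of_le_right (le_iSup (fun x : {x : Σ ν, StdTableau ν α // x ≠ ⟨μ, τ⟩} =>
        symmetrySpace e φ x.1.2) ⟨x, hx⟩)
  obtain ⟨Y, hY, Z, hZ, rfl⟩ := Submodule.mem_sup.1 (hsup (mem_contentSpace.1 hX).1)
  have h1 : Z ∈ contentSpace φ (linOps (Finset.univ.map e)) τ.entry := by
    have := Submodule.sub_mem _ hX (symmetrySpace_le hφ τ hY)
    rwa [add_sub_cancel_left] at this
  have h2 : ip Z Z = 0 := by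
    refine Submodule.iSup_induction _ (motive := fun A => ip Z A = 0) hZ (fun x A hA => ?_)
      (ip_zero_right _) fun A B hA hB => by rw [ip_add_right, hA, hB, add_zero]
    exact ip_contentSpace (p := τ) (q := x.1.2) x.2.symm h1 (symmetrySpace_le hφ _ hA)
  rw [ip_self_eq_zero.1 h2, add_zero]
  exact hY

end Completeness

/-! ### The spaces of the labels -/

section Labels

variable {n : ℕ}

/-- The inclusion of a set of spins. -/
abbrev siteEmb (G : Finset (Fin n)) : G ↪ Fin n := Function.Embedding.subtype fun k => k ∈ G

/-- The permutations of a set of spins as permutations of all spins. -/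
abbrev sitePerm (G : Finset (Fin n)) : Equiv.Perm G →* Equiv.Perm (Fin n) :=
  Equiv.Perm.ofSubtype (p := fun k => k ∈ G)

theorem sitePerm_apply (G : Finset (Fin n)) (σ : Equiv.Perm G) (a : G) :
    sitePerm G σ (siteEmb G a) = siteEmb G (σ a) :=
  Equiv.Perm.ofSubtype_apply_coe σ a

theorem map_siteEmb (G : Finset (Fin n)) : Finset.univ.map (siteEmb G) = G := by
  rw [Finset.univ_eq_attach]
  exact Finset.attach_map_val

theorem card_site_le (hn : n ≤ 5) (G : Finset (Fin n)) : Fintype.card G ≤ 5 := by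
  rw [Fintype.card_coe]
  exact (Finset.card_le_univ G).trans (by simpa using hn)

theorem Label.card_shape (l : Label n) : l.shape.card = Fintype.card l.subsystem :=
  (card_of_tableau l.tableau.entry).symm

/-- Every Young operator of τ maps into the eigenspace given by the contents, which is already the
image of one of them; the supremum therefore collapses. -/
theorem Label.space_eq (hn : n ≤ 5) (l : Label n) :
    l.space = symmetrySpace (siteEmb l.subsystem) (sitePerm l.subsystem) l.tableau := by
  have hφ := sitePerm_apply l.subsystem
  have hmap := map_siteEmb l.subsystem
  refine le_antisymm (iSup₂_le fun P hP => ?_) ?_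
  · have h1 := map_le_contentSpace hφ hP
    have h2 := contentSpace_le_symmetrySpace hφ (card_site_le hn _) l.tableau
    have h3 := h1.trans h2
    rw [hmap] at h3
    exact h3
  · refine le_trans ?_ (le_iSup₂ _ l.tableau.exists_isYoungOperator.choose_spec)
    rw [symmetrySpace, hmap]
    exact le_rfl

theorem Label.space_eq_contentSpace (hn : n ≤ 5) (l : Label n) :
    l.space = contentSpace (sitePerm l.subsystem) (linOps l.subsystem) l.tableau.entry := by
  have h1 := symmetrySpace_le (sitePerm_apply l.subsystem) l.tableau
  have h2 := contentSpace_le_symmetrySpace (sitePerm_apply l.subsystem) (card_site_le hn _) l.tableau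
  rw [l.space_eq hn, le_antisymm h1 h2, map_siteEmb]

theorem finrank_tensorOperators_space (hn : n ≤ 5) (l : Label n) (j : ℕ) :
    Module.finrank ℂ (tensorOperators l.space j) = rankMultiplicity l.shape j := by
  have hc : l.shape.card ≤ 5 := l.card_shape ▸ card_site_le hn _
  rw [l.space_eq hn, finrank_tensorOperators_symmetrySpace (sitePerm_apply _) _
    (checkShape_of_card_le hc) (by omega), rankMultiplicity_eq_count (checkShape_of_card_le hc)
    (by omega)]

theorem iSup_space (hn : n ≤ 5) : ⨆ l : Label n, l.space = ⊤ := by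
  rw [eq_top_iff, ← iSup_linOps]
  refine iSup_le fun G => ?_
  rw [← map_siteEmb G, ← iSup_symmetrySpace (sitePerm_apply G) (card_site_le hn G)]
  refine iSup_le fun x => ?_
  rw [← Label.space_eq hn ⟨G, x.1, x.2⟩]
  exact le_iSup (fun l : Label n => l.space) ⟨G, x.1, x.2⟩

theorem ip_space (hn : n ≤ 5) {l l' : Label n} (h : l ≠ l') {X Y : Op n} (hX : X ∈ l.space)
    (hY : Y ∈ l'.space) : ip X Y = 0 := by
  rw [Label.space_eq_contentSpace hn] at hX hY
  obtain ⟨G, μ, p⟩ := l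
  obtain ⟨G', μ', q⟩ := l'
  by_cases hG : G = G'
  · subst hG
    refine ip_contentSpace (p := p) (q := q) (fun he => h ?_) hX hY
    obtain ⟨rfl, he⟩ := Sigma.mk.inj_iff.1 he
    rw [eq_of_heq he]
  · exact ip_linOps hG (mem_contentSpace.1 hX).1 (mem_contentSpace.1 hY).1

/-- In the description by contents this is immediate: permutations commute with the adjoint, and the
contents are real. -/
theorem conjTranspose_mem_space (hn : n ≤ 5) (l : Label n) {X : Op n} (hX : X ∈ l.space) :
    Xᴴ ∈ l.space := by
  rw [l.space_eq_contentSpace hn, mem_contentSpace] at hX ⊢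
  refine ⟨conjTranspose_mem_linOps hX.1, fun k => ?_⟩
  have h := congrArg Matrix.conjTranspose (hX.2 k)
  rw [Matrix.conjTranspose_smul] at h
  rw [← (show star (content l.tableau.entry k : ℂ) = (content l.tableau.entry k : ℂ) by simp), ← h]
  simp only [jucysMurphy, map_sum, LinearMap.sum_apply, symAct_of, Matrix.conjTranspose_sum]
  rfl

end Labels

/-! ### The phase convention -/

/-- The family `(-1)^m (T_{-m})ᴴ`. -/
def conjTensor {n : ℕ} (T : ℤ → Op n) (m : ℤ) : Op n := ((-1 : ℂ) ^ m) • (T (-m))ᴴ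

theorem neg_one_zpow_mul_self (m : ℤ) : ((-1 : ℂ) ^ m) * (-1) ^ m = 1 := by
  rw [← mul_zpow]
  simp

theorem conjTensor_conjTensor {n : ℕ} (T : ℤ → Op n) : conjTensor (conjTensor T) = T := by
  funext m
  rw [conjTensor, conjTensor, Matrix.conjTranspose_smul, Matrix.conjTranspose_conjTranspose,
    neg_neg, smul_smul, star_zpow₀, star_neg, star_one, zpow_neg, ← inv_zpow, inv_neg_one,
    neg_one_zpow_mul_self, one_smul]

theorem conjTensor_add {n : ℕ} (S T : ℤ → Op n) :
    conjTensor (S + T) = conjTensor S + conjTensor T := by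
  funext m
  simp only [conjTensor, Pi.add_apply, Matrix.conjTranspose_add, smul_add]

theorem conjTensor_smul {n : ℕ} (c : ℂ) (T : ℤ → Op n) :
    conjTensor (c • T) = star c • conjTensor T := by
  funext m
  simp only [conjTensor, Pi.smul_apply, Matrix.conjTranspose_smul]
  rw [smul_comm]

theorem adTotal_conjTranspose {n : ℕ} (M : Qubit) (X : Op n) :
    adTotal n M Xᴴ = -(adTotal n Mᴴ X)ᴴ := by
  rw [conjTranspose_adTotal, Matrix.conjTranspose_conjTranspose, neg_neg]

/-- Since [J_±, X†] = -[J_∓, X]†, the adjoint reverses m and introduces a sign at each step of the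
ladder, which (-1)^m compensates. -/
theorem conjTensor_mem {n : ℕ} {W : Submodule ℂ (Op n)} (hW : ∀ X ∈ W, Xᴴ ∈ W) {j : ℕ}
    {T : ℤ → Op n} (hT : T ∈ tensorOperators W j) : conjTensor T ∈ tensorOperators W j := by
  obtain ⟨h1, h2, h3⟩ := mem_tensorOperators.1 hT
  refine mem_tensorOperators.2 ⟨fun m => W.smul_mem _ (hW _ (h1 _)), fun m hm => ?_,
    fun m hm => ?_⟩
  · rw [conjTensor, h2 _ (by rwa [abs_neg]), Matrix.conjTranspose_zero, smul_zero]
  · obtain ⟨hz, hr, hl⟩ := h3 (-m) (by rwa [abs_neg])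
    simp only [conjTensor, map_smul, adTotal_conjTranspose, conjTranspose_spinZ,
      conjTranspose_spinRaise, conjTranspose_spinLower, hz, hr, hl, Matrix.conjTranspose_smul,
      Complex.star_def, Complex.conj_ofReal]
    refine ⟨?_, ?_, ?_⟩
    · rw [smul_comm, ← neg_smul]
      simp
    · rw [zpow_add_one₀ (by norm_num), neg_add', ← smul_neg, smul_comm, mul_neg_one, neg_smul,
        smul_neg]
      push_cast
      ring_nf
    · rw [zpow_sub_one₀ (by norm_num), neg_sub', sub_neg_eq_add, ← smul_neg, smul_comm, inv_neg_one,
        mul_neg_one, neg_smul, smul_neg]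
      push_cast
      ring_nf

/-! ### Orthogonality of tensor operators -/

section Orthogonality

variable {n : ℕ} {W W' : Submodule ℂ (Op n)} {j j' : ℕ} {T T' : ℤ → Op n}

/-- ‖J₊T_m‖² and ⟨T_m, J₋J₊T_m⟩ carry the same nonzero factor for m < j, so neighbouring components
have equal norms. -/
theorem ip_component_self (hT : T ∈ tensorOperators W j) {m : ℤ} (hm : |m| ≤ (j : ℤ)) :
    ip (T m) (T m) = ip (T j) (T j) := by
  obtain ⟨-, -, h⟩ := mem_tensorOperators.1 hT
  have key : ∀ k : ℕ, k ≤ 2 * j → ip (T (j - k)) (T (j - k)) = ip (T j) (T j) := by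
    intro k
    induction k with
    | zero => intro _; simp
    | succ k ih =>
      intro hk
      rw [← ih (by omega)]
      have hm : |(j : ℤ) - (k + 1 : ℕ)| ≤ (j : ℤ) := abs_le.2 ⟨by omega, by omega⟩
      have hc := ladder_pos (j := j) (m := (j : ℤ) - (k + 1 : ℕ)) (by omega) (by omega)
      have h1 := ip_raise (T (j - (k + 1 : ℕ))) (adTotal n spinRaise (T (j - (k + 1 : ℕ))))
      rw [lower_raise_tensorOperator hT hm, (h _ hm).2.1, ip_smul_left, ip_smul_right,
        ip_smul_right, Complex.star_def, Complex.conj_ofReal, ← mul_assoc,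
        sqrt_mul_sqrt_cast hc.le] at h1
      have h2 := mul_left_cancel₀ (by exact_mod_cast hc.ne') h1
      rw [← h2]
      have h3 : (j : ℤ) - (k + 1 : ℕ) + 1 = j - k := by push_cast; ring
      rw [h3]
  have hm' := abs_le.1 hm
  have := key (j - m).toNat (by omega)
  rwa [Int.toNat_of_nonneg (by omega), sub_sub_cancel] at this

/-- Different m are separated by J_z. For equal m the self-adjoint operator J₋J₊ has eigenvalues
j(j+1) - m(m+1), which separate the ranks. -/
theorem ip_component_of_ne (hT : T ∈ tensorOperators W j) (hT' : T' ∈ tensorOperators W' j')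
    {m m' : ℤ} (h : (j, m) ≠ (j', m')) : ip (T m) (T' m') = 0 := by
  obtain ⟨-, h0, h1⟩ := mem_tensorOperators.1 hT
  obtain ⟨-, h0', h1'⟩ := mem_tensorOperators.1 hT'
  by_cases hm : |m| ≤ (j : ℤ)
  swap
  · rw [h0 m (not_le.1 hm), ip_zero_left]
  by_cases hm' : |m'| ≤ (j' : ℤ)
  swap
  · rw [h0' m' (not_le.1 hm'), ip_zero_right]
  by_cases hmm : m = m'
  · subst hmm
    have h2 := ip_lower (adTotal n spinRaise (T m)) (T' m)
    rw [ip_raise, lower_raise_tensorOperator hT hm, lower_raise_tensorOperator hT' hm',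
      ip_smul_left, ip_smul_right, Complex.star_def, Complex.conj_ofReal] at h2
    by_contra hne
    have h3 := mul_right_cancel₀ hne h2
    rw [Complex.ofReal_inj, sub_left_inj] at h3
    have h4 : j * (j + 1) = j' * (j' + 1) := by exact_mod_cast h3
    refine h (Prod.ext ?_ rfl)
    nlinarith
  · exact weight_orthogonal (h1 m hm).1 (h1' m' hm').1 hmm

end Orthogonality

/-- `conjTensor` is an antilinear involution, so S + `conjTensor` S is fixed; if it vanishes, iS is
fixed. Dividing by a real norm preserves this, and all components have the same norm. -/
theorem exists_normalized_tensorOperator {n : ℕ} {W : Submodule ℂ (Op n)}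
    (hW : ∀ X ∈ W, Xᴴ ∈ W) {j : ℕ} (h : tensorOperators W j ≠ ⊥) :
    ∃ T ∈ tensorOperators W j, conjTensor T = T ∧ ∀ m : ℤ, |m| ≤ (j : ℤ) → ip (T m) (T m) = 1 := by
  obtain ⟨S, hS, hne⟩ : ∃ S ∈ tensorOperators W j, S ≠ 0 := (Submodule.ne_bot_iff _).1 h
  obtain ⟨R, hR, hR0, hRc⟩ : ∃ R ∈ tensorOperators W j, R ≠ 0 ∧ conjTensor R = R := by
    by_cases h0 : S + conjTensor S = 0
    · refine ⟨Complex.I • S, Submodule.smul_mem _ _ hS, smul_ne_zero Complex.I_ne_zero hne, ?_⟩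
      rw [conjTensor_smul, eq_neg_of_add_eq_zero_right h0]
      simp
    · refine ⟨S + conjTensor S, Submodule.add_mem _ hS (conjTensor_mem hW hS), h0, ?_⟩
      rw [conjTensor_add, conjTensor_conjTensor, add_comm]
  have hj : ip (R j) (R j) ≠ 0 := fun h => hR0 (tensorOperator_eq_zero hR (ip_self_eq_zero.1 h))
  have hr : 0 < (ip (R j) (R j)).re := lt_of_le_of_ne (ip_self_re_nonneg _) fun h => hj (by
    rw [ip_self_eq_re, ← h, Complex.ofReal_zero])
  refine ⟨((Real.sqrt (ip (R j) (R j)).re)⁻¹ : ℂ) • R, Submodule.smul_mem _ _ hR, ?_,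
    fun m hm => ?_⟩
  · rw [conjTensor_smul, hRc]
    simp
  · rw [Pi.smul_apply, ip_smul_left, ip_smul_right, ip_component_self hR hm, ← mul_assoc,
      star_inv₀, Complex.star_def, Complex.conj_ofReal, ← mul_inv, sqrt_mul_sqrt_cast hr.le,
      ← ip_self_eq_re, inv_mul_cancel₀ hj]

/-- The space is spanned by the images of words, which are weight vectors. -/
theorem symmetrySpace_le_componentSpan {μ : YoungDiagram} {α : Type} [Fintype α] [LinearOrder α]
    {n : ℕ} (e : α ↪ Fin n) (φ : Equiv.Perm α →* Equiv.Perm (Fin n)) (τ : StdTableau μ α) :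
    symmetrySpace e φ τ ≤ componentSpan (symmetrySpace e φ τ) := by
  conv_lhs => rw [symmetrySpace, ← span_wordOp, Submodule.map_span]
  rw [Submodule.span_le]
  rintro _ ⟨_, ⟨f, rfl⟩, rfl⟩
  refine weightSpace_le_componentSpan (ladderStable_map _) (wordWeight f)
    (mem_weightSpace.2 ⟨?_, ?_⟩)
  · refine Submodule.mem_map_of_mem ?_
    rw [← span_wordOp]
    exact Submodule.subset_span ⟨f, rfl⟩
  · rw [← symAct_adTotal, wordOp_weight, map_smul]

/-- The ambient space of families indexed by ℤ is infinite-dimensional, but the top component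
determines the family. -/
instance finite_tensorOperators {n : ℕ} (W : Submodule ℂ (Op n)) (j : ℕ) :
    Module.Finite ℂ (tensorOperators W j) := by
  refine Module.Finite.of_injective ((LinearMap.proj (R := ℂ) (φ := fun _ : ℤ => Op n) (j : ℤ)) ∘ₗ
    (tensorOperators W j).subtype) ?_
  rw [← LinearMap.ker_eq_bot, LinearMap.ker_eq_bot']
  rintro ⟨T, hT⟩ h
  exact Subtype.ext (tensorOperator_eq_zero hT h)

/-! ### The LISA basis -/

section Basis

variable {n : ℕ}

theorem TensorLabel.ext_rank {l l' : TensorLabel n} (h : l.toLabel = l'.toLabel)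
    (hr : l.rank = l'.rank) : l = l' := by
  obtain ⟨l, j, hj⟩ := l
  obtain ⟨l', j', hj'⟩ := l'
  obtain rfl : l = l' := h
  obtain rfl : j = j' := hr
  rfl

theorem TensorLabel.finrank_eq_one (hn : n ≤ 5) (l : TensorLabel n) :
    Module.finrank ℂ (tensorOperators l.space l.rank) = 1 := by
  have hc : l.shape.card ≤ 5 := l.card_shape ▸ card_site_le hn _
  have h := l.occurs
  rw [finrank_tensorOperators_space hn]
  rw [rankMultiplicity_of_card_le hc] at h ⊢
  split_ifs at h ⊢
  · rfl
  · omega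

theorem TensorLabel.exists_eq_smul (hn : n ≤ 5) (l : TensorLabel n) {T T' : ℤ → Op n}
    (hT : T ∈ tensorOperators l.space l.rank) (hne : T ≠ 0)
    (hT' : T' ∈ tensorOperators l.space l.rank) : ∃ c : ℂ, T' = c • T := by
  obtain ⟨c, hc⟩ := (finrank_eq_one_iff_of_nonzero' (⟨T, hT⟩ : tensorOperators l.space l.rank)
    fun h => hne (congrArg Subtype.val h)).1 (l.finrank_eq_one hn) ⟨T', hT'⟩
  exact ⟨c, (congrArg Subtype.val hc).symm⟩

theorem span_components_eq_top (hn : n ≤ 5) {T : TensorLabel n → ℤ → Op n}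
    (hT : ∀ l, T l ∈ tensorOperators l.space l.rank) (hne : ∀ l, T l ≠ 0) :
    Submodule.span ℂ (Set.range fun x : TensorLabel n × ℤ => T x.1 x.2) = ⊤ := by
  rw [eq_top_iff, ← iSup_space hn]
  refine iSup_le fun l => ?_
  have h1 : l.space ≤ componentSpan l.space := by
    rw [l.space_eq hn]
    exact symmetrySpace_le_componentSpan _ _ _
  refine h1.trans (Submodule.span_le.2 ?_)
  rintro _ ⟨j, S, hS, m, rfl⟩
  by_cases h : 0 < rankMultiplicity l.shape j
  · obtain ⟨c, rfl⟩ := TensorLabel.exists_eq_smul hn ⟨l, j, h⟩ (hT _) (hne _) hS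
    exact Submodule.smul_mem _ _ (Submodule.subset_span ⟨(⟨l, j, h⟩, m), rfl⟩)
  · have h0 := finrank_tensorOperators_space hn l j
    rw [Nat.eq_zero_of_not_pos h] at h0
    rw [Submodule.finrank_eq_zero] at h0
    rw [h0, Submodule.mem_bot] at hS
    rw [hS]
    exact Submodule.zero_mem _

theorem exists_isLISABasis (hn : n ≤ 5) :
    ∃ T : TensorLabel n → ℤ → Op n, IsLISABasis T ∧
      ∀ T' : TensorLabel n → ℤ → Op n, IsLISABasis T' → ∀ l, T' l = T l ∨ T' l = -T l := by
  choose T hT hc h1 using fun l : TensorLabel n =>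
    exists_normalized_tensorOperator (W := l.space) (j := l.rank)
      (fun X hX => conjTranspose_mem_space hn l.toLabel hX)
      fun h => by
        have := l.finrank_eq_one hn
        rw [h, finrank_bot] at this
        omega
  have hne : ∀ l, T l ≠ 0 := fun l h => by
    have := h1 l l.rank (by simp)
    rw [h, Pi.zero_apply, ip_zero_left] at this
    exact zero_ne_one this
  refine ⟨T, ⟨hT, fun l m => (congrFun (hc l) m).symm, h1, fun l l' m m' h => ?_,
    span_components_eq_top hn hT hne⟩, fun T' hT' l => ?_⟩
  · change ip _ _ = 0
    by_cases hl : l.toLabel = l'.toLabel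
    · refine ip_component_of_ne (hT l) (hT l') fun he => h ?_
      rw [Prod.mk.injEq] at he
      rw [TensorLabel.ext_rank hl he.1, he.2]
    · exact ip_space hn hl ((mem_tensorOperators.1 (hT l)).1 m)
        ((mem_tensorOperators.1 (hT l')).1 m')
  -- Uniqueness: T' = cT, where the phase convention forces c to be real and the normalisation
  -- forces c² = 1.
  · obtain ⟨c, h⟩ := l.exists_eq_smul hn (hT l) (hne l) (hT'.mem l)
    have h2 : star c = c := by
      have h3 : conjTensor (T' l) = T' l := funext fun m => (hT'.phase l m).symm
      rw [h, conjTensor_smul, hc] at h3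
      exact smul_left_injective ℂ (hne l) h3
    have h4 : ip (T' l l.rank) (T' l l.rank) = 1 := hT'.normalized l l.rank (by simp)
    rw [h, Pi.smul_apply, ip_smul_left, ip_smul_right, h1 l l.rank (by simp), h2, mul_one,
      mul_self_eq_one_iff] at h4
    rcases h4 with rfl | rfl
    · exact Or.inl (by rw [h, one_smul])
    · exact Or.inr (by rw [h, neg_one_smul])

end Basis

/-! ### Linear operators as a tensor power of the vector representation -/

/-- The binary quadratic form attached to a traceless matrix. -/
def quadForm (A : Qubit) : MvPolynomial (Fin 2) ℂ :=
  MvPolynomial.C (-A 0 1) * (MvPolynomial.X 0 * MvPolynomial.X 0) +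
    MvPolynomial.C (A 0 0 - A 1 1) * (MvPolynomial.X 0 * MvPolynomial.X 1) +
    MvPolynomial.C (A 1 0) * (MvPolynomial.X 1 * MvPolynomial.X 1)

/-- The form is xᵀAεx with ε = (0 1; -1 0). Substitution replaces A ε by U A ε Uᵀ, and εUᵀ =
adj(U)ε. On SU(2) the adjugate is the inverse, so this is conjugation. -/
theorem substAlg_quadForm (U A : Qubit) :
    substAlg U (quadForm A) = quadForm (U * (A * U.adjugate)) := by
  simp only [quadForm, substAlg, map_add, map_mul, MvPolynomial.aeval_X, MvPolynomial.algHom_C,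
    MvPolynomial.algebraMap_eq, Matrix.adjugate_fin_two, Matrix.mul_apply, Fin.sum_univ_two,
    Matrix.of_apply, Matrix.cons_val_zero, Matrix.cons_val_one, map_neg, map_sub]
  ring

theorem quadForm_mem (A : Qubit) :
    quadForm A ∈ MvPolynomial.homogeneousSubmodule (Fin 2) ℂ (2 * 1) := by
  have h : ∀ (c : ℂ) (i k : Fin 2), MvPolynomial.C c * (MvPolynomial.X i * MvPolynomial.X k) ∈
      MvPolynomial.homogeneousSubmodule (Fin 2) ℂ (2 * 1) := fun c i k => by
    simpa using (MvPolynomial.isHomogeneous_C (Fin 2) c).mul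
      ((MvPolynomial.isHomogeneous_X ℂ i).mul (MvPolynomial.isHomogeneous_X ℂ k))
  exact Submodule.add_mem _ (Submodule.add_mem _ (h _ _ _) (h _ _ _)) (h _ _ _)

/-- The coefficients of a matrix in the basis `letter`. -/
def letterCoeff (p : MvPolynomial (Fin 2) ℂ) : Fin 3 → ℂ :=
  ![p.coeff (Finsupp.single 1 2), p.coeff (Finsupp.single 0 1 + Finsupp.single 1 1) / 2,
    -p.coeff (Finsupp.single 0 2)]

theorem coeff_C_mul_X_mul_X (c : ℂ) (i k : Fin 2) (d : Fin 2 →₀ ℕ) :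
    (MvPolynomial.C c * (MvPolynomial.X i * MvPolynomial.X k)).coeff d =
      if Finsupp.single i 1 + Finsupp.single k 1 = d then c else 0 := by
  rw [MvPolynomial.coeff_C_mul, MvPolynomial.X, MvPolynomial.X, MvPolynomial.monomial_mul,
    MvPolynomial.coeff_monomial]
  split_ifs <;> simp

theorem coeff_quadForm (A : Qubit) (d : Fin 2 →₀ ℕ) :
    (quadForm A).coeff d = (if d 0 = 2 ∧ d 1 = 0 then -A 0 1 else 0) +
      (if d 0 = 1 ∧ d 1 = 1 then A 0 0 - A 1 1 else 0) +
      (if d 0 = 0 ∧ d 1 = 2 then A 1 0 else 0) := by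
  simp only [quadForm, MvPolynomial.coeff_add, coeff_C_mul_X_mul_X, Finsupp.ext_iff,
    Fin.forall_fin_two, Finsupp.add_apply, Finsupp.single_apply]
  simp [eq_comm]

theorem letterCoeff_quadForm (v : Fin 3 → ℂ) :
    letterCoeff (quadForm (∑ i, v i • letter i)) = v := by
  funext i
  fin_cases i <;>
    simp [letterCoeff, coeff_quadForm, Fin.sum_univ_three, letter]

theorem quadForm_letterCoeff {p : MvPolynomial (Fin 2) ℂ}
    (hp : p ∈ MvPolynomial.homogeneousSubmodule (Fin 2) ℂ (2 * 1)) :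
    quadForm (∑ i, letterCoeff p i • letter i) = p := by
  ext d
  rw [coeff_quadForm]
  by_cases hd : d.degree = 2
  · rw [Finsupp.degree_eq_sum, Fin.sum_univ_two] at hd
    have key : ∀ a b : ℕ, d 0 = a → d 1 = b → d = Finsupp.single 0 a + Finsupp.single 1 b := by
      rintro a b rfl rfl
      ext i
      fin_cases i <;> simp
    obtain ⟨h0, h1⟩ | ⟨h0, h1⟩ | ⟨h0, h1⟩ :
        (d 0 = 2 ∧ d 1 = 0) ∨ (d 0 = 1 ∧ d 1 = 1) ∨ (d 0 = 0 ∧ d 1 = 2) := by omega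
    all_goals
      rw [h0, h1, key _ _ h0 h1]
      simp [letterCoeff, Fin.sum_univ_three, letter, Matrix.add_apply]
  · have h0 := MvPolynomial.IsHomogeneous.coeff_eq_zero
      ((MvPolynomial.mem_homogeneousSubmodule _ _).1 hp) (d := d) hd
    rw [Finsupp.degree_eq_sum, Fin.sum_univ_two] at hd
    rw [h0, if_neg (by omega), if_neg (by omega), if_neg (by omega)]
    simp

/-- The basis of the vector representation that corresponds to `letter`. -/
def letterBasis : Module.Basis (Fin 3) ℂ (SpinSpace 1) :=
  Module.Basis.ofEquivFun
    { toFun := fun p => letterCoeff p.1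
      invFun := fun v => ⟨quadForm (∑ i, v i • letter i), quadForm_mem _⟩
      map_add' := fun p q => by
        funext i
        fin_cases i <;> simp [letterCoeff, add_div, add_comm]
      map_smul' := fun c p => by
        funext i
        fin_cases i <;> simp [letterCoeff]; ring
      left_inv := fun p => Subtype.ext (quadForm_letterCoeff p.2)
      right_inv := letterCoeff_quadForm }

/-- The isomorphism of the vector representation with the traceless matrices. -/
def spinMat : SpinSpace 1 →ₗ[ℂ] Qubit := letterBasis.constr ℂ letter

theorem spinMat_apply (p : SpinSpace 1) : spinMat p = ∑ i, letterCoeff p.1 i • letter i := by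
  rw [spinMat, Module.Basis.constr_apply_fintype]
  rfl

theorem trace_spinMat (p : SpinSpace 1) : (spinMat p).trace = 0 := by
  simp [spinMat_apply, Matrix.trace_sum, Matrix.trace_smul, trace_letter]

theorem spinMat_spinRep (U : SU2) (p : SpinSpace 1) :
    spinMat (spinRep 1 U p) = U.1 * (spinMat p * (U⁻¹).1) := by
  have hdet : U.1.det = 1 := (Matrix.mem_specialUnitaryGroup_iff.1 U.2).2
  have hinv : (U⁻¹).1 = U.1.adjugate := by
    have h1 : (U⁻¹).1 * U.1 = 1 := congrArg Subtype.val (inv_mul_cancel U)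
    have h2 : U.1 * U.1.adjugate = 1 := by rw [Matrix.mul_adjugate, hdet, one_smul]
    exact left_inv_eq_right_inv h1 h2
  have htr : (U.1 * (spinMat p * (U⁻¹).1)).trace = 0 := by
    rw [Matrix.trace_mul_comm, mul_assoc, hinv, Matrix.adjugate_mul, hdet, one_smul, mul_one,
      trace_spinMat]
  have h : (spinRep 1 U p).1 = quadForm (U.1 * (spinMat p * (U⁻¹).1)) := by
    rw [hinv, ← substAlg_quadForm, spinMat_apply, quadForm_letterCoeff p.2]
    rfl
  rw [spinMat_apply, h, eq_sum_letter htr, letterCoeff_quadForm]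

/-- The isomorphism of the tensor power of the vector representation with the linear operators. -/
def tensorPowerEquiv (g : ℕ) :
    (⨂[ℂ] _ : Fin g, SpinSpace 1) ≃ₗ[ℂ] linOps (Finset.univ : Finset (Fin g)) :=
  ((Basis.piTensorProduct fun _ : Fin g => letterBasis).equiv
    (Module.Basis.span (linearIndependent_wordOp (Function.Embedding.refl (Fin g))))
    (Equiv.refl _)).trans
    (LinearEquiv.ofEq _ _ (by rw [span_wordOp, Finset.map_refl]))

/-- Both sides are multilinear and agree on basis tensors. This description, free of bases, makes
the equivariance a check on one factor. -/
theorem tensorPowerEquiv_tprod {g : ℕ} (p : Fin g → SpinSpace 1) :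
    (tensorPowerEquiv g (PiTensorProduct.tprod ℂ p)).1 = prodOp fun k => spinMat (p k) := by
  have h : (linOps (Finset.univ : Finset (Fin g))).subtype ∘ₗ (tensorPowerEquiv g).toLinearMap =
      PiTensorProduct.lift ((embedOp (Function.Embedding.refl (Fin g))).compLinearMap
        fun _ => spinMat) := by
    refine (Basis.piTensorProduct fun _ : Fin g => letterBasis).ext fun f => ?_
    rw [LinearMap.comp_apply, LinearEquiv.coe_coe, tensorPowerEquiv, LinearEquiv.trans_apply,
      Module.Basis.equiv_apply, Basis.piTensorProduct_apply, PiTensorProduct.lift.tprod]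
    change (Module.Basis.span (linearIndependent_wordOp (Function.Embedding.refl (Fin g))) f).1 = _
    rw [Module.Basis.span_apply, MultilinearMap.compLinearMap_apply]
    change embedOp _ (fun a => letter (f a)) = _
    congr 1
    funext k
    rw [spinMat, Module.Basis.constr_basis]
  have h1 := LinearMap.congr_fun h (PiTensorProduct.tprod ℂ p)
  rw [PiTensorProduct.lift.tprod, MultilinearMap.compLinearMap_apply, embedOp_apply,
    siteMats_refl] at h1
  exact h1

theorem tensorPowerRep_equiv_linRep (g : ℕ) : Nonempty ((tensorPowerRep g).Equiv (linRep g)) := by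
  refine ⟨Representation.Equiv.mk (tensorPowerEquiv g) fun x => ?_⟩
  refine PiTensorProduct.ext (MultilinearMap.ext fun p => Subtype.ext ?_)
  have h1 : tensorPowerRep g x (PiTensorProduct.tprod ℂ p) =
      PiTensorProduct.tprod ℂ (s := fun _ : Fin g => SpinSpace 1)
        fun k => (spinRep 1 x.1 (p (x.2⁻¹ k)) : SpinSpace 1) := by
    change PiTensorProduct.reindex ℂ _ x.2 (PiTensorProduct.map (fun _ : Fin g => spinRep 1 x.1)
      (PiTensorProduct.tprod ℂ p)) = _
    rw [PiTensorProduct.map_tprod, PiTensorProduct.reindex_tprod]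
    rfl
  have h2 : ∀ X : linOps (Finset.univ : Finset (Fin g)), (linRep g x X).1 = opRep g x X.1 :=
    fun X => rfl
  change (tensorPowerEquiv g (tensorPowerRep g x (PiTensorProduct.tprod ℂ p))).1 =
    (linRep g x (tensorPowerEquiv g (PiTensorProduct.tprod ℂ p))).1
  rw [h1, h2, tensorPowerEquiv_tprod, tensorPowerEquiv_tprod]
  simp [opRep, rotRep, permRep_prodOp, prodOp_mul, spinMat_spinRep]

end SpinTensor

end

theorem mainTheorem2 :
    (∀ g : ℕ, Nonempty
      ((SpinTensor.tensorPowerRep g).Equiv (SpinTensor.linRep g))) ∧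
    (∀ lam : YoungDiagram, lam.card ≤ 5 → ∀ j : ℕ,
      SpinTensor.rankMultiplicity lam j ≤ 1 ∧
      (SpinTensor.rankMultiplicity lam j = 1 ↔ j ∈ SpinTensor.rankTable lam.rowLens)) ∧
    (∀ n : ℕ, n ≤ 5 →
      (∀ (l : SpinTensor.Label n) (j : ℕ),
        Module.finrank ℂ (SpinTensor.tensorOperators l.space j) =
          SpinTensor.rankMultiplicity l.shape j) ∧
      ∃ T : SpinTensor.TensorLabel n → ℤ → SpinTensor.Op n,
        SpinTensor.IsLISABasis T ∧
        ∀ T' : SpinTensor.TensorLabel n → ℤ → SpinTensor.Op n,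
          SpinTensor.IsLISABasis T' → ∀ l, T' l = T l ∨ T' l = -T l) ∧
    SpinTensor.rankMultiplicity (YoungDiagram.ofRowLens [4, 2] (by decide)) 2 = 2 := by
  refine ⟨SpinTensor.tensorPowerRep_equiv_linRep, fun lam h j => ?_, fun n hn =>
    ⟨SpinTensor.finrank_tensorOperators_space hn, SpinTensor.exists_isLISABasis hn⟩,
    SpinTensor.rankMultiplicity_four_two⟩
  rw [SpinTensor.rankMultiplicity_of_card_le h]
  split_ifs with hj <;> simp [hj]
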